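/- **Conventions.** Let $k\in\mathbb N$ and let $U\subset\mathbb C^k$ be open and connected. A *complex of Hilbert spaces* $D=(X,d)$ consists of complex Hilbert spaces $X_j$, $j\in\mathbb Z$, with $X_j=\{0\}$ for all sufficiently large $|j|$, and bounded operators $d_j:X_j\to X_{j-1}$ with $d_{j-1}d_j=0$. Put $X_+=\bigoplus_i X_{2i}$, $X_-=\bigoplus_i X_{2i-1}$; then $D$ is also a $\mathbb Z/2\mathbb Z$-graded complex with differentials $d_+:X_+\to X_-$, $d_-:X_-\to X_+$, homology $H_+(D)=\ker d_+/\operatorname{im}d_-$, $H_-(D)=\ker d_- /\operatorname{im}d_+$, and, if the homology is finite dimensional ($D$ is *Fredholm*), determinant line $|D|=|H_+(D)|\otimes|H_-(D)|^*$, where $|V|=\Lambda^{\dim V}V$. For $0\ne v\in|V|$, $v^*\in|V|^*$ is the functional with $v^*(v)=1$. A *pseudo-inverse* of a linear map $A$ is a linear map $A^\dagger$ with $AA^\dagger A=A$ and $A^\dagger AA^\dagger=A^\dagger$. For a linear operator $T$ with $1-T$ of finite rank, $\det T$ is the determinant of its restriction to a finite dimensional invariant subspace that contains $\operatorname{im}(1-T)$.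 **Perturbation isomorphism.** (a) Let $A,B:V\to W$ be Fredholm linear maps between vector spaces such that $A-B$ has finite rank. Choose pseudo-inverses $A^\dagger,B^\dagger$ and put $P_A=1-A^\dagger A$, $Q_B=1-BB^\dagger$; these are idempotents with images $\ker A$ and $\ker B^\dagger$. If the common index is $\le0$, choose linear maps $L:\ker A\to W$, $M:\ker B^\dagger\to V$ and $N:\ker B^\dagger\to W$ such that $L$ induces an injection $\ker A\to\operatorname{coker}A$, $M$ induces a surjection $\ker B^\dagger\to\operatorname{coker}B^\dagger$, $N$ induces an isomorphism $\ker M\to W/(\operatorname{im}A+\operatorname{im}L)$, and $N$ vanishes on a complement of $\ker M$. With $\Sigma=(A+LP_A)(B^\dagger+MQ_B)+NQ_B$, the perturbation isomorphism $P(B,A):|\ker A|\otimes|\operatorname{coker}A|^*\to|\ker B|\otimes|\operatorname{coker}B|^*$ is $$s\otimes(Ls\wedge Nt_1)^*\mapsto\det(\Sigma)^{-1}\,Mt_0\otimes(t_0\wedge t_1)^*$$ for nonzero $s\in|\ker A|$, $t_1\in|\ker M|$, $t_0\in|\ker N|$. If the common index is $\ge0$, choose linear maps $L:\ker A\to W$,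 $M:\ker B^\dagger\to V$ and $N:\ker A\to V$ such that $L$ induces a surjection $\ker A\to\operatorname{coker}A$, $M$ induces an injection $\ker B^\dagger\to\operatorname{coker}B^\dagger$, $N$ induces an isomorphism $\ker L\to V/(\operatorname{im}M+\operatorname{im}B^\dagger)$, and $N$ vanishes on a complement of $\ker L$. With $\Sigma=(B^\dagger+MQ_B)(A+LP_A)+NP_A$, it is $$(s_0\wedge s_1)\otimes(Ls_1)^*\mapsto\det(\Sigma)^{-1}(Ns_0\wedge Mt)\otimes t^*$$ for nonzero $s_0\in|\ker L|$, $s_1\in|\ker N|$, $t\in|\operatorname{coker}B|$. In both cases the canonical isomorphisms $\ker B\cong\operatorname{coker}B^\dagger$ and $\ker B^\dagger\cong\operatorname{coker}B$ are used. (b) Let $D=(V,d)$ and $E=(V,\delta)$ be $\mathbb Z/2\mathbb Z$-graded Fredholm complexes on the same spaces $V_\pm$ such that $d_\pm-\delta_\pm$ have finite rank. Choose $\mathbb Z/2\mathbb Z$-graded Fredholm complexes $D^\dagger:V_-\xrightarrow{d_+^\dagger}V_+\xrightarrow{d_-^\dagger}V_-$ and $E^\dagger:V_-\xrightarrow{\delta_+^\dagger}V_+\xrightarrow{\delta_-^\dagger}V_-$,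 made of pseudo-inverses of $d_\pm$ and $\delta_\pm$, such that the differences $d_\pm^\dagger-\delta_\pm^\dagger$ have finite rank. Then $P(E,D):|D|\to|E|$ is the perturbation isomorphism from $d_++d_-^\dagger$ to $\delta_++\delta_-^\dagger$, under the canonical isomorphisms $H_+(D)\cong\ker(d_++d_-^\dagger)$, $H_-(D)\cong\operatorname{coker}(d_++d_-^\dagger)$ and the analogous ones for $E$. **Proposition.** For $z\in U$ let $D^z=(X,d^z)$ and $\Delta^z=(Y,\delta^z)$ be exact complexes of Hilbert spaces (the spaces $X_j,Y_j$ do not depend on $z$) such that $z\mapsto d_j^z$ and $z\mapsto\delta_j^z$ are holomorphic in operator norm on $U$ for all $j$. Let $C$ and $\Gamma$ be complexes with zero differentials, with finite dimensional spaces $C_j,\Gamma_j$, zero for all large $|j|$, and of index zero: $\dim C_+=\dim C_-$ and $\dim\Gamma_+=\dim\Gamma_-$. Let $X_j\oplus C_j=Y_j\oplus\Gamma_j$ for all $j$ (equality of Hilbert spaces, or identification by fixed bounded linear isomorphisms that do not depend on $z$). Suppose that, for all $j$, the difference $(d_j^z\oplus0)-(\delta_j^z\oplus0):X_j\oplus C_j\to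 X_{j-1}\oplus C_{j-1}$ has finite rank for all $z\in U$ and is a holomorphic function of $z\in U$ with values in the Banach space $\mathcal L^1(X_j\oplus C_j,X_{j-1}\oplus C_{j-1})$ of trace class operators with the norm $\|T\|_1=\operatorname{Tr}|T|$. Fix nonzero vectors $\omega_\pm\in|C_\pm|$ and $\eta_\pm\in|\Gamma_\pm|$, and define $i_C:\mathbb C\to|C|=|D^z\oplus C|$ by $1\mapsto\omega_+\otimes\omega_-^*$ and $i_\Gamma:\mathbb C\to|\Gamma|=|\Delta^z\oplus\Gamma|$ by $1\mapsto\eta_+\otimes\eta_-^*$. Then, for each $z\in U$, the maps $i_C$ and $i_\Gamma$ are isomorphisms and the perturbation isomorphism $P(\Delta^z\oplus\Gamma,D^z\oplus C)$ exists and does not depend on the choices in its definition, and the function $$U\to\mathbb C^*,\qquad z\mapsto i_\Gamma^{-1}\,P(\Delta^z\oplus\Gamma,\,D^z\oplus C)\,i_C$$ takes nonzero values and is holomorphic. -/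

import Mathlib

open scoped TensorProduct DirectSum InnerProductSpace Topology

noncomputable section Determinants

variable {𝕜 : Type*} [Field 𝕜]
variable {V : Type*} [AddCommGroup V] [Module 𝕜 V]
variable {W : Type*} [AddCommGroup W] [Module 𝕜 W]

/-- The determinant line `|V| = Λ^{dim V}(V)` of a finite dimensional vector space. -/
abbrev DetLine (𝕜 : Type*) [Field 𝕜] (V : Type*) [AddCommGroup V] [Module 𝕜 V] : Type _ :=
  ⋀[𝕜]^(Module.finrank 𝕜 V) V

open Classical in
/-- An element of the exterior algebra of degree `dim V`, seen as an element of `|V|`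
(elements that are not of top degree are sent to `0`). -/
def toDetLine (x : ExteriorAlgebra 𝕜 V) : DetLine 𝕜 V :=
  if h : x ∈ ⋀[𝕜]^(Module.finrank 𝕜 V) V then ⟨x, h⟩ else 0

theorem ExteriorAlgebra_map_mem_exteriorPower (f : V →ₗ[𝕜] W) {n : ℕ} {x : ExteriorAlgebra 𝕜 V}
    (hx : x ∈ ⋀[𝕜]^n V) : ExteriorAlgebra.map f x ∈ ⋀[𝕜]^n W := by
  rw [← ExteriorAlgebra.ιMulti_span_fixedDegree] at hx ⊢
  induction hx using Submodule.span_induction with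
  | mem x hx =>
    obtain ⟨v, rfl⟩ := hx
    rw [ExteriorAlgebra.map_apply_ιMulti]
    exact Submodule.subset_span ⟨_, rfl⟩
  | zero => simp
  | add x y _ _ hx hy => rw [map_add]; exact Submodule.add_mem _ hx hy
  | smul a x _ hx => rw [map_smul]; exact Submodule.smul_mem _ _ hx

open Classical in
/-- The map `|f| : |V| → |W|` induced by a linear map between spaces of the same finite dimension;
it is used for isomorphisms (between spaces of different dimensions it is `0`). -/
def detMap (f : V →ₗ[𝕜] W) : DetLine 𝕜 V →ₗ[𝕜] DetLine 𝕜 W :=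
  if h : Module.finrank 𝕜 V = Module.finrank 𝕜 W then
    (ExteriorAlgebra.map f).toLinearMap.restrict fun _ hx =>
      h ▸ ExteriorAlgebra_map_mem_exteriorPower f hx
  else 0

/-- The dual vector `v^* ∈ |V|^*` of a nonzero vector `v ∈ |V|`: since `|V|` is a line, it is the
unique functional with `v^*(v) = 1`. -/
def dualVector (v : DetLine 𝕜 V) : Module.Dual 𝕜 (DetLine 𝕜 V) :=
  Classical.epsilon fun φ => φ v = 1

theorem one_sub_range_invariant (T : V →ₗ[𝕜] V) :
    ∀ x ∈ (LinearMap.id - T).range, T x ∈ (LinearMap.id - T).range := by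
  rintro _ ⟨y, rfl⟩
  exact ⟨T y, by simp⟩

/-- The determinant of an operator `T` such that `1 - T` has finite rank: the determinant of the
restriction of `T` to the finite dimensional invariant subspace `Im (1 - T)`. -/
def finiteRankDet (T : V →ₗ[𝕜] V) : 𝕜 :=
  LinearMap.det (T.restrict (one_sub_range_invariant T))

/-- A linear map has finite rank. -/
def FiniteRank (f : V →ₗ[𝕜] W) : Prop := FiniteDimensional 𝕜 f.range

/-- A linear map is Fredholm: its kernel and its cokernel are finite dimensional. -/
structure IsFredholmMap (A : V →ₗ[𝕜] W) : Prop where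
  ker : FiniteDimensional 𝕜 A.ker
  coker : FiniteDimensional 𝕜 (W ⧸ A.range)

/-- `A'` is a pseudo-inverse of `A`: `A A'` is an idempotent with image `Im A`, `1 - A' A` is an
idempotent with image `Ker A`, and `1 - A A'` has image `Ker A'`. -/
structure IsPseudoInverse (A : V →ₗ[𝕜] W) (A' : W →ₗ[𝕜] V) : Prop where
  left : ∀ x, A (A' (A x)) = A x
  right : ∀ y, A' (A (A' y)) = A' y

theorem IsPseudoInverse.symm {A : V →ₗ[𝕜] W} {A' : W →ₗ[𝕜] V} (h : IsPseudoInverse A A') :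
    IsPseudoInverse A' A := ⟨h.right, h.left⟩

/-- The idempotent `P_A = 1 - A' A`, as a map onto its image `Ker A`. For `h.symm` it is the
idempotent `Q_A = 1 - A A'`, as a map onto its image `Ker A'`. -/
def IsPseudoInverse.kerProj {A : V →ₗ[𝕜] W} {A' : W →ₗ[𝕜] V} (h : IsPseudoInverse A A') :
    V →ₗ[𝕜] A.ker :=
  (LinearMap.id - A' ∘ₗ A).codRestrict A.ker fun x => by simp [h.left]

end Determinants

noncomputable section FredholmMaps

variable {𝕜 : Type*} [Field 𝕜]
variable {V : Type*} [AddCommGroup V] [Module 𝕜 V]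
variable {W : Type*} [AddCommGroup W] [Module 𝕜 W]

/-- The line `det (Ker A) ⊗ det (Coker A)^*`. -/
abbrev FredholmDet (A : V →ₗ[𝕜] W) : Type _ :=
  DetLine 𝕜 A.ker ⊗[𝕜] Module.Dual 𝕜 (DetLine 𝕜 (W ⧸ A.range))

/-- Perturbation triples `(L, M, N)` in nonpositive index. The map `N` is defined on all of
`Ker B'`; it is an isomorphism from `Ker M` onto `W / (Im A + Im L)` and vanishes on a complement
of `Ker M`, which is then `Ker N`. -/
structure IsPerturbationTripleNonpos (A : V →ₗ[𝕜] W) (B' : W →ₗ[𝕜] V)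
    (L : A.ker →ₗ[𝕜] W) (M : B'.ker →ₗ[𝕜] V) (N : B'.ker →ₗ[𝕜] W) : Prop where
  injective_L : Function.Injective (A.range.mkQ ∘ₗ L)
  surjective_M : Function.Surjective (B'.range.mkQ ∘ₗ M)
  bijective_N : Function.Bijective ((A.range ⊔ L.range).mkQ ∘ₗ N ∘ₗ M.ker.subtype)
  isCompl : IsCompl M.ker N.ker

/-- Perturbation triples `(L, M, N)` in nonnegative index. The map `N` is defined on all of
`Ker A`; it is an isomorphism from `Ker L` onto `V / (Im M + Im B')` and vanishes on a complement
of `Ker L`, which is then `Ker N`. -/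
structure IsPerturbationTripleNonneg (A : V →ₗ[𝕜] W) (B' : W →ₗ[𝕜] V)
    (L : A.ker →ₗ[𝕜] W) (M : B'.ker →ₗ[𝕜] V) (N : A.ker →ₗ[𝕜] V) : Prop where
  surjective_L : Function.Surjective (A.range.mkQ ∘ₗ L)
  injective_M : Function.Injective (B'.range.mkQ ∘ₗ M)
  bijective_N : Function.Bijective ((M.range ⊔ B'.range).mkQ ∘ₗ N ∘ₗ L.ker.subtype)
  isCompl : IsCompl L.ker N.ker

/-- `P` is given by the formula
`s ⊗ (L s ∧ N t₁)^* ↦ det(Σ)⁻¹ • (M t₀ ⊗ (t₀ ∧ t₁)^*)`, where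
`Σ = (A + L P_A) (B' + M Q_B) + N Q_B`. Here the canonical isomorphisms `Ker B ≅ Coker B'` and
`Ker B' ≅ Coker B` are used: the former has the inverse induced by `P_B`, the latter is the
restriction of the quotient map. -/
def IsPerturbationIsoNonpos (A B : V →ₗ[𝕜] W) (P : FredholmDet A →ₗ[𝕜] FredholmDet B) : Prop :=
  ∃ (A' B' : W →ₗ[𝕜] V) (hA : IsPseudoInverse A A') (hB : IsPseudoInverse B B')
    (L : A.ker →ₗ[𝕜] W) (M : B'.ker →ₗ[𝕜] V) (N : B'.ker →ₗ[𝕜] W),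
    IsPerturbationTripleNonpos A B' L M N ∧
    ∀ (s : DetLine 𝕜 A.ker) (t₁ : DetLine 𝕜 M.ker) (t₀ : DetLine 𝕜 N.ker),
      s ≠ 0 → t₁ ≠ 0 → t₀ ≠ 0 →
      P (s ⊗ₜ[𝕜] dualVector (toDetLine
          (ExteriorAlgebra.map (A.range.mkQ ∘ₗ L) s.1 *
            ExteriorAlgebra.map (A.range.mkQ ∘ₗ N ∘ₗ M.ker.subtype) t₁.1))) =
        (finiteRankDet ((A + L ∘ₗ hA.kerProj) ∘ₗ (B' + M ∘ₗ hB.symm.kerProj) +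
            N ∘ₗ hB.symm.kerProj))⁻¹ •
          (toDetLine (ExteriorAlgebra.map (hB.kerProj ∘ₗ M ∘ₗ N.ker.subtype) t₀.1) ⊗ₜ[𝕜]
            dualVector (toDetLine
              (ExteriorAlgebra.map (B.range.mkQ ∘ₗ B'.ker.subtype ∘ₗ N.ker.subtype) t₀.1 *
                ExteriorAlgebra.map (B.range.mkQ ∘ₗ B'.ker.subtype ∘ₗ M.ker.subtype) t₁.1)))

/-- `P` is given by the formula
`(s₀ ∧ s₁) ⊗ (L s₁)^* ↦ det(Σ)⁻¹ • ((N s₀ ∧ M t) ⊗ t^*)`, where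
`Σ = (B' + M Q_B) (A + L P_A) + N P_A`, with the same canonical isomorphisms
`Ker B ≅ Coker B'` and `Ker B' ≅ Coker B`. -/
def IsPerturbationIsoNonneg (A B : V →ₗ[𝕜] W) (P : FredholmDet A →ₗ[𝕜] FredholmDet B) : Prop :=
  ∃ (A' B' : W →ₗ[𝕜] V) (hA : IsPseudoInverse A A') (hB : IsPseudoInverse B B')
    (L : A.ker →ₗ[𝕜] W) (M : B'.ker →ₗ[𝕜] V) (N : A.ker →ₗ[𝕜] V),
    IsPerturbationTripleNonneg A B' L M N ∧
    ∀ (s₀ : DetLine 𝕜 L.ker) (s₁ : DetLine 𝕜 N.ker) (t : DetLine 𝕜 B'.ker),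
      s₀ ≠ 0 → s₁ ≠ 0 → t ≠ 0 →
      P (toDetLine (ExteriorAlgebra.map L.ker.subtype s₀.1 *
            ExteriorAlgebra.map N.ker.subtype s₁.1) ⊗ₜ[𝕜]
          dualVector (toDetLine
            (ExteriorAlgebra.map (A.range.mkQ ∘ₗ L ∘ₗ N.ker.subtype) s₁.1))) =
        (finiteRankDet ((B' + M ∘ₗ hB.symm.kerProj) ∘ₗ (A + L ∘ₗ hA.kerProj) +
            N ∘ₗ hA.kerProj))⁻¹ •
          (toDetLine (ExteriorAlgebra.map (hB.kerProj ∘ₗ N ∘ₗ L.ker.subtype) s₀.1 *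
              ExteriorAlgebra.map (hB.kerProj ∘ₗ M) t.1) ⊗ₜ[𝕜]
            dualVector (toDetLine (ExteriorAlgebra.map (B.range.mkQ ∘ₗ B'.ker.subtype) t.1)))

/-- `P` is a perturbation isomorphism from the Fredholm map `A` to its finite rank perturbation `B`,
computed from some choice of pseudo-inverses and of a perturbation triple. -/
def IsFredholmPerturbationIso (A B : V →ₗ[𝕜] W) (P : FredholmDet A →ₗ[𝕜] FredholmDet B) : Prop :=
  IsFredholmMap A ∧ IsFredholmMap B ∧ FiniteRank (A - B) ∧
    ((A.index ≤ 0 ∧ IsPerturbationIsoNonpos A B P) ∨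
      (0 ≤ A.index ∧ IsPerturbationIsoNonneg A B P))

end FredholmMaps

/-- A `ℤ/2ℤ`-graded chain complex `V₊ → V₋ → V₊`. -/
structure TwoPeriodicComplex (𝕜 : Type*) [Field 𝕜] (Vp Vm : Type*)
    [AddCommGroup Vp] [Module 𝕜 Vp] [AddCommGroup Vm] [Module 𝕜 Vm] where
  dp : Vp →ₗ[𝕜] Vm
  dm : Vm →ₗ[𝕜] Vp
  dm_dp : ∀ x, dm (dp x) = 0
  dp_dm : ∀ y, dp (dm y) = 0

namespace TwoPeriodicComplex

noncomputable section

variable {𝕜 : Type*} [Field 𝕜] {Vp Vm : Type*}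
variable [AddCommGroup Vp] [Module 𝕜 Vp] [AddCommGroup Vm] [Module 𝕜 Vm]

/-- `H₊(D) = Ker d₊ / Im d₋`. -/
abbrev HPlus (D : TwoPeriodicComplex 𝕜 Vp Vm) : Type _ :=
  D.dp.ker ⧸ D.dm.range.submoduleOf D.dp.ker

/-- `H₋(D) = Ker d₋ / Im d₊`. -/
abbrev HMinus (D : TwoPeriodicComplex 𝕜 Vp Vm) : Type _ :=
  D.dm.ker ⧸ D.dp.range.submoduleOf D.dm.ker

/-- The determinant line `|D| = |H₊(D)| ⊗ |H₋(D)|^*`. -/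
abbrev Det (D : TwoPeriodicComplex 𝕜 Vp Vm) : Type _ :=
  DetLine 𝕜 D.HPlus ⊗[𝕜] Module.Dual 𝕜 (DetLine 𝕜 D.HMinus)

/-- A `ℤ/2ℤ`-graded complex is Fredholm when its homology is finite dimensional. -/
structure IsFredholm (D : TwoPeriodicComplex 𝕜 Vp Vm) : Prop where
  plus : FiniteDimensional 𝕜 D.HPlus
  minus : FiniteDimensional 𝕜 D.HMinus

/-- `E` is a finite rank perturbation of `D`. -/
structure IsFiniteRankPerturbation (D E : TwoPeriodicComplex 𝕜 Vp Vm) : Prop where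
  plus : FiniteRank (D.dp - E.dp)
  minus : FiniteRank (D.dm - E.dm)

/-- A pseudo-inverse `V₋ → V₊ → V₋` of a Fredholm complex `D`: a Fredholm complex whose
differentials `D'.dp : V₋ → V₊` and `D'.dm : V₊ → V₋` are pseudo-inverses of `d₊` and `d₋`. -/
structure IsPseudoInv (D : TwoPeriodicComplex 𝕜 Vp Vm) (D' : TwoPeriodicComplex 𝕜 Vm Vp) :
    Prop where
  isFredholm : D'.IsFredholm
  plus : IsPseudoInverse D.dp D'.dp
  minus : IsPseudoInverse D.dm D'.dm

/-- The operator `σ₊ = d₊ + d₋' : V₊ → V₋`. -/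
def sigmaPlus (D : TwoPeriodicComplex 𝕜 Vp Vm) (D' : TwoPeriodicComplex 𝕜 Vm Vp) :
    Vp →ₗ[𝕜] Vm := D.dp + D'.dm

theorem IsPseudoInv.ker_sigmaPlus_le {D : TwoPeriodicComplex 𝕜 Vp Vm}
    {D' : TwoPeriodicComplex 𝕜 Vm Vp} (h : D.IsPseudoInv D') :
    (D.sigmaPlus D').ker ≤ D.dp.ker := by
  intro x hx
  have h0 : D.dp x + D'.dm x = 0 := hx
  have h1 := congrArg D'.dp h0
  rw [map_add, D'.dp_dm, add_zero, map_zero] at h1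
  rw [LinearMap.mem_ker, ← h.plus.left x, h1, map_zero]

theorem IsPseudoInv.range_dp_le {D : TwoPeriodicComplex 𝕜 Vp Vm}
    {D' : TwoPeriodicComplex 𝕜 Vm Vp} (h : D.IsPseudoInv D') :
    D.dp.range ≤ (D.sigmaPlus D').range := by
  rintro _ ⟨x, rfl⟩
  refine ⟨D'.dp (D.dp x), ?_⟩
  simp [sigmaPlus, D'.dm_dp, h.plus.left]

/-- The canonical isomorphism `Ker σ₊ → H₊(D)`, `x ↦ [x]`. -/
def IsPseudoInv.kerToHPlus {D : TwoPeriodicComplex 𝕜 Vp Vm}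
    {D' : TwoPeriodicComplex 𝕜 Vm Vp} (h : D.IsPseudoInv D') :
    (D.sigmaPlus D').ker →ₗ[𝕜] D.HPlus :=
  (D.dm.range.submoduleOf D.dp.ker).mkQ ∘ₗ Submodule.inclusion h.ker_sigmaPlus_le

/-- The canonical isomorphism `H₋(D) → Coker σ₊`, `[y] ↦ [y]`. -/
def IsPseudoInv.hMinusToCoker {D : TwoPeriodicComplex 𝕜 Vp Vm}
    {D' : TwoPeriodicComplex 𝕜 Vm Vp} (h : D.IsPseudoInv D') :
    D.HMinus →ₗ[𝕜] Vm ⧸ (D.sigmaPlus D').range :=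
  Submodule.mapQ _ _ D.dm.ker.subtype fun y hy =>
    h.range_dp_le (show (y : Vm) ∈ D.dp.range from hy)

/-- The canonical isomorphism `|Ker σ₊| ⊗ |Coker σ₊|^* → |D|`. -/
def IsPseudoInv.canonicalIso {D : TwoPeriodicComplex 𝕜 Vp Vm}
    {D' : TwoPeriodicComplex 𝕜 Vm Vp} (h : D.IsPseudoInv D') :
    FredholmDet (D.sigmaPlus D') →ₗ[𝕜] D.Det :=
  TensorProduct.map (detMap h.kerToHPlus) (detMap h.hMinusToCoker).dualMap

/-- `P : |D| → |E|` is the perturbation isomorphism `P(E, D)` of the finite rank perturbation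
`D → E`: for some pseudo-inverses of `D` and `E` that are finite rank perturbations of each other,
it is the perturbation isomorphism of `σ₊ → τ₊`, up to the canonical identifications. -/
def IsPerturbationIso (D E : TwoPeriodicComplex 𝕜 Vp Vm) (P : D.Det →ₗ[𝕜] E.Det) : Prop :=
  D.IsFredholm ∧ E.IsFredholm ∧ D.IsFiniteRankPerturbation E ∧
  ∃ (D' E' : TwoPeriodicComplex 𝕜 Vm Vp) (hD : D.IsPseudoInv D') (hE : E.IsPseudoInv E')
    (P₀ : FredholmDet (D.sigmaPlus D') →ₗ[𝕜] FredholmDet (E.sigmaPlus E')),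
    D'.IsFiniteRankPerturbation E' ∧
    IsFredholmPerturbationIso (D.sigmaPlus D') (E.sigmaPlus E') P₀ ∧
    P ∘ₗ hD.canonicalIso = hE.canonicalIso ∘ₗ P₀

end

end TwoPeriodicComplex

noncomputable section HilbertComplexes

/-- The graded space is bounded: its components vanish in all degrees of large absolute value. -/
def IsBoundedGrading (X : ℤ → Type*) : Prop :=
  ∃ J : ℕ, ∀ j : ℤ, (J : ℤ) ≤ |j| → Subsingleton (X j)

/-- The even part `X₊` of a graded vector space. -/
abbrev EvenPart (X : ℤ → Type*) [∀ j, NormedAddCommGroup (X j)] : Type _ :=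
  ⨁ j : {j : ℤ // Even j}, X j

/-- The odd part `X₋` of a graded vector space. -/
abbrev OddPart (X : ℤ → Type*) [∀ j, NormedAddCommGroup (X j)] : Type _ :=
  ⨁ j : {j : ℤ // Odd j}, X j

/-- A (bounded) chain complex of Hilbert spaces with bounded differentials `d_j : X_j → X_{j-1}`
on the given spaces `X_j`. -/
structure HilbertComplex (X : ℤ → Type*) [∀ j, NormedAddCommGroup (X j)]
    [∀ j, InnerProductSpace ℂ (X j)] [∀ j, CompleteSpace (X j)] where
  d : ∀ j, X j →L[ℂ] X (j - 1)
  d_d : ∀ j x, d (j - 1) (d j x) = 0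
  bounded : IsBoundedGrading X

namespace HilbertComplex

variable {X : ℤ → Type*} [∀ j, NormedAddCommGroup (X j)]
  [∀ j, InnerProductSpace ℂ (X j)] [∀ j, CompleteSpace (X j)]
variable {C : ℤ → Type*} [∀ j, NormedAddCommGroup (C j)] [∀ j, InnerProductSpace ℂ (C j)]
variable {Z : ℤ → Type*} [∀ j, NormedAddCommGroup (Z j)]
  [∀ j, InnerProductSpace ℂ (Z j)] [∀ j, CompleteSpace (Z j)]

/-- Exactness: `Ker d_{j-1} = Im d_j` in every degree. -/
def IsExact (D : HilbertComplex X) : Prop :=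
  ∀ j, Function.Exact (D.d j) (D.d (j - 1))

/-- The associated `ℤ/2ℤ`-graded complex `X₊ → X₋ → X₊`. -/
def fold (D : HilbertComplex X) : TwoPeriodicComplex ℂ (EvenPart X) (OddPart X) where
  dp := DirectSum.toModule ℂ _ _ fun j =>
    DirectSum.lof ℂ {j : ℤ // Odd j} (fun i => X i) ⟨j.1 - 1, j.2.sub_odd odd_one⟩ ∘ₗ
      (D.d j : X j →ₗ[ℂ] X (j.1 - 1))
  dm := DirectSum.toModule ℂ _ _ fun j =>
    DirectSum.lof ℂ {j : ℤ // Even j} (fun i => X i) ⟨j.1 - 1, j.2.sub_odd odd_one⟩ ∘ₗ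
      (D.d j : X j →ₗ[ℂ] X (j.1 - 1))
  dm_dp := by
    intro x
    induction x using DirectSum.induction_on with
    | zero => simp
    | of i x =>
      rw [← DirectSum.lof_eq_of ℂ]
      simp [D.d_d]
    | add x y hx hy => rw [map_add, map_add, hx, hy, add_zero]
  dp_dm := by
    intro x
    induction x using DirectSum.induction_on with
    | zero => simp
    | of i x =>
      rw [← DirectSum.lof_eq_of ℂ]
      simp [D.d_d]
    | add x y hx hy => rw [map_add, map_add, hx, hy, add_zero]

/-- The direct sum `D ⊕ C` of `D` with the trivial complex on `C` (all differentials are zero),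
with chains `Z_j = X_j ⊕ C_j` (identified through `e_j`). Its differential is `d_j ⊕ 0`. -/
def addTrivial (D : HilbertComplex X) (hC : IsBoundedGrading C)
    (e : ∀ j, WithLp 2 (X j × C j) ≃L[ℂ] Z j) : HilbertComplex Z where
  d j := ((e (j - 1) : WithLp 2 (X (j - 1) × C (j - 1)) →L[ℂ] Z (j - 1)).comp
    ((WithLp.prodContinuousLinearEquiv 2 ℂ (X (j - 1)) (C (j - 1))).symm :
      X (j - 1) × C (j - 1) →L[ℂ] WithLp 2 (X (j - 1) × C (j - 1)))).comp
    (((D.d j).prodMap (0 : C j →L[ℂ] C (j - 1))).comp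
      ((WithLp.prodContinuousLinearEquiv 2 ℂ (X j) (C j) :
        WithLp 2 (X j × C j) →L[ℂ] X j × C j).comp
        ((e j).symm : Z j →L[ℂ] WithLp 2 (X j × C j))))
  d_d j x := by simp [Prod.map, D.d_d]
  bounded := by
    obtain ⟨J, hJ⟩ := D.bounded
    obtain ⟨K, hK⟩ := hC
    refine ⟨max J K, fun j hj => ?_⟩
    have := hJ j (le_trans (by exact_mod_cast le_max_left J K) hj)
    have := hK j (le_trans (by exact_mod_cast le_max_right J K) hj)
    have : Subsingleton (WithLp 2 (X j × C j)) :=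
      (WithLp.prodContinuousLinearEquiv 2 ℂ (X j) (C j)).toEquiv.subsingleton
    exact (e j).symm.toEquiv.subsingleton

/-- The inclusion of `C_j` in `Z_j = X_j ⊕ C_j`. -/
def trivialIncl (e : ∀ j, WithLp 2 (X j × C j) ≃L[ℂ] Z j) (j : ℤ) : C j →ₗ[ℂ] Z j :=
  (e j).toLinearMap ∘ₗ (WithLp.prodContinuousLinearEquiv 2 ℂ (X j) (C j)).symm.toLinearMap ∘ₗ
    LinearMap.inr ℂ (X j) (C j)

theorem addTrivial_d_trivialIncl (D : HilbertComplex X) (hC : IsBoundedGrading C)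
    (e : ∀ j, WithLp 2 (X j × C j) ≃L[ℂ] Z j) (j : ℤ) (c : C j) :
    (D.addTrivial hC e).d j (trivialIncl e j c) = 0 := by
  simp [addTrivial, trivialIncl]

/-- The map `C₊ → H₊(D ⊕ C)` induced by the inclusion of `C`. -/
def trivialToHPlus (D : HilbertComplex X) (hC : IsBoundedGrading C)
    (e : ∀ j, WithLp 2 (X j × C j) ≃L[ℂ] Z j) :
    EvenPart C →ₗ[ℂ] (D.addTrivial hC e).fold.HPlus :=
  Submodule.mkQ _ ∘ₗ (DirectSum.lmap fun j : {j : ℤ // Even j} =>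
    trivialIncl e j.1).codRestrict (D.addTrivial hC e).fold.dp.ker fun c => by
      induction c using DirectSum.induction_on with
      | zero => simp
      | of i x =>
        rw [← DirectSum.lof_eq_of ℂ, LinearMap.mem_ker]
        simp [fold, DirectSum.lmap_lof, addTrivial_d_trivialIncl]
      | add x y hx hy => rw [map_add]; exact Submodule.add_mem _ hx hy

/-- The map `C₋ → H₋(D ⊕ C)` induced by the inclusion of `C`. -/
def trivialToHMinus (D : HilbertComplex X) (hC : IsBoundedGrading C)
    (e : ∀ j, WithLp 2 (X j × C j) ≃L[ℂ] Z j) :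
    OddPart C →ₗ[ℂ] (D.addTrivial hC e).fold.HMinus :=
  Submodule.mkQ _ ∘ₗ (DirectSum.lmap fun j : {j : ℤ // Odd j} =>
    trivialIncl e j.1).codRestrict (D.addTrivial hC e).fold.dm.ker fun c => by
      induction c using DirectSum.induction_on with
      | zero => simp
      | of i x =>
        rw [← DirectSum.lof_eq_of ℂ, LinearMap.mem_ker]
        simp [fold, DirectSum.lmap_lof, addTrivial_d_trivialIncl]
      | add x y hx hy => rw [map_add]; exact Submodule.add_mem _ hx hy

/-- The isomorphism `i_C : ℂ → |C| = |D ⊕ C|`, `1 ↦ ω₊ ⊗ ω₋^*`, for an exact complex `D`, where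
`ω₊ ∈ |C₊|` and `ω₋ ∈ |C₋|` are nonzero vectors. -/
def trivialization (D : HilbertComplex X) (hC : IsBoundedGrading C)
    (e : ∀ j, WithLp 2 (X j × C j) ≃L[ℂ] Z j)
    (ωp : DetLine ℂ (EvenPart C)) (ωm : DetLine ℂ (OddPart C)) :
    ℂ →ₗ[ℂ] (D.addTrivial hC e).fold.Det :=
  LinearMap.toSpanSingleton ℂ _
    (detMap (D.trivialToHPlus hC e) ωp ⊗ₜ[ℂ] dualVector (detMap (D.trivialToHMinus hC e) ωm))

end HilbertComplex

/-- A family of complexes, restricted to `U`, is holomorphic: all its differentials depend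
holomorphically on the parameter, in the operator norm. -/
def IsHolomorphicFamily {k : ℕ} {X : ℤ → Type*} [∀ j, NormedAddCommGroup (X j)]
    [∀ j, InnerProductSpace ℂ (X j)] [∀ j, CompleteSpace (X j)]
    (D : EuclideanSpace ℂ (Fin k) → HilbertComplex X) (U : Set (EuclideanSpace ℂ (Fin k))) : Prop :=
  ∀ j, DifferentiableOn ℂ (fun z => (D z).d j) U

end HilbertComplexes

noncomputable section TraceClass

variable {H : Type*} [NormedAddCommGroup H] [InnerProductSpace ℂ H] [CompleteSpace H]
variable {G : Type*} [NormedAddCommGroup G] [InnerProductSpace ℂ G] [CompleteSpace G]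

/-- The operator trace in `[0, ∞]` of a positive operator: the supremum of the sums
`∑ ⟨e, S e⟩` over all finite orthonormal systems, which is the sum over any orthonormal basis. -/
def operatorTrace (S : H →L[ℂ] H) : ENNReal :=
  ⨆ (s : Finset H) (_ : Orthonormal ℂ ((↑) : s → H)),
    ∑ x ∈ s, ENNReal.ofReal (RCLike.re (⟪x, S x⟫_ℂ))

/-- The trace norm `‖T‖₁ = Tr |T|`, with `|T| = (T^* T)^{1/2}`. -/
def traceNorm (T : H →L[ℂ] G) : ENNReal :=
  operatorTrace (CFC.sqrt (ContinuousLinearMap.adjoint T ∘L T))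

/-- `F`, restricted to `U`, is a holomorphic map into the Banach space `𝓛¹(H, G)` of trace class
operators: its values are of trace class, and at each point of `U` it has a complex linear
derivative `F'` with trace class values, the remainder being small in trace norm. -/
def TraceNormHolomorphicOn {E : Type*} [NormedAddCommGroup E] [NormedSpace ℂ E]
    (F : E → H →L[ℂ] G) (U : Set E) : Prop :=
  ∀ z₀ ∈ U, traceNorm (F z₀) < ⊤ ∧
    ∃ F' : E →ₗ[ℂ] (H →L[ℂ] G), (∀ v, traceNorm (F' v) < ⊤) ∧
      ∀ ε : ℝ, 0 < ε → ∀ᶠ z in 𝓝[U] z₀,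
        traceNorm (F z - F z₀ - F' (z - z₀)) ≤ ENNReal.ofReal (ε * ‖z - z₀‖)

end TraceClass

/-! In index zero the perturbation isomorphism is a determinant in disguise. For a Fredholm map A of
index zero, adding an isomorphism from Ker A onto a complement of Im A, composed with a projection
onto Ker A, gives an invertible map S, a stabilization of A. It singles out the vector s ⊗ (S s)^*
of |Ker A| ⊗ |Coker A|^*. In a perturbation triple of index zero, N vanishes, L produces a
stabilization S_A, and B' + M Q_B is inverse to a stabilization S_B up to determinant one. The
defining formula then says that the vector of S_A goes to det(S_B⁻¹ S_A)⁻¹ times the vector of S_B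
(`IsFredholmPerturbationIso.exists_stabilization`).

Independence of choices has two sources. Replacing S by another stabilization multiplies its vector
by the determinant of the quotient (`IsStabilization.stabVec_eq_smul`), which cancels in the
formula. Replacing the pseudo-inverse of a complex D is realized by a unipotent chain automorphism
that is the identity on homology, so it transports stabilizations without changing the vector in |D|
(`IsPseudoInv.exists_transport`). The automorphisms for D and E differ by finite rank, and the
quotient of two unipotent operators that differ by finite rank has determinant one
(`finiteRankDet_eq_one_of_isNilpotent`). Hence the perturbation isomorphism is unique
(`IsPerturbationIso.eq`).

Existence and holomorphy are local. Exactness gives closed ranges, hence a bounded contracting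
homotopy h at z₀. Inverting d h + h d + ι π near z₀ makes it holomorphic, and h d h has square zero.
A contraction for Δ is obtained by correcting the one for D, so that the two differ by finite rank
(`IsHomotopy.transfer`, `exists_holOn_isContraction`). With fixed isomorphisms C₊ ≅ C₋ and Γ₊ ≅ Γ₋
both operators σ₊ acquire holomorphic stabilizations with holomorphic inverses, and everything
reduces to the determinant of T = S_Δ⁻¹ S_D, since their vectors are constant multiples of i_C(1)
and i_Γ(1).

The operators 1 - T(z) have finite rank. By the Baire category theorem and the identity theorem for
minors their rank is bounded on a ball (`exists_hasRankLE_of_finiteRank`). For rank at most n, det(1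
+ F) = 1 + tr F + o(‖F‖) uniformly and |tr F| ≤ n ‖F‖, so operator norm differentiability of T gives
that of det T (`differentiableAt_finiteRankDet`). Uniqueness glues the local functions. -/

/-! ### Finite rank maps and determinants of their perturbations of the identity -/

section FiniteRankDeterminant

variable {𝕜 : Type*} [Field 𝕜]
variable {V : Type*} [AddCommGroup V] [Module 𝕜 V]
variable {W : Type*} [AddCommGroup W] [Module 𝕜 W]
variable {K : Type*} [AddCommGroup K] [Module 𝕜 K]

namespace FiniteRank

theorem of_range_le {f : V →ₗ[𝕜] W} (S : Submodule 𝕜 W) [FiniteDimensional 𝕜 S]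
    (h : f.range ≤ S) : FiniteRank f :=
  Submodule.finiteDimensional_of_le h

theorem zero : FiniteRank (0 : V →ₗ[𝕜] W) :=
  of_range_le ⊥ (by simp)

theorem add {f g : V →ₗ[𝕜] W} (hf : FiniteRank f) (hg : FiniteRank g) : FiniteRank (f + g) := by
  have : FiniteDimensional 𝕜 f.range := hf
  have : FiniteDimensional 𝕜 g.range := hg
  exact of_range_le (f.range ⊔ g.range) (LinearMap.range_add_le f g)

theorem neg {f : V →ₗ[𝕜] W} (hf : FiniteRank f) : FiniteRank (-f) := by
  have : FiniteDimensional 𝕜 f.range := hf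
  exact of_range_le f.range (by rw [LinearMap.range_neg])

theorem sub {f g : V →ₗ[𝕜] W} (hf : FiniteRank f) (hg : FiniteRank g) : FiniteRank (f - g) := by
  rw [sub_eq_add_neg]; exact hf.add hg.neg

theorem symm {f g : V →ₗ[𝕜] W} (h : FiniteRank (f - g)) : FiniteRank (g - f) := by
  rw [← neg_sub]; exact h.neg

theorem trans {f g h : V →ₗ[𝕜] W} (hf : FiniteRank (f - g)) (hg : FiniteRank (g - h)) :
    FiniteRank (f - h) := by
  rw [← sub_add_sub_cancel]; exact hf.add hg

theorem comp_left {f : V →ₗ[𝕜] W} (hf : FiniteRank f) (g : W →ₗ[𝕜] K) : FiniteRank (g ∘ₗ f) := by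
  have : FiniteDimensional 𝕜 f.range := hf
  exact of_range_le (f.range.map g) (by rw [LinearMap.range_comp])

theorem comp_right {f : V →ₗ[𝕜] W} (hf : FiniteRank f) (g : K →ₗ[𝕜] V) : FiniteRank (f ∘ₗ g) := by
  have : FiniteDimensional 𝕜 f.range := hf
  exact of_range_le f.range (LinearMap.range_comp_le_range g f)

theorem of_finiteDimensional_left [FiniteDimensional 𝕜 V] (f : V →ₗ[𝕜] W) : FiniteRank f := by
  unfold FiniteRank; infer_instance

/-- Products of maps that agree up to finite rank agree up to finite rank. -/
theorem comp_sub_comp {f f' : W →ₗ[𝕜] K} {g g' : V →ₗ[𝕜] W} (hf : FiniteRank (f - f'))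
    (hg : FiniteRank (g - g')) : FiniteRank (f ∘ₗ g - f' ∘ₗ g') := by
  have h : f ∘ₗ g - f' ∘ₗ g' = (f - f') ∘ₗ g + f' ∘ₗ (g - g') := by
    ext; simp
  rw [h]
  exact (hf.comp_right g).add (hg.comp_left f')

theorem add_sub_add {f f' g g' : V →ₗ[𝕜] W} (hf : FiniteRank (f - f'))
    (hg : FiniteRank (g - g')) : FiniteRank (f + g - (f' + g')) := by
  rw [add_sub_add_comm]; exact hf.add hg

theorem sub_sub_sub {f f' g g' : V →ₗ[𝕜] W} (hf : FiniteRank (f - f'))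
    (hg : FiniteRank (g - g')) : FiniteRank (f - g - (f' - g')) := by
  rw [sub_sub_sub_comm]; exact hf.sub hg

theorem refl (f : V →ₗ[𝕜] W) : FiniteRank (f - f) := by
  rw [sub_self]; exact zero

end FiniteRank

/-- The Weinstein–Aronszajn identity for linear maps. -/
theorem LinearMap.det_id_add_comp_comm [FiniteDimensional 𝕜 V] [FiniteDimensional 𝕜 W]
    (f : V →ₗ[𝕜] W) (g : W →ₗ[𝕜] V) :
    LinearMap.det (LinearMap.id + g ∘ₗ f) = LinearMap.det (LinearMap.id + f ∘ₗ g) := by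
  let b := Module.finBasis 𝕜 V
  let c := Module.finBasis 𝕜 W
  rw [← LinearMap.det_toMatrix b, ← LinearMap.det_toMatrix c, map_add, map_add,
    LinearMap.toMatrix_comp b c b, LinearMap.toMatrix_comp c b c, LinearMap.toMatrix_id,
    LinearMap.toMatrix_id, Matrix.det_one_add_mul_comm]

/-- If `T = 1 + U G`, where `U G` factors through a finite dimensional space, then the determinant
of `T` is that of `1 + G U`. -/
theorem finiteRankDet_id_add_comp [FiniteDimensional 𝕜 K] (U : K →ₗ[𝕜] V) (G : V →ₗ[𝕜] K) :
    finiteRankDet (LinearMap.id + U ∘ₗ G) = LinearMap.det (LinearMap.id + G ∘ₗ U) := by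
  set T : V →ₗ[𝕜] V := LinearMap.id + U ∘ₗ G with hT
  set R := (LinearMap.id - T).range with hR
  have hfin : FiniteDimensional 𝕜 R :=
    FiniteRank.of_range_le U.range (by
      rintro _ ⟨x, rfl⟩
      exact ⟨-G x, by simp [hT]⟩)
  -- U need not map all of K into R, but it maps the image of G into R. Both sides are therefore
  -- compared with a determinant on the image of G, by two applications of the Weinstein–Aronszajn
  -- identity.
  have hUR : ∀ k : G.range, U k ∈ R := by
    rintro ⟨_, x, rfl⟩
    exact ⟨-x, by simp [hT]⟩
  let U' : G.range →ₗ[𝕜] R := (U ∘ₗ G.range.subtype).codRestrict R hUR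
  let G' : V →ₗ[𝕜] G.range := G.rangeRestrict
  have h1 : T.restrict (one_sub_range_invariant T) =
      LinearMap.id + U' ∘ₗ (G' ∘ₗ R.subtype) := by
    ext x
    simp only [hT, LinearMap.restrict_apply]
    rfl
  have h2 : LinearMap.id + G ∘ₗ U = LinearMap.id + G.range.subtype ∘ₗ (G' ∘ₗ U) := rfl
  have h3 : (LinearMap.id : G.range →ₗ[𝕜] G.range) + (G' ∘ₗ R.subtype) ∘ₗ U' =
      LinearMap.id + (G' ∘ₗ U) ∘ₗ G.range.subtype := rfl
  unfold finiteRankDet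
  rw [h1, LinearMap.det_id_add_comp_comm, h3, h2, LinearMap.det_id_add_comp_comm]

/-- The determinant of `T` can be computed on any finite dimensional subspace that contains the
image of `1 - T`. -/
theorem finiteRankDet_eq_det_restrict (T : V →ₗ[𝕜] V) (S : Submodule 𝕜 V) [FiniteDimensional 𝕜 S]
    (hS : (LinearMap.id - T).range ≤ S) (hT : ∀ x ∈ S, T x ∈ S) :
    finiteRankDet T = LinearMap.det (T.restrict hT) := by
  let G : V →ₗ[𝕜] S := (T - LinearMap.id).codRestrict S fun x => by
    rw [← neg_sub]
    exact S.neg_mem (hS ⟨x, rfl⟩)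
  have h : T = LinearMap.id + S.subtype ∘ₗ G := by
    ext x; simp [G]
  have h' : T.restrict hT = LinearMap.id + G ∘ₗ S.subtype := by
    ext x; simp [G]
  rw [h']
  conv_lhs => rw [h]
  exact finiteRankDet_id_add_comp _ _

theorem mapsTo_of_range_id_sub_le {T : V →ₗ[𝕜] V} {S : Submodule 𝕜 V}
    (hS : (LinearMap.id - T).range ≤ S) : ∀ x ∈ S, T x ∈ S := fun x hx => by
  have := S.sub_mem hx (hS ⟨x, rfl⟩)
  simpa using this

theorem finiteRankDet_id : finiteRankDet (LinearMap.id : V →ₗ[𝕜] V) = 1 := by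
  have h : (LinearMap.id - (LinearMap.id : V →ₗ[𝕜] V)).range ≤ ⊥ := by simp
  rw [finiteRankDet_eq_det_restrict _ ⊥ h (mapsTo_of_range_id_sub_le h)]
  exact LinearMap.det_eq_one_of_subsingleton _

/-- The sum of the images of 1 - T₁ and 1 - T₂ is invariant under both operators and contains the
image of 1 - T₁T₂, so the ordinary determinant on this one subspace computes all three. -/
theorem finiteRankDet_comp {T₁ T₂ : V →ₗ[𝕜] V} (h₁ : FiniteRank (LinearMap.id - T₁))
    (h₂ : FiniteRank (LinearMap.id - T₂)) :
    finiteRankDet (T₁ ∘ₗ T₂) = finiteRankDet T₁ * finiteRankDet T₂ := by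
  have : FiniteDimensional 𝕜 (LinearMap.id - T₁).range := h₁
  have : FiniteDimensional 𝕜 (LinearMap.id - T₂).range := h₂
  set S := (LinearMap.id - T₁).range ⊔ (LinearMap.id - T₂).range with hS
  have hS₁ : (LinearMap.id - T₁).range ≤ S := le_sup_left
  have hS₂ : (LinearMap.id - T₂).range ≤ S := le_sup_right
  have m₁ := mapsTo_of_range_id_sub_le hS₁
  have m₂ := mapsTo_of_range_id_sub_le hS₂
  have hS₃ : (LinearMap.id - T₁ ∘ₗ T₂).range ≤ S := by
    rintro _ ⟨x, rfl⟩
    have := S.add_mem (hS₂ ⟨x, rfl⟩) (hS₁ ⟨T₂ x, rfl⟩)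
    simpa using this
  rw [finiteRankDet_eq_det_restrict _ S hS₁ m₁, finiteRankDet_eq_det_restrict _ S hS₂ m₂,
    finiteRankDet_eq_det_restrict _ S hS₃ (mapsTo_of_range_id_sub_le hS₃), ← LinearMap.det_comp]
  rfl

theorem finiteRankDet_conj (T : V →ₗ[𝕜] V) (e : V ≃ₗ[𝕜] W) (hT : FiniteRank (LinearMap.id - T)) :
    finiteRankDet (e.toLinearMap ∘ₗ T ∘ₗ e.symm.toLinearMap) = finiteRankDet T := by
  have : FiniteDimensional 𝕜 (LinearMap.id - T).range := hT
  let S := (LinearMap.id - T).range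
  let G : V →ₗ[𝕜] S := (T - LinearMap.id).codRestrict S fun x => by
    rw [← neg_sub]
    exact S.neg_mem ⟨x, rfl⟩
  have h : T = LinearMap.id + S.subtype ∘ₗ G := by
    ext x; simp [G]
  have h' : e.toLinearMap ∘ₗ T ∘ₗ e.symm.toLinearMap =
      LinearMap.id + (e.toLinearMap ∘ₗ S.subtype) ∘ₗ (G ∘ₗ e.symm.toLinearMap) := by
    ext x; simp [G]
  rw [h', finiteRankDet_id_add_comp]
  conv_rhs => rw [h, finiteRankDet_id_add_comp]
  congr 1
  ext x; simp

theorem finiteRankDet_mul_eq_one {T₁ T₂ : V →ₗ[𝕜] V} (h₁ : FiniteRank (LinearMap.id - T₁))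
    (h : T₁ ∘ₗ T₂ = LinearMap.id) : finiteRankDet T₁ * finiteRankDet T₂ = 1 := by
  have h₂ : FiniteRank (LinearMap.id - T₂) := by
    have : LinearMap.id - T₂ = -((LinearMap.id - T₁) ∘ₗ T₂) := by
      rw [LinearMap.sub_comp, h, LinearMap.id_comp, neg_sub]
    rw [this]
    exact (h₁.comp_right _).neg
  rw [← finiteRankDet_comp h₁ h₂, h, finiteRankDet_id]

theorem finiteRankDet_ne_zero {T₁ T₂ : V →ₗ[𝕜] V} (h₁ : FiniteRank (LinearMap.id - T₁))
    (h : T₁ ∘ₗ T₂ = LinearMap.id) : finiteRankDet T₁ ≠ 0 :=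
  left_ne_zero_of_mul_eq_one (finiteRankDet_mul_eq_one h₁ h)

/-- A unipotent endomorphism of a finite dimensional space has determinant one. -/
theorem LinearMap.det_id_add_of_isNilpotent [FiniteDimensional 𝕜 V] {a : V →ₗ[𝕜] V}
    (ha : IsNilpotent a) : LinearMap.det (LinearMap.id + a) = 1 := by
  have h := (LinearMap.charpoly_eq_X_pow_iff (φ := -a)).2
  have hn : ∀ m, ∃ n : ℕ, ((-a) ^ n) m = 0 := fun m => by
    obtain ⟨n, hn⟩ := ha.neg
    exact ⟨n, by rw [hn]; rfl⟩
  -- det(1 + a) is the value at 1 of the characteristic polynomial of -a, which is a power of X.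
  have h2 := LinearMap.eval_charpoly (-a) (1 : 𝕜)
  rw [h hn] at h2
  simp only [Polynomial.eval_pow, Polynomial.eval_X, one_pow, map_one, sub_neg_eq_add] at h2
  exact h2.symm

/-- If two nilpotent operators differ by a finite rank operator, then the quotient of the
corresponding unipotent operators has determinant one. -/
theorem finiteRankDet_eq_one_of_isNilpotent {a b T : V →ₗ[𝕜] V} (ha : IsNilpotent a)
    (hb : IsNilpotent b) (hab : FiniteRank (a - b))
    (hT : (LinearMap.id + b) ∘ₗ T = LinearMap.id + a) : finiteRankDet T = 1 := by
  have : FiniteDimensional 𝕜 (a - b).range := hab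
  obtain ⟨n, hn⟩ := hb
  -- The smallest b-invariant subspace containing Im (a - b). It is finite dimensional because b is
  -- nilpotent, and all determinants are taken on it.
  let S : Submodule 𝕜 V := ⨆ i : Fin n, (a - b).range.map (b ^ (i : ℕ))
  have hbS : ∀ x ∈ S, b x ∈ S := by
    intro x hx
    have : S ≤ S.comap b := by
      refine iSup_le fun i => ?_
      rintro _ ⟨y, hy, rfl⟩
      rw [Submodule.mem_comap, ← Module.End.mul_apply, ← pow_succ']
      by_cases h : (i : ℕ) + 1 < n
      · exact Submodule.mem_iSup_of_mem (⟨i + 1, h⟩ : Fin n) ⟨y, hy, rfl⟩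
      · rw [show (i : ℕ) + 1 = n by omega, hn]
        exact S.zero_mem
    exact this hx
  have hR : (a - b).range ≤ S := by
    rcases n with _ | n
    · have : ∀ x : V, x = 0 := fun x => by
        have := congrArg (fun f : V →ₗ[𝕜] V => f x) hn
        simpa using this
      intro x _
      rw [this x]; exact S.zero_mem
    · intro x hx
      exact Submodule.mem_iSup_of_mem (0 : Fin (n + 1)) ⟨x, hx, by simp⟩
  have haS : ∀ x ∈ S, a x ∈ S := fun x hx => by
    have := S.add_mem (hR ⟨x, rfl⟩) (hbS x hx)
    simpa using this
  have hnil : ∀ {c : V →ₗ[𝕜] V} (hc : IsNilpotent c) (hcS : ∀ x ∈ S, c x ∈ S),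
      IsNilpotent (c.restrict hcS) := by
    rintro c ⟨m, hm⟩ hcS
    refine ⟨m, ?_⟩
    rw [Module.End.pow_restrict m]
    ext x
    simp [hm]
  have e1 : ∀ x, T x + b (T x) = x + a x := fun x => by
    have := congrArg (fun f : V →ₗ[𝕜] V => f x) hT
    simpa using this
  have hTS : (LinearMap.id - T).range ≤ S := by
    rintro _ ⟨x, rfl⟩
    -- Since (1 + b)(x - T x) = -(a - b) x, applying powers of b shows that b^k (x - T x) lies in S
    -- as soon as b^(k+1) (x - T x) does. The descent starts at b^n = 0.
    have key : ∀ k : ℕ, (b ^ k) (x - T x) ∈ S → (x - T x) ∈ S := by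
      intro k
      induction k with
      | zero => simp
      | succ k ih =>
        intro h
        refine ih ?_
        have : x - T x = -(a - b) x - b (x - T x) := by
          have := e1 x
          simp only [LinearMap.sub_apply, map_sub]
          rw [← sub_eq_zero] at this ⊢
          rw [← neg_eq_zero, ← this]
          abel
        rw [this, map_sub, ← Module.End.mul_apply, ← pow_succ]
        refine S.sub_mem ?_ h
        rw [map_neg]
        refine S.neg_mem ?_
        clear h ih this
        induction k with
        | zero => exact hR ⟨x, rfl⟩
        | succ k ih => rw [pow_succ']; exact hbS _ ih
    refine key n ?_
    rw [hn]; exact S.zero_mem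
  have hTm := mapsTo_of_range_id_sub_le hTS
  have h1 : (LinearMap.id + b.restrict hbS) ∘ₗ T.restrict hTm = LinearMap.id + a.restrict haS := by
    ext x
    simpa using e1 x
  have h2 := congrArg LinearMap.det h1
  rw [LinearMap.det_comp, LinearMap.det_id_add_of_isNilpotent (hnil ⟨n, hn⟩ hbS),
    LinearMap.det_id_add_of_isNilpotent (hnil ha haS), one_mul] at h2
  rw [finiteRankDet_eq_det_restrict T S hTS hTm, h2]

end FiniteRankDeterminant

/-! ### Determinant lines -/

noncomputable section DeterminantLines

variable {𝕜 : Type*} [Field 𝕜]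
variable {V : Type*} [AddCommGroup V] [Module 𝕜 V]
variable {W : Type*} [AddCommGroup W] [Module 𝕜 W]
variable {K : Type*} [AddCommGroup K] [Module 𝕜 K]
variable {Q : Type*} [AddCommGroup Q] [Module 𝕜 Q]

theorem LinearMap.finrank_eq_of_bijective {f : V →ₗ[𝕜] W} (hf : Function.Bijective f) :
    Module.finrank 𝕜 V = Module.finrank 𝕜 W :=
  (LinearEquiv.ofBijective f hf).finrank_eq

theorem finrank_detLine [FiniteDimensional 𝕜 V] : Module.finrank 𝕜 (DetLine 𝕜 V) = 1 := by
  rw [exteriorPower.finrank_eq, Nat.choose_self]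

theorem exists_detLine_ne_zero (𝕜 V : Type*) [Field 𝕜] [AddCommGroup V] [Module 𝕜 V]
    [FiniteDimensional 𝕜 V] : ∃ x : DetLine 𝕜 V, x ≠ 0 := by
  obtain ⟨x, hx, -⟩ := finrank_eq_one_iff'.1 (finrank_detLine (𝕜 := 𝕜) (V := V))
  exact ⟨x, hx⟩

theorem DetLine.exists_smul_eq [FiniteDimensional 𝕜 V] {x : DetLine 𝕜 V} (hx : x ≠ 0)
    (y : DetLine 𝕜 V) : ∃ c : 𝕜, c • x = y :=
  exists_smul_eq_of_finrank_eq_one finrank_detLine hx y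

theorem toDetLine_coe (x : DetLine 𝕜 V) : toDetLine (x : ExteriorAlgebra 𝕜 V) = x := by
  unfold toDetLine
  rw [dif_pos x.2]

theorem coe_detMap (h : Module.finrank 𝕜 V = Module.finrank 𝕜 W) (f : V →ₗ[𝕜] W)
    (x : DetLine 𝕜 V) : (detMap f x : ExteriorAlgebra 𝕜 W) = ExteriorAlgebra.map f x.1 := by
  unfold detMap
  rw [dif_pos h]
  rfl

theorem toDetLine_map (h : Module.finrank 𝕜 V = Module.finrank 𝕜 W) (f : V →ₗ[𝕜] W)
    (x : DetLine 𝕜 V) : toDetLine (ExteriorAlgebra.map f x.1) = detMap f x := by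
  rw [← coe_detMap h, toDetLine_coe]

theorem detMap_comp_apply (h : Module.finrank 𝕜 V = Module.finrank 𝕜 W)
    (h' : Module.finrank 𝕜 W = Module.finrank 𝕜 K) (f : V →ₗ[𝕜] W) (g : W →ₗ[𝕜] K)
    (x : DetLine 𝕜 V) : detMap g (detMap f x) = detMap (g ∘ₗ f) x := by
  apply Subtype.ext
  rw [coe_detMap h', coe_detMap h, coe_detMap (h.trans h'), ← ExteriorAlgebra.map_comp_map]
  rfl

theorem detMap_id_apply (x : DetLine 𝕜 V) : detMap LinearMap.id x = x := by
  apply Subtype.ext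
  rw [coe_detMap rfl, ExteriorAlgebra.map_id]
  rfl

theorem detMap_injective {f : V →ₗ[𝕜] W} (hf : Function.Bijective f) :
    Function.Injective (detMap f) := by
  let e := LinearEquiv.ofBijective f hf
  have h : ∀ x, detMap e.symm.toLinearMap (detMap f x) = x := fun x => by
    rw [detMap_comp_apply e.finrank_eq e.symm.finrank_eq]
    have : e.symm.toLinearMap ∘ₗ f = LinearMap.id := by
      ext x; exact e.symm_apply_apply x
    rw [this, detMap_id_apply]
  exact Function.LeftInverse.injective h

theorem detMap_ne_zero {f : V →ₗ[𝕜] W} (hf : Function.Bijective f) {x : DetLine 𝕜 V} (hx : x ≠ 0) :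
    detMap f x ≠ 0 := by
  rw [← map_zero (detMap f)]
  exact (detMap_injective hf).ne hx

/-- After identifying the line with the field, the universal alternating map in top degree is a
multiple of the determinant of a basis, and φ scales the latter by det φ. -/
theorem detMap_eq_det_smul [FiniteDimensional 𝕜 V] (φ : V →ₗ[𝕜] V) (x : DetLine 𝕜 V) :
    detMap φ x = LinearMap.det φ • x := by
  obtain ⟨ψ⟩ : Nonempty (DetLine 𝕜 V ≃ₗ[𝕜] 𝕜) :=
    FiniteDimensional.nonempty_linearEquiv_of_finrank_eq (by
      rw [finrank_detLine, Module.finrank_self])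
  have h : ψ.toLinearMap ∘ₗ detMap φ = ψ.toLinearMap ∘ₗ (LinearMap.det φ • LinearMap.id) := by
    refine exteriorPower.linearMap_ext ?_
    let b := Module.finBasis 𝕜 V
    let f : V [⋀^Fin (Module.finrank 𝕜 V)]→ₗ[𝕜] 𝕜 :=
      ψ.toLinearMap.compAlternatingMap (exteriorPower.ιMulti 𝕜 _)
    have h1 : ∀ v, (ψ.toLinearMap ∘ₗ detMap φ).compAlternatingMap
        (exteriorPower.ιMulti 𝕜 _) v = f (φ ∘ v) := fun v => by
      refine congrArg ψ (Subtype.ext ?_)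
      rw [coe_detMap rfl]
      exact ExteriorAlgebra.map_apply_ιMulti φ v
    have h2 : ∀ v, (ψ.toLinearMap ∘ₗ (LinearMap.det φ • LinearMap.id)).compAlternatingMap
        (exteriorPower.ιMulti 𝕜 _) v = LinearMap.det φ • f v := fun v => by
      simp [f]
    ext v
    rw [h1, h2, f.eq_smul_basis_det b]
    simp only [AlternatingMap.smul_apply, Module.Basis.det_comp, smul_eq_mul]
    ring
  exact ψ.injective (LinearMap.congr_fun h x)

theorem dualVector_apply_self [FiniteDimensional 𝕜 V] {v : DetLine 𝕜 V} (hv : v ≠ 0) :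
    dualVector v v = 1 := by
  refine Classical.epsilon_spec (p := fun φ : Module.Dual 𝕜 (DetLine 𝕜 V) => φ v = 1) ?_
  exact Module.Projective.exists_dual_eq_one 𝕜 hv

theorem eq_dualVector [FiniteDimensional 𝕜 V] {v : DetLine 𝕜 V} (hv : v ≠ 0)
    {φ : Module.Dual 𝕜 (DetLine 𝕜 V)} (h : φ v = 1) : φ = dualVector v := by
  refine LinearMap.ext fun y => ?_
  obtain ⟨c, rfl⟩ := DetLine.exists_smul_eq hv y
  rw [map_smul, map_smul, h, dualVector_apply_self hv]

theorem dualVector_smul [FiniteDimensional 𝕜 V] {v : DetLine 𝕜 V} (hv : v ≠ 0) {c : 𝕜}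
    (hc : c ≠ 0) : dualVector (c • v) = c⁻¹ • dualVector v := by
  refine (eq_dualVector (smul_ne_zero hc hv) ?_).symm
  rw [map_smul, LinearMap.smul_apply, dualVector_apply_self hv]
  simp [hc]

theorem dualMap_detMap_dualVector [FiniteDimensional 𝕜 V] [FiniteDimensional 𝕜 W]
    {f : V →ₗ[𝕜] W} (hf : Function.Bijective f) {v : DetLine 𝕜 V} (hv : v ≠ 0) :
    (detMap f).dualMap (dualVector (detMap f v)) = dualVector v := by
  refine eq_dualVector hv ?_
  rw [LinearMap.dualMap_apply, dualVector_apply_self (detMap_ne_zero hf hv)]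

/-- The vector `s ⊗ (f s)^*` in `|K| ⊗ |Q|^*` determined by an isomorphism `f : K → Q`. -/
def detVec (f : K →ₗ[𝕜] Q) : DetLine 𝕜 K ⊗[𝕜] Module.Dual 𝕜 (DetLine 𝕜 Q) :=
  (Classical.epsilon fun s : DetLine 𝕜 K => s ≠ 0) ⊗ₜ[𝕜]
    dualVector (detMap f (Classical.epsilon fun s : DetLine 𝕜 K => s ≠ 0))

/-- Rescaling s by c rescales (f s)^* by c⁻¹, so the tensor does not depend on the vector s chosen
in the definition. -/
theorem detVec_eq [FiniteDimensional 𝕜 K] [FiniteDimensional 𝕜 Q] {f : K →ₗ[𝕜] Q}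
    (hf : Function.Bijective f) {s : DetLine 𝕜 K} (hs : s ≠ 0) :
    detVec f = s ⊗ₜ[𝕜] dualVector (detMap f s) := by
  have h0 := Classical.epsilon_spec (exists_detLine_ne_zero 𝕜 K)
  unfold detVec
  set s₀ := Classical.epsilon fun s : DetLine 𝕜 K => s ≠ 0
  obtain ⟨c, rfl⟩ := DetLine.exists_smul_eq h0 s
  have hc : c ≠ 0 := fun h => hs (by rw [h, zero_smul])
  rw [map_smul, dualVector_smul (detMap_ne_zero hf h0) hc, TensorProduct.smul_tmul_smul,
    mul_inv_cancel₀ hc, one_smul]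

theorem tmul_dualVector_ne_zero [FiniteDimensional 𝕜 K] [FiniteDimensional 𝕜 Q]
    {s : DetLine 𝕜 K} {t : DetLine 𝕜 Q} (hs : s ≠ 0) (ht : t ≠ 0) :
    s ⊗ₜ[𝕜] dualVector t ≠ 0 := by
  intro h
  have := congrArg (TensorProduct.lid 𝕜 𝕜 ∘ TensorProduct.map (dualVector s)
    (LinearMap.applyₗ t)) h
  simp [dualVector_apply_self hs, dualVector_apply_self ht] at this

theorem detVec_ne_zero [FiniteDimensional 𝕜 K] [FiniteDimensional 𝕜 Q] {f : K →ₗ[𝕜] Q}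
    (hf : Function.Bijective f) : detVec f ≠ 0 := by
  obtain ⟨s, hs⟩ := exists_detLine_ne_zero 𝕜 K
  rw [detVec_eq hf hs]
  exact tmul_dualVector_ne_zero hs (detMap_ne_zero hf hs)

theorem finrank_detLine_tensor_dual [FiniteDimensional 𝕜 K] [FiniteDimensional 𝕜 Q] :
    Module.finrank 𝕜 (DetLine 𝕜 K ⊗[𝕜] Module.Dual 𝕜 (DetLine 𝕜 Q)) = 1 := by
  rw [Module.finrank_tensorProduct, Subspace.dual_finrank_eq, finrank_detLine, finrank_detLine]

/-- Replacing f by f ∘ φ multiplies f s by det φ, hence its dual vector by the inverse. This is how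
determinants enter the comparison of stabilizations. -/
theorem detVec_comp_endo [FiniteDimensional 𝕜 K] [FiniteDimensional 𝕜 Q] {f : K →ₗ[𝕜] Q}
    {φ : K →ₗ[𝕜] K} (hf : Function.Bijective f) (hφ : Function.Bijective (f ∘ₗ φ)) :
    detVec f = LinearMap.det φ • detVec (f ∘ₗ φ) := by
  obtain ⟨s, hs⟩ := exists_detLine_ne_zero 𝕜 K
  have hfin := LinearMap.finrank_eq_of_bijective hf
  have hd : LinearMap.det φ ≠ 0 := by
    intro h
    refine detMap_ne_zero hφ hs ?_
    rw [← detMap_comp_apply rfl hfin, detMap_eq_det_smul, h, zero_smul, map_zero]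
  rw [detVec_eq hf hs, detVec_eq hφ hs, ← detMap_comp_apply rfl hfin, detMap_eq_det_smul, map_smul,
    dualVector_smul (detMap_ne_zero hf hs) hd, TensorProduct.tmul_smul, smul_smul,
    mul_inv_cancel₀ hd, one_smul]

/-- Naturality of `detVec`. -/
theorem map_detMap_detVec [FiniteDimensional 𝕜 K] [FiniteDimensional 𝕜 Q] [FiniteDimensional 𝕜 V]
    [FiniteDimensional 𝕜 W] {f : V →ₗ[𝕜] W} {φ : K →ₗ[𝕜] V} {ψ : W →ₗ[𝕜] Q}
    (hf : Function.Bijective f) (hφ : Function.Bijective φ) (hψ : Function.Bijective ψ) :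
    TensorProduct.map (detMap φ) (detMap ψ).dualMap (detVec (ψ ∘ₗ f ∘ₗ φ)) = detVec f := by
  obtain ⟨s, hs⟩ := exists_detLine_ne_zero 𝕜 K
  have hφs := detMap_ne_zero hφ hs
  have hfφ : Function.Bijective (f ∘ₗ φ) := hf.comp hφ
  have hc : Function.Bijective (ψ ∘ₗ f ∘ₗ φ) := hψ.comp hfφ
  rw [detVec_eq hc hs, detVec_eq hf hφs, TensorProduct.map_tmul,
    ← detMap_comp_apply (LinearMap.finrank_eq_of_bijective hfφ)
      (LinearMap.finrank_eq_of_bijective hψ),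
    dualMap_detMap_dualVector hψ (detMap_ne_zero hfφ hs),
    detMap_comp_apply (LinearMap.finrank_eq_of_bijective hφ)
      (LinearMap.finrank_eq_of_bijective hf)]

/-- A linear map out of a line is determined by one nonzero value. -/
theorem LinearMap.eq_of_finrank_eq_one (hV : Module.finrank 𝕜 V = 1) {v : V} (hv : v ≠ 0)
    {f g : V →ₗ[𝕜] W} (h : f v = g v) : f = g := by
  ext x
  obtain ⟨c, rfl⟩ := exists_smul_eq_of_finrank_eq_one hV hv x
  rw [map_smul, map_smul, h]

theorem LinearMap.exists_apply_eq {v : V} (hv : v ≠ 0) (w : W) : ∃ f : V →ₗ[𝕜] W, f v = w := by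
  obtain ⟨φ, hφ⟩ := Module.Projective.exists_dual_eq_one 𝕜 hv
  exact ⟨φ.smulRight w, by simp [hφ]⟩

end DeterminantLines

/-! ### Stabilizations of Fredholm maps of index zero -/

noncomputable section Stabilization

variable {𝕜 : Type*} [Field 𝕜]
variable {V : Type*} [AddCommGroup V] [Module 𝕜 V]
variable {W : Type*} [AddCommGroup W] [Module 𝕜 W]

/-- `S` is obtained from the map `A` of index zero by adding an isomorphism from `Ker A` onto a
complement of `Im A`, extended by zero to some complement of `Ker A`. -/
structure IsStabilization (A S : V →ₗ[𝕜] W) : Prop where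
  proj : ∃ P : V →ₗ[𝕜] A.ker, (∀ x : A.ker, P x = x) ∧ ∀ x, S x = A x + S (P x)
  bijective : Function.Bijective (A.range.mkQ ∘ₗ S ∘ₗ A.ker.subtype)

/-- The vector `s ⊗ (S s)^*` of `|Ker A| ⊗ |Coker A|^*`. -/
def stabVec (A S : V →ₗ[𝕜] W) : FredholmDet A :=
  detVec (A.range.mkQ ∘ₗ S ∘ₗ A.ker.subtype)

namespace IsStabilization

variable {A B S S₁ S₂ : V →ₗ[𝕜] W}

theorem bijective_self (h : IsStabilization A S) : Function.Bijective S := by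
  obtain ⟨P, hP, hS⟩ := h.proj
  constructor
  · rw [injective_iff_map_eq_zero]
    intro x hx
    have h0 : (A.range.mkQ ∘ₗ S ∘ₗ A.ker.subtype) (P x) = 0 := by
      have : S (P x) = -A x := by
        rw [hS x] at hx
        exact eq_neg_of_add_eq_zero_right hx
      rw [LinearMap.comp_apply, LinearMap.comp_apply, Submodule.subtype_apply, this,
        Submodule.mkQ_apply, Submodule.Quotient.mk_eq_zero]
      exact A.range.neg_mem ⟨x, rfl⟩
    have h1 : P x = 0 := h.bijective.1 (by rw [h0, map_zero])
    have h2 : A x = 0 := by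
      rw [hS x, h1] at hx
      simpa using hx
    have h3 := hP ⟨x, h2⟩
    rw [h1] at h3
    exact (congrArg Subtype.val h3).symm
  · intro w
    obtain ⟨k, hk⟩ := h.bijective.2 (A.range.mkQ w)
    have : w - S k ∈ A.range := by
      rw [← Submodule.Quotient.mk_eq_zero, Submodule.Quotient.mk_sub, sub_eq_zero]
      exact hk.symm
    obtain ⟨x, hx⟩ := this
    refine ⟨k + (x - P x), ?_⟩
    rw [map_add, map_sub, hS x, add_sub_cancel_right, hx, add_sub_cancel]

/-- A stabilization, as a linear equivalence. -/
def equiv (h : IsStabilization A S) : V ≃ₗ[𝕜] W := LinearEquiv.ofBijective S h.bijective_self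

@[simp] theorem equiv_apply (h : IsStabilization A S) (x : V) : h.equiv x = S x := rfl

@[simp] theorem apply_equiv_symm (h : IsStabilization A S) (y : W) : S (h.equiv.symm y) = y :=
  h.equiv.apply_symm_apply y

@[simp] theorem equiv_symm_apply (h : IsStabilization A S) (x : V) : h.equiv.symm (S x) = x :=
  h.equiv.symm_apply_apply x

theorem finiteRank_sub (hA : IsFredholmMap A) (h : IsStabilization A S) : FiniteRank (S - A) := by
  obtain ⟨P, -, hS⟩ := h.proj
  have := hA.ker
  have e : S - A = (S ∘ₗ A.ker.subtype) ∘ₗ P := by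
    ext x
    rw [LinearMap.sub_apply, sub_eq_iff_eq_add']
    exact hS x
  rw [e]
  exact (FiniteRank.of_finiteDimensional_left _).comp_right P

/-- 1 - T = S₁⁻¹ (S₁ - S₂), and each stabilization differs by finite rank from the map that it
stabilizes. -/
theorem finiteRank_id_sub (hA : IsFredholmMap A) (hB : IsFredholmMap B) (h₁ : IsStabilization A S₁)
    (h₂ : IsStabilization B S₂) (hAB : FiniteRank (A - B)) {T : V →ₗ[𝕜] V} (hT : S₁ ∘ₗ T = S₂) :
    FiniteRank (LinearMap.id - T) := by
  have e : LinearMap.id - T = h₁.equiv.symm.toLinearMap ∘ₗ (S₁ - S₂) := by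
    ext x
    simp [← hT]
  rw [e]
  exact (((h₁.finiteRank_sub hA).trans hAB).trans (h₂.finiteRank_sub hB).symm).comp_left _

theorem stabVec_ne_zero (hA : IsFredholmMap A) (h : IsStabilization A S) : stabVec A S ≠ 0 := by
  have := hA.ker
  have := hA.coker
  exact detVec_ne_zero h.bijective

/-- The dependence of `stabVec A S` on the stabilization `S`. -/
theorem stabVec_eq_smul (hA : IsFredholmMap A) (h₁ : IsStabilization A S₁)
    (h₂ : IsStabilization A S₂) {T : V →ₗ[𝕜] V} (hT : S₁ ∘ₗ T = S₂) :
    stabVec A S₁ = finiteRankDet T • stabVec A S₂ := by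
  have := hA.ker
  have := hA.coker
  obtain ⟨P₁, hP₁, hS₁⟩ := h₁.proj
  obtain ⟨P₂, hP₂, hS₂⟩ := h₂.proj
  let ι := A.ker.subtype
  -- An intermediate stabilization, with the isomorphism of S₁ on Ker A and the projection of S₂.
  -- Changing the projection costs determinant one; changing the isomorphism costs a determinant on
  -- Ker A.
  let S₁₂ : V →ₗ[𝕜] W := A + (S₁ ∘ₗ ι) ∘ₗ P₂
  have hι : ∀ x : A.ker, S₁₂ x = S₁ x := fun x => by
    simp [S₁₂, hP₂, ι]
  have h₁₂ : IsStabilization A S₁₂ := by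
    refine ⟨⟨P₂, hP₂, fun x => ?_⟩, ?_⟩
    · rw [hι]; rfl
    · convert h₁.bijective using 2
      ext x
      simp [hι]
  let T₁ : V →ₗ[𝕜] V := LinearMap.id + ι ∘ₗ (P₂ - P₁)
  have hT₁ : S₁ ∘ₗ T₁ = S₁₂ := by
    ext x
    simp only [T₁, S₁₂, LinearMap.comp_apply, LinearMap.add_apply, LinearMap.id_apply,
      LinearMap.sub_apply, map_add, map_sub]
    nth_rewrite 1 [hS₁ x]
    simp only [ι, Submodule.subtype_apply]
    abel
  have hd₁ : finiteRankDet T₁ = 1 := by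
    rw [finiteRankDet_id_add_comp]
    -- Both projections are the identity on Ker A, so after exchanging the factors the determinant
    -- is that of the identity.
    have : (P₂ - P₁) ∘ₗ ι = 0 := by
      ext x
      simp [ι, hP₁, hP₂]
    rw [this, add_zero, LinearMap.det_id]
  let U : A.ker →ₗ[𝕜] V := h₁₂.equiv.symm.toLinearMap ∘ₗ (S₂ - S₁) ∘ₗ ι
  have hU : ∀ k : A.ker, S₁₂ (U k) = S₂ k - S₁ k := fun k => by
    simp [U, ι]
  let T₂ : V →ₗ[𝕜] V := LinearMap.id + U ∘ₗ P₂
  have hT₂ : S₁₂ ∘ₗ T₂ = S₂ := by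
    ext x
    simp only [T₂, LinearMap.comp_apply, LinearMap.add_apply, LinearMap.id_apply, map_add, hU]
    rw [hS₂ x]
    simp only [S₁₂, LinearMap.add_apply, LinearMap.comp_apply, ι, Submodule.subtype_apply]
    abel
  have hTT : T = T₁ ∘ₗ T₂ := by
    ext x
    apply h₁.bijective_self.1
    have e1 := LinearMap.congr_fun hT x
    have e2 := LinearMap.congr_fun hT₁ (T₂ x)
    have e3 := LinearMap.congr_fun hT₂ x
    simp only [LinearMap.comp_apply] at e1 e2 e3 ⊢
    rw [e1, e2, e3]
  have hr : FiniteRank (A - A) := FiniteRank.refl A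
  -- Modulo Im A, the isomorphisms Ker A → Coker A of S₁ and S₂ differ by 1 + P₂ U, the endomorphism
  -- whose determinant is det T₂.
  have hcomp : A.range.mkQ ∘ₗ S₂ ∘ₗ ι = (A.range.mkQ ∘ₗ S₁ ∘ₗ ι) ∘ₗ (LinearMap.id + P₂ ∘ₗ U) := by
    ext k
    have e : S₂ k = S₁ k + S₁ (P₂ (U k)) + A (U k) := by
      have := hU k
      simp only [S₁₂, LinearMap.add_apply, LinearMap.comp_apply, ι, Submodule.subtype_apply] at this
      rw [eq_sub_iff_add_eq] at this
      rw [← this]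
      abel
    have e0 : A.range.mkQ (A (U k)) = 0 := by
      rw [Submodule.mkQ_apply, Submodule.Quotient.mk_eq_zero]
      exact ⟨_, rfl⟩
    change A.range.mkQ (S₂ k) = A.range.mkQ (S₁ (k + P₂ (U k) : A.ker))
    rw [e, map_add, e0, add_zero]
    simp
  rw [hTT, finiteRankDet_comp (h₁.finiteRank_id_sub hA hA h₁₂ hr hT₁)
    (h₁₂.finiteRank_id_sub hA hA h₂ hr hT₂), hd₁, one_mul, finiteRankDet_id_add_comp]
  unfold stabVec
  have hb := h₂.bijective
  change Function.Bijective (A.range.mkQ ∘ₗ S₂ ∘ₗ ι) at hb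
  change detVec (A.range.mkQ ∘ₗ S₁ ∘ₗ ι) = _ • detVec (A.range.mkQ ∘ₗ S₂ ∘ₗ ι)
  rw [hcomp] at hb ⊢
  exact detVec_comp_endo h₁.bijective hb

end IsStabilization

/-! ### Pseudo-inverses, and perturbation triples in index zero -/

namespace IsPseudoInverse

variable {A : V →ₗ[𝕜] W} {A' : W →ₗ[𝕜] V}

theorem coe_kerProj (h : IsPseudoInverse A A') (x : V) : (h.kerProj x : V) = x - A' (A x) := rfl

theorem kerProj_coe (h : IsPseudoInverse A A') (x : A.ker) : h.kerProj x = x := by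
  apply Subtype.ext
  rw [h.coe_kerProj, x.2, map_zero, sub_zero]

theorem kerProj_apply (h : IsPseudoInverse A A') (y : W) : h.kerProj (A' y) = 0 := by
  apply Subtype.ext
  rw [h.coe_kerProj, h.right, sub_self]; rfl

theorem kerProj_eq_zero_iff (h : IsPseudoInverse A A') {x : V} :
    h.kerProj x = 0 ↔ x ∈ A'.range := by
  constructor
  · intro hx
    have := congrArg Subtype.val hx
    rw [h.coe_kerProj] at this
    exact ⟨A x, (sub_eq_zero.1 this).symm⟩
  · rintro ⟨y, rfl⟩
    exact h.kerProj_apply y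

theorem bijective_ker_coker (h : IsPseudoInverse A A') :
    Function.Bijective (A.range.mkQ ∘ₗ A'.ker.subtype) := by
  constructor
  · rw [injective_iff_map_eq_zero]
    intro y hy
    have hy' : (y : W) ∈ A.range := by
      rwa [LinearMap.comp_apply, Submodule.mkQ_apply, Submodule.Quotient.mk_eq_zero] at hy
    obtain ⟨x, hx⟩ := hy'
    apply Subtype.ext
    rw [← hx, ← h.left x, hx, y.2, map_zero]; rfl
  · intro q
    obtain ⟨w, rfl⟩ := A.range.mkQ_surjective q
    refine ⟨h.symm.kerProj w, ?_⟩
    rw [LinearMap.comp_apply, Submodule.subtype_apply, h.symm.coe_kerProj, map_sub, sub_eq_self,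
      Submodule.mkQ_apply, Submodule.Quotient.mk_eq_zero]
    exact ⟨_, rfl⟩

theorem isStabilization (h : IsPseudoInverse A A') {L : A.ker →ₗ[𝕜] W}
    (hL : Function.Bijective (A.range.mkQ ∘ₗ L)) : IsStabilization A (A + L ∘ₗ h.kerProj) := by
  refine ⟨⟨h.kerProj, h.kerProj_coe, fun x => ?_⟩, ?_⟩
  · simp [h.kerProj_coe]
  · convert hL using 2
    ext x
    simp [h.kerProj_coe]

theorem stabVec_add (h : IsPseudoInverse A A') (L : A.ker →ₗ[𝕜] W) :
    stabVec A (A + L ∘ₗ h.kerProj) = detVec (A.range.mkQ ∘ₗ L) := by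
  unfold stabVec
  congr 2
  ext x
  simp [h.kerProj_coe]

/-- A map `M : Ker A' → V` that is invertible modulo `Im A'` defines a stabilization of `A`, which is
inverse to the stabilization `A' + M Q` of `A'` up to an operator of determinant one. -/
theorem exists_isStabilization (h : IsPseudoInverse A A') {M : A'.ker →ₗ[𝕜] V}
    [FiniteDimensional 𝕜 A'.ker]
    (hM : Function.Bijective (h.kerProj ∘ₗ M)) :
    ∃ S, IsStabilization A S ∧ (∀ y : A'.ker, S (h.kerProj (M y)) = y) ∧
      FiniteRank (LinearMap.id - S ∘ₗ (A' + M ∘ₗ h.symm.kerProj)) ∧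
      finiteRankDet (S ∘ₗ (A' + M ∘ₗ h.symm.kerProj)) = 1 := by
  let m := LinearEquiv.ofBijective _ hM
  have hm : ∀ y, m y = h.kerProj (M y) := fun _ => rfl
  -- L inverts the Ker A component of M. Then (A + L P)(A' + M Q) = 1 + A M Q, and its determinant
  -- is 1 because Q A = 0.
  let L : A.ker →ₗ[𝕜] W := A'.ker.subtype ∘ₗ m.symm.toLinearMap
  have hL : Function.Bijective (A.range.mkQ ∘ₗ L) := by
    change Function.Bijective ((A.range.mkQ ∘ₗ A'.ker.subtype) ∘ₗ m.symm.toLinearMap)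
    exact h.bijective_ker_coker.comp m.symm.bijective
  have hS2 : (A + L ∘ₗ h.kerProj) ∘ₗ (A' + M ∘ₗ h.symm.kerProj) =
      LinearMap.id + (A ∘ₗ M) ∘ₗ h.symm.kerProj := by
    ext y
    simp only [LinearMap.comp_apply, LinearMap.add_apply, map_add, h.kerProj_apply, ← hm, L,
      LinearEquiv.coe_coe, LinearEquiv.symm_apply_apply, map_zero, LinearMap.id_apply,
      Submodule.subtype_apply, h.symm.coe_kerProj]
    abel
  have hr : FiniteRank ((A ∘ₗ M) ∘ₗ h.symm.kerProj) :=
    (FiniteRank.of_finiteDimensional_left _).comp_right _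
  refine ⟨_, h.isStabilization hL, fun y => ?_, ?_, ?_⟩
  · simp [h.kerProj_coe, L, ← hm]
  · rw [hS2, sub_add_cancel_left]
    exact hr.neg
  · rw [hS2, finiteRankDet_id_add_comp]
    have : h.symm.kerProj ∘ₗ A ∘ₗ M = 0 := by
      ext y
      simp [h.symm.kerProj_apply]
    rw [this, add_zero, LinearMap.det_id]

end IsPseudoInverse

theorem DetLine.exists_coe_eq_one (h : Module.finrank 𝕜 V = 0) :
    ∃ t : DetLine 𝕜 V, (t : ExteriorAlgebra 𝕜 V) = 1 := by
  refine ⟨⟨1, ?_⟩, rfl⟩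
  rw [h]
  change _ ∈ (LinearMap.range (ExteriorAlgebra.ι 𝕜)) ^ 0
  rw [pow_zero]
  exact Submodule.one_le.1 le_rfl

theorem DetLine.exists_eq_algebraMap (h : Module.finrank 𝕜 V = 0) {t : DetLine 𝕜 V} (ht : t ≠ 0) :
    ∃ c : 𝕜, c ≠ 0 ∧ (t : ExteriorAlgebra 𝕜 V) = algebraMap 𝕜 _ c := by
  have h1 := t.2
  have h2 : (t : ExteriorAlgebra 𝕜 V) ∈ (LinearMap.range (ExteriorAlgebra.ι 𝕜)) ^ 0 := by
    rwa [← h]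
  rw [pow_zero, Submodule.mem_one] at h2
  obtain ⟨c, hc⟩ := h2
  refine ⟨c, fun h0 => ht (Subtype.ext ?_), hc.symm⟩
  rw [← hc, h0, map_zero]; rfl

theorem toDetLine_map_mul_algebraMap (f : V →ₗ[𝕜] W)
    (h : Module.finrank 𝕜 V = Module.finrank 𝕜 W) (x : DetLine 𝕜 V) (c : 𝕜) :
    toDetLine (ExteriorAlgebra.map f x.1 * algebraMap 𝕜 _ c) = c • detMap f x := by
  rw [← Algebra.commutes, ← Algebra.smul_def, ← map_smul]
  have := toDetLine_map h f (c • x)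
  rw [map_smul] at this
  exact this

theorem bijective_of_finrank_eq_of_injective [FiniteDimensional 𝕜 V] [FiniteDimensional 𝕜 W]
    (h : Module.finrank 𝕜 V = Module.finrank 𝕜 W) {f : V →ₗ[𝕜] W} (hf : Function.Injective f) :
    Function.Bijective f :=
  ⟨hf, (LinearMap.injective_iff_surjective_of_finrank_eq_finrank h).1 hf⟩

theorem bijective_of_finrank_eq_of_surjective [FiniteDimensional 𝕜 V] [FiniteDimensional 𝕜 W]
    (h : Module.finrank 𝕜 V = Module.finrank 𝕜 W) {f : V →ₗ[𝕜] W} (hf : Function.Surjective f) :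
    Function.Bijective f :=
  ⟨(LinearMap.injective_iff_surjective_of_finrank_eq_finrank h).2 hf, hf⟩

/-- `P` is the isomorphism defined by stabilizations `S_A` and `S_B` and by `det (S_B⁻¹ S_A)`. -/
def IsStabilizedIso (A B : V →ₗ[𝕜] W) (S_A S_B : V →ₗ[𝕜] W)
    (P : FredholmDet A →ₗ[𝕜] FredholmDet B) : Prop :=
  ∀ T : V →ₗ[𝕜] V, S_B ∘ₗ T = S_A → P (stabVec A S_A) = (finiteRankDet T)⁻¹ • stabVec B S_B

variable {A B : V →ₗ[𝕜] W}

/-- Equality of dimensions makes L and M bijective modulo the images. So Ker M = 0, its complement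
Ker N is everything, N = 0, and t₁ may be taken to be 1. -/
theorem IsPerturbationIsoNonpos.exists_stabilization (hA : IsFredholmMap A) (hB : IsFredholmMap B)
    (hAB : FiniteRank (A - B))
    (hA0 : Module.finrank 𝕜 A.ker = Module.finrank 𝕜 (W ⧸ A.range))
    (hB0 : Module.finrank 𝕜 B.ker = Module.finrank 𝕜 (W ⧸ B.range))
    {P : FredholmDet A →ₗ[𝕜] FredholmDet B} (hP : IsPerturbationIsoNonpos A B P) :
    ∃ S_A S_B, IsStabilization A S_A ∧ IsStabilization B S_B ∧ IsStabilizedIso A B S_A S_B P := by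
  have := hA.ker
  have := hA.coker
  have := hB.ker
  have := hB.coker
  obtain ⟨A', B', pA, pB, L, M, N, htr, hP⟩ := hP
  have hL := bijective_of_finrank_eq_of_injective hA0 htr.injective_L
  let θ := LinearEquiv.ofBijective _ pB.bijective_ker_coker
  have : FiniteDimensional 𝕜 B'.ker := FiniteDimensional.of_injective _ θ.injective
  have hm : Function.Bijective (pB.kerProj ∘ₗ M) := by
    refine bijective_of_finrank_eq_of_surjective (θ.finrank_eq.trans hB0.symm) fun k => ?_
    obtain ⟨t, ht⟩ := htr.surjective_M (B'.range.mkQ k)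
    refine ⟨t, ?_⟩
    have : M t - k ∈ B'.range := by
      rw [← Submodule.Quotient.mk_eq_zero, Submodule.Quotient.mk_sub, sub_eq_zero]
      exact ht
    rw [← pB.kerProj_eq_zero_iff, map_sub, pB.kerProj_coe, sub_eq_zero] at this
    exact this
  obtain ⟨S, hS, hSM, hr, hd⟩ := pB.exists_isStabilization hm
  refine ⟨_, S, pA.isStabilization hL, hS, fun T hT => ?_⟩
  have hMker : M.ker = ⊥ := by
    rw [LinearMap.ker_eq_bot]
    exact Function.Injective.of_comp (f := pB.kerProj) hm.1
  have hNker : N.ker = ⊤ := by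
    have := htr.isCompl
    rw [hMker] at this
    exact eq_top_of_bot_isCompl this
  have hN : N = 0 := LinearMap.ker_eq_top.1 hNker
  have hj : Function.Bijective N.ker.subtype :=
    ⟨Subtype.val_injective, fun x => ⟨⟨x, hNker ▸ trivial⟩, rfl⟩⟩
  obtain ⟨s, hs⟩ := exists_detLine_ne_zero 𝕜 A.ker
  obtain ⟨t₀, ht₀⟩ := exists_detLine_ne_zero 𝕜 N.ker
  obtain ⟨t₁, ht₁⟩ := DetLine.exists_coe_eq_one (𝕜 := 𝕜) (V := M.ker) (by rw [hMker, finrank_bot])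
  have hmj : Function.Bijective (pB.kerProj ∘ₗ M ∘ₗ N.ker.subtype) := hm.comp hj
  have hθj : Function.Bijective (B.range.mkQ ∘ₗ B'.ker.subtype ∘ₗ N.ker.subtype) :=
    pB.bijective_ker_coker.comp hj
  have key := hP s t₁ t₀ hs (fun h => by simp [h] at ht₁) ht₀
  rw [ht₁, map_one, map_one, mul_one, mul_one, toDetLine_map (LinearMap.finrank_eq_of_bijective hL),
    toDetLine_map (LinearMap.finrank_eq_of_bijective hmj),
    toDetLine_map (LinearMap.finrank_eq_of_bijective hθj)] at key
  have hTr := hS.finiteRank_id_sub hB hA (pA.isStabilization hL) hAB.symm hT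
  rw [pA.stabVec_add, detVec_eq hL hs, key]
  congr 1
  -- Σ is the product of S T S⁻¹ and S (B' + M Q). The second factor has determinant one, so det Σ =
  -- det T.
  · have e1 : (A + L ∘ₗ pA.kerProj) ∘ₗ (B' + M ∘ₗ pB.symm.kerProj) + N ∘ₗ pB.symm.kerProj =
        (hS.equiv.toLinearMap ∘ₗ T ∘ₗ hS.equiv.symm.toLinearMap) ∘ₗ
          (S ∘ₗ (B' + M ∘ₗ pB.symm.kerProj)) := by
      rw [hN, LinearMap.zero_comp, add_zero, ← hT]
      ext x
      simp
    have hr' : FiniteRank (LinearMap.id - hS.equiv.toLinearMap ∘ₗ T ∘ₗ hS.equiv.symm.toLinearMap) := by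
      have : LinearMap.id - hS.equiv.toLinearMap ∘ₗ T ∘ₗ hS.equiv.symm.toLinearMap =
          hS.equiv.toLinearMap ∘ₗ (LinearMap.id - T) ∘ₗ hS.equiv.symm.toLinearMap := by
        ext x; simp
      rw [this]
      exact (hTr.comp_right _).comp_left _
    rw [e1, finiteRankDet_comp hr' hr, hd, mul_one, finiteRankDet_conj _ _ hTr]
  · unfold stabVec
    rw [detVec_eq hS.bijective (detMap_ne_zero hmj ht₀),
      detMap_comp_apply (LinearMap.finrank_eq_of_bijective hmj) hB0]
    congr 3
    refine congrArg detMap ?_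
    ext y
    simp [hSM]

/-- Here Ker L = 0 forces N = 0, and s₀ may be taken to be 1. The factors of Σ occur in the opposite
order. -/
theorem IsPerturbationIsoNonneg.exists_stabilization (hA : IsFredholmMap A) (hB : IsFredholmMap B)
    (hAB : FiniteRank (A - B))
    (hA0 : Module.finrank 𝕜 A.ker = Module.finrank 𝕜 (W ⧸ A.range))
    (hB0 : Module.finrank 𝕜 B.ker = Module.finrank 𝕜 (W ⧸ B.range))
    {P : FredholmDet A →ₗ[𝕜] FredholmDet B} (hP : IsPerturbationIsoNonneg A B P) :
    ∃ S_A S_B, IsStabilization A S_A ∧ IsStabilization B S_B ∧ IsStabilizedIso A B S_A S_B P := by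
  have := hA.ker
  have := hA.coker
  have := hB.ker
  have := hB.coker
  obtain ⟨A', B', pA, pB, L, M, N, htr, hP⟩ := hP
  have hL := bijective_of_finrank_eq_of_surjective hA0 htr.surjective_L
  let θ := LinearEquiv.ofBijective _ pB.bijective_ker_coker
  have : FiniteDimensional 𝕜 B'.ker := FiniteDimensional.of_injective _ θ.injective
  have hm : Function.Bijective (pB.kerProj ∘ₗ M) := by
    refine bijective_of_finrank_eq_of_injective (θ.finrank_eq.trans hB0.symm) ?_
    rw [injective_iff_map_eq_zero]
    intro t ht
    refine htr.injective_M ?_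
    rw [map_zero, LinearMap.comp_apply, Submodule.mkQ_apply, Submodule.Quotient.mk_eq_zero]
    exact pB.kerProj_eq_zero_iff.1 ht
  obtain ⟨S, hS, hSM, hr, hd⟩ := pB.exists_isStabilization hm
  refine ⟨_, S, pA.isStabilization hL, hS, fun T hT => ?_⟩
  have hLker : L.ker = ⊥ := by
    rw [LinearMap.ker_eq_bot]
    exact Function.Injective.of_comp (f := A.range.mkQ) hL.1
  have hNker : N.ker = ⊤ := by
    have := htr.isCompl
    rw [hLker] at this
    exact eq_top_of_bot_isCompl this
  have hN : N = 0 := LinearMap.ker_eq_top.1 hNker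
  have hj : Function.Bijective N.ker.subtype :=
    ⟨Subtype.val_injective, fun x => ⟨⟨x, hNker ▸ trivial⟩, rfl⟩⟩
  obtain ⟨s₁, hs₁⟩ := exists_detLine_ne_zero 𝕜 N.ker
  obtain ⟨t, ht⟩ := exists_detLine_ne_zero 𝕜 B'.ker
  obtain ⟨s₀, hs₀⟩ := DetLine.exists_coe_eq_one (𝕜 := 𝕜) (V := L.ker) (by rw [hLker, finrank_bot])
  have hLj : Function.Bijective (A.range.mkQ ∘ₗ L ∘ₗ N.ker.subtype) := hL.comp hj
  have key := hP s₀ s₁ t (fun h => by simp [h] at hs₀) hs₁ ht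
  rw [hs₀, map_one, map_one, one_mul, one_mul,
    toDetLine_map (LinearMap.finrank_eq_of_bijective hLj),
    toDetLine_map (LinearMap.finrank_eq_of_bijective hm),
    toDetLine_map (LinearMap.finrank_eq_of_bijective hj),
    toDetLine_map (LinearMap.finrank_eq_of_bijective pB.bijective_ker_coker)] at key
  have hTr := hS.finiteRank_id_sub hB hA (pA.isStabilization hL) hAB.symm hT
  rw [pA.stabVec_add, detVec_eq hL (detMap_ne_zero hj hs₁),
    detMap_comp_apply (LinearMap.finrank_eq_of_bijective hj) hA0]
  refine key.trans ?_
  congr 1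
  · set T' := B' + M ∘ₗ pB.symm.kerProj with hT'
    -- Σ = S⁻¹ (S T') S T, where S T' has determinant one, so again det Σ = det T.
    have e1 : T' ∘ₗ (A + L ∘ₗ pA.kerProj) + N ∘ₗ pA.kerProj =
        (hS.equiv.symm.toLinearMap ∘ₗ (S ∘ₗ T') ∘ₗ hS.equiv.symm.symm.toLinearMap) ∘ₗ T := by
      rw [hN, LinearMap.zero_comp, add_zero, ← hT]
      ext x
      simp
    have hr' : FiniteRank (LinearMap.id -
        hS.equiv.symm.toLinearMap ∘ₗ (S ∘ₗ T') ∘ₗ hS.equiv.symm.symm.toLinearMap) := by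
      have : LinearMap.id -
            hS.equiv.symm.toLinearMap ∘ₗ (S ∘ₗ T') ∘ₗ hS.equiv.symm.symm.toLinearMap =
          hS.equiv.symm.toLinearMap ∘ₗ (LinearMap.id - S ∘ₗ T') ∘ₗ hS.equiv.toLinearMap := by
        ext x; simp
      rw [this]
      exact (hr.comp_right _).comp_left _
    rw [e1, finiteRankDet_comp hr' hTr, finiteRankDet_conj _ _ hr, hd, one_mul]
  · unfold stabVec
    rw [detVec_eq hS.bijective (detMap_ne_zero hm ht),
      detMap_comp_apply (LinearMap.finrank_eq_of_bijective hm) hB0]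
    congr 3
    refine congrArg detMap ?_
    ext y
    simp [hSM]

/-- The perturbation isomorphism in index zero is given by stabilizations. -/
theorem IsFredholmPerturbationIso.exists_stabilization
    (hA0 : Module.finrank 𝕜 A.ker = Module.finrank 𝕜 (W ⧸ A.range))
    (hB0 : Module.finrank 𝕜 B.ker = Module.finrank 𝕜 (W ⧸ B.range))
    {P : FredholmDet A →ₗ[𝕜] FredholmDet B} (hP : IsFredholmPerturbationIso A B P) :
    ∃ S_A S_B, IsStabilization A S_A ∧ IsStabilization B S_B ∧ IsStabilizedIso A B S_A S_B P := by
  obtain ⟨hA, hB, hAB, ⟨-, hP⟩ | ⟨-, hP⟩⟩ := hP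
  · exact hP.exists_stabilization hA hB hAB hA0 hB0
  · exact hP.exists_stabilization hA hB hAB hA0 hB0

set_option maxHeartbeats 400000 in
/-- Pseudo-inverses and mutually inverse isomorphisms `Ker B ≅ Ker B'` define a perturbation
isomorphism. -/
theorem isFredholmPerturbationIso_of_stabilization (hA : IsFredholmMap A) (hB : IsFredholmMap B)
    (hAB : FiniteRank (A - B))
    (hA0 : Module.finrank 𝕜 A.ker = Module.finrank 𝕜 (W ⧸ A.range))
    (hB0 : Module.finrank 𝕜 B.ker = Module.finrank 𝕜 (W ⧸ B.range))
    {A' B' : W →ₗ[𝕜] V} (pA : IsPseudoInverse A A') (pB : IsPseudoInverse B B')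
    {L : A.ker →ₗ[𝕜] W} (hL : Function.Bijective (A.range.mkQ ∘ₗ L)) (m : B'.ker ≃ₗ[𝕜] B.ker)
    {P : FredholmDet A →ₗ[𝕜] FredholmDet B}
    (hP : IsStabilizedIso A B (A + L ∘ₗ pA.kerProj)
      (B + (B'.ker.subtype ∘ₗ m.symm.toLinearMap) ∘ₗ pB.kerProj) P) :
    IsFredholmPerturbationIso A B P := by
  have := hA.ker
  have := hA.coker
  have := hB.ker
  have := hB.coker
  let θ := LinearEquiv.ofBijective _ pB.bijective_ker_coker
  have : FiniteDimensional 𝕜 B'.ker := FiniteDimensional.of_injective _ θ.injective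
  have hLB : Function.Bijective (B.range.mkQ ∘ₗ B'.ker.subtype ∘ₗ m.symm.toLinearMap) :=
    pB.bijective_ker_coker.comp m.symm.bijective
  have hS := pB.isStabilization hLB
  set S := B + (B'.ker.subtype ∘ₗ m.symm.toLinearMap) ∘ₗ pB.kerProj with hSdef
  let M : B'.ker →ₗ[𝕜] V := B.ker.subtype ∘ₗ m.toLinearMap
  have hMm : ∀ y, pB.kerProj (M y) = m y := fun y => pB.kerProj_coe _
  -- The index is zero, so the formula for nonpositive index applies. It is used with M the
  -- inclusion of Ker B composed with m, and N = 0.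
  refine ⟨hA, hB, hAB, Or.inl ⟨?_, A', B', pA, pB, L, M, 0, ?_, ?_⟩⟩
  · rw [LinearMap.index_eq_finrank_sub, hA0, sub_self]
  · have hMker : M.ker = ⊥ :=
      LinearMap.ker_eq_bot.2 (Subtype.val_injective.comp m.injective)
    refine ⟨hL.1, fun q => ?_, ?_, ?_⟩
    · obtain ⟨v, rfl⟩ := B'.range.mkQ_surjective q
      refine ⟨m.symm (pB.kerProj v), ?_⟩
      rw [LinearMap.comp_apply, ← sub_eq_zero, ← map_sub, Submodule.mkQ_apply,
        Submodule.Quotient.mk_eq_zero, ← pB.kerProj_eq_zero_iff, map_sub, hMm,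
        LinearEquiv.apply_symm_apply, sub_self]
    · have : (A.range ⊔ L.range) = ⊤ := by
        rw [eq_top_iff]
        intro w _
        obtain ⟨k, hk⟩ := hL.2 (A.range.mkQ w)
        rw [Submodule.mem_sup]
        refine ⟨w - L k, ?_, L k, ⟨k, rfl⟩, sub_add_cancel _ _⟩
        rw [← Submodule.Quotient.mk_eq_zero, Submodule.Quotient.mk_sub, sub_eq_zero]
        exact hk.symm
      have h1 : Subsingleton (W ⧸ (A.range ⊔ L.range)) := Submodule.Quotient.subsingleton_iff.2 this
      have h2 : Subsingleton M.ker := by rw [hMker]; infer_instance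
      exact ⟨fun _ _ _ => Subsingleton.elim _ _, fun _ => ⟨0, Subsingleton.elim _ _⟩⟩
    · rw [hMker, LinearMap.ker_zero]
      exact isCompl_bot_top
  · intro s t₁ t₀ hs ht₁ ht₀
    have hMker : M.ker = ⊥ :=
      LinearMap.ker_eq_bot.2 (Subtype.val_injective.comp m.injective)
    -- Ker M = 0, so t₁ is a nonzero scalar c, and both sides of the formula scale by c⁻¹.
    obtain ⟨c, hc, hct⟩ := DetLine.exists_eq_algebraMap (by rw [hMker, finrank_bot]) ht₁
    have hj : Function.Bijective (0 : B'.ker →ₗ[𝕜] W).ker.subtype :=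
      ⟨Subtype.val_injective, fun x => ⟨⟨x, by simp⟩, rfl⟩⟩
    set j := (0 : B'.ker →ₗ[𝕜] W).ker.subtype with hjdef
    have hm : Function.Bijective (pB.kerProj ∘ₗ M) := by
      have : pB.kerProj ∘ₗ M = m.toLinearMap := LinearMap.ext hMm
      rw [this]; exact m.bijective
    have hmj : Function.Bijective (pB.kerProj ∘ₗ M ∘ₗ j) := hm.comp hj
    have hθj : Function.Bijective (B.range.mkQ ∘ₗ B'.ker.subtype ∘ₗ j) :=
      pB.bijective_ker_coker.comp hj
    rw [hct, AlgHom.commutes, AlgHom.commutes, toDetLine_map_mul_algebraMap _ (LinearMap.finrank_eq_of_bijective hL),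
      toDetLine_map_mul_algebraMap _ (LinearMap.finrank_eq_of_bijective hθj),
      toDetLine_map (LinearMap.finrank_eq_of_bijective hmj),
      dualVector_smul (detMap_ne_zero hL hs) hc, dualVector_smul (detMap_ne_zero hθj ht₀) hc,
      TensorProduct.tmul_smul, TensorProduct.tmul_smul, map_smul, smul_comm _ c⁻¹]
    congr 1
    -- Since M takes values in Ker B, the term B M Q vanishes, and B' + M Q is the exact inverse of
    -- S.
    have hSinv : S ∘ₗ (B' + M ∘ₗ pB.symm.kerProj) = LinearMap.id := by
      ext y
      simp only [hSdef, LinearMap.comp_apply, LinearMap.add_apply, map_add, pB.kerProj_apply, hMm,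
        LinearEquiv.coe_coe, LinearEquiv.symm_apply_apply, map_zero, LinearMap.id_apply,
        Submodule.subtype_apply, pB.symm.coe_kerProj]
      have : B (M (pB.symm.kerProj y)) = 0 := (m (pB.symm.kerProj y)).2
      rw [this]
      abel
    have hinv : (B' + M ∘ₗ pB.symm.kerProj) = hS.equiv.symm.toLinearMap := by
      ext y
      apply hS.bijective_self.1
      have := LinearMap.congr_fun hSinv y
      simpa using this
    set S_A := A + L ∘ₗ pA.kerProj with hSA
    have hT : S ∘ₗ (hS.equiv.symm.toLinearMap ∘ₗ S_A) = S_A := by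
      ext x; simp
    have hTr := hS.finiteRank_id_sub hB hA (pA.isStabilization hL) hAB.symm hT
    have key := hP _ hT
    rw [pA.stabVec_add, detVec_eq hL hs] at key
    have hdet : finiteRankDet (S_A ∘ₗ hS.equiv.symm.toLinearMap) =
        finiteRankDet (hS.equiv.symm.toLinearMap ∘ₗ S_A) := by
      rw [← finiteRankDet_conj _ hS.equiv hTr]
      refine congrArg finiteRankDet (LinearMap.ext fun x => ?_)
      simp
    have e : B.range.mkQ ∘ₗ B'.ker.subtype ∘ₗ j =
        (B.range.mkQ ∘ₗ S ∘ₗ B.ker.subtype) ∘ₗ (pB.kerProj ∘ₗ M ∘ₗ j) := by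
      have : ∀ y, S (pB.kerProj (M y)) = y := fun y => by
        simp [hSdef, hMm, pB.kerProj_coe]
      refine LinearMap.ext fun y => ?_
      simp only [LinearMap.comp_apply, Submodule.subtype_apply, this]
    unfold stabVec at key
    rw [detVec_eq hS.bijective (detMap_ne_zero hmj ht₀),
      detMap_comp_apply (LinearMap.finrank_eq_of_bijective hmj) hB0, ← e] at key
    have hdet₂ : finiteRankDet (S_A ∘ₗ (B' + M ∘ₗ pB.symm.kerProj) +
        (0 : B'.ker →ₗ[𝕜] W) ∘ₗ pB.symm.kerProj) =
        finiteRankDet (hS.equiv.symm.toLinearMap ∘ₗ S_A) := by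
      rw [LinearMap.zero_comp, add_zero (S_A ∘ₗ _), ← hdet]
      exact congrArg (fun R => finiteRankDet (S_A ∘ₗ R)) hinv
    refine key.trans ?_
    exact congrArg (fun c : 𝕜 => c⁻¹ • _) hdet₂.symm

end Stabilization

/-! ### Two-periodic complexes: uniqueness of the perturbation isomorphism -/

namespace TwoPeriodicComplex

noncomputable section

variable {𝕜 : Type*} [Field 𝕜] {Vp Vm : Type*}
variable [AddCommGroup Vp] [Module 𝕜 Vp] [AddCommGroup Vm] [Module 𝕜 Vm]

/-- The complex with the roles of the even and the odd part exchanged. -/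
@[simps] def swap (D : TwoPeriodicComplex 𝕜 Vp Vm) : TwoPeriodicComplex 𝕜 Vm Vp where
  dp := D.dm
  dm := D.dp
  dm_dp := D.dp_dm
  dp_dm := D.dm_dp

namespace IsPseudoInv

variable {D E : TwoPeriodicComplex 𝕜 Vp Vm} {D' E' D₁ D₂ E₁ E₂ : TwoPeriodicComplex 𝕜 Vm Vp}

theorem swap (h : D.IsPseudoInv D') : D.swap.IsPseudoInv D'.swap :=
  ⟨⟨h.isFredholm.minus, h.isFredholm.plus⟩, h.minus, h.plus⟩

theorem mem_ker_sigmaPlus (h : D.IsPseudoInv D') {x : Vp} :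
    x ∈ (D.sigmaPlus D').ker ↔ D.dp x = 0 ∧ D'.dm x = 0 := by
  constructor
  · intro hx
    have h1 : D.dp x = 0 := h.ker_sigmaPlus_le hx
    refine ⟨h1, ?_⟩
    have h2 : D.dp x + D'.dm x = 0 := hx
    rwa [h1, zero_add] at h2
  · rintro ⟨h1, h2⟩
    change D.dp x + D'.dm x = 0
    rw [h1, h2, add_zero]

theorem range_dm_le (h : D.IsPseudoInv D') : D'.dm.range ≤ (D.sigmaPlus D').range := by
  rintro _ ⟨x, rfl⟩
  refine ⟨D.dm (D'.dm x), ?_⟩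
  simp [sigmaPlus, D.dp_dm, h.minus.right]

/-- As in Hodge theory: Ker σ₊ consists of the cycles killed by d₋', and each homology class of a
cycle x has the unique such representative x - d₋ d₋' x. -/
theorem bijective_kerToHPlus (h : D.IsPseudoInv D') : Function.Bijective h.kerToHPlus := by
  constructor
  · rw [injective_iff_map_eq_zero]
    intro x hx
    have hx1 := h.mem_ker_sigmaPlus.1 x.2
    have hx2 : (x : Vp) ∈ D.dm.range := by
      rwa [kerToHPlus, LinearMap.comp_apply, Submodule.mkQ_apply,
        Submodule.Quotient.mk_eq_zero] at hx
    obtain ⟨y, hy⟩ := hx2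
    apply Subtype.ext
    rw [← hy, ← h.minus.left y, hy, hx1.2, map_zero]; rfl
  · intro q
    obtain ⟨x, rfl⟩ := Submodule.mkQ_surjective _ q
    have hx : D.dp x = 0 := x.2
    have hk : (x : Vp) - D.dm (D'.dm x) ∈ (D.sigmaPlus D').ker := by
      rw [h.mem_ker_sigmaPlus, map_sub, map_sub, hx, D.dp_dm, h.minus.right]
      simp
    refine ⟨⟨_, hk⟩, ?_⟩
    rw [kerToHPlus, LinearMap.comp_apply, Submodule.mkQ_apply, Submodule.mkQ_apply,
      Submodule.Quotient.eq]
    refine ⟨-D'.dm x, ?_⟩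
    simp

theorem bijective_hMinusToCoker (h : D.IsPseudoInv D') : Function.Bijective h.hMinusToCoker := by
  constructor
  · rw [injective_iff_map_eq_zero]
    intro q hq
    obtain ⟨y, rfl⟩ := Submodule.mkQ_surjective _ q
    have hy : D.dm y = 0 := y.2
    have hy' : (y : Vm) ∈ (D.sigmaPlus D').range := by
      rwa [hMinusToCoker, Submodule.mkQ_apply, Submodule.mapQ_apply,
        Submodule.Quotient.mk_eq_zero] at hq
    obtain ⟨x, hx⟩ := hy'
    have hx' : D.dp x + D'.dm x = y := hx
    -- Applying d₋ to y = d₊ x + d₋' x and using that y is a cycle leaves d₋ d₋' x = 0, hence d₋' x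
    -- = 0.
    have h0 : D'.dm x = 0 := by
      have := congrArg D.dm hx'
      rw [map_add, D.dm_dp, zero_add, hy] at this
      rw [← h.minus.right, this, map_zero]
    rw [Submodule.mkQ_apply, Submodule.Quotient.mk_eq_zero]
    refine ⟨x, ?_⟩
    rw [h0, add_zero] at hx'
    exact hx'
  · intro q
    obtain ⟨y, rfl⟩ := Submodule.mkQ_surjective _ q
    have hk : y - D'.dm (D.dm y) ∈ D.dm.ker := by
      rw [LinearMap.mem_ker, map_sub, h.minus.left, sub_self]
    refine ⟨Submodule.Quotient.mk ⟨_, hk⟩, ?_⟩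
    rw [hMinusToCoker, Submodule.mapQ_apply, Submodule.mkQ_apply, Submodule.Quotient.eq]
    have : -D'.dm (D.dm y) ∈ (D.sigmaPlus D').range := neg_mem (h.range_dm_le ⟨_, rfl⟩)
    simpa using this

theorem isFredholmMap (h : D.IsPseudoInv D') (hD : D.IsFredholm) :
    IsFredholmMap (D.sigmaPlus D') := by
  have := hD.plus
  have := hD.minus
  exact ⟨FiniteDimensional.of_injective _ h.bijective_kerToHPlus.1,
    Module.Finite.of_surjective _ h.bijective_hMinusToCoker.2⟩

theorem finrank_ker_eq (h : D.IsPseudoInv D')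
    (hD0 : Module.finrank 𝕜 D.HPlus = Module.finrank 𝕜 D.HMinus) :
    Module.finrank 𝕜 (D.sigmaPlus D').ker =
      Module.finrank 𝕜 (Vm ⧸ (D.sigmaPlus D').range) := by
  rw [LinearMap.finrank_eq_of_bijective h.bijective_kerToHPlus, hD0,
    LinearMap.finrank_eq_of_bijective h.bijective_hMinusToCoker]

/-- The vector of `|D|` that corresponds to a stabilization of `σ₊`. -/
def stabVec (h : D.IsPseudoInv D') (S : Vp →ₗ[𝕜] Vm) : D.Det :=
  h.canonicalIso (_root_.stabVec (D.sigmaPlus D') S)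

/-- The isomorphism Λ between the homology spaces does not refer to the pseudo-inverse. This makes
vectors computed from different pseudo-inverses comparable inside |D|. -/
theorem stabVec_eq_detVec (h : D.IsPseudoInv D') (hD : D.IsFredholm) {S : Vp →ₗ[𝕜] Vm}
    (hS : IsStabilization (D.sigmaPlus D') S) {Λ : D.HPlus →ₗ[𝕜] D.HMinus}
    (hΛ : h.hMinusToCoker ∘ₗ Λ ∘ₗ h.kerToHPlus =
      (D.sigmaPlus D').range.mkQ ∘ₗ S ∘ₗ (D.sigmaPlus D').ker.subtype) :
    Function.Bijective Λ ∧ h.stabVec S = detVec Λ := by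
  have := hD.plus
  have := hD.minus
  have := (h.isFredholmMap hD).ker
  have := (h.isFredholmMap hD).coker
  have hb := hS.bijective
  rw [← hΛ] at hb
  have h1 : Function.Bijective (Λ ∘ₗ h.kerToHPlus) :=
    (Function.Bijective.of_comp_iff' h.bijective_hMinusToCoker _).1 hb
  have h2 : Function.Bijective Λ := (Function.Bijective.of_comp_iff _ h.bijective_kerToHPlus).1 h1
  refine ⟨h2, ?_⟩
  unfold stabVec _root_.stabVec canonicalIso
  rw [← hΛ]
  exact map_detMap_detVec h2 h.bijective_kerToHPlus h.bijective_hMinusToCoker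

theorem exists_stabVec_eq_detVec (h : D.IsPseudoInv D') (hD : D.IsFredholm) {S : Vp →ₗ[𝕜] Vm}
    (hS : IsStabilization (D.sigmaPlus D') S) :
    ∃ Λ : D.HPlus →ₗ[𝕜] D.HMinus, h.hMinusToCoker ∘ₗ Λ ∘ₗ h.kerToHPlus =
      (D.sigmaPlus D').range.mkQ ∘ₗ S ∘ₗ (D.sigmaPlus D').ker.subtype ∧
      Function.Bijective Λ ∧ h.stabVec S = detVec Λ := by
  let e₁ := LinearEquiv.ofBijective _ h.bijective_kerToHPlus
  let e₂ := LinearEquiv.ofBijective _ h.bijective_hMinusToCoker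
  let Λ : D.HPlus →ₗ[𝕜] D.HMinus := e₂.symm.toLinearMap ∘ₗ
    ((D.sigmaPlus D').range.mkQ ∘ₗ S ∘ₗ (D.sigmaPlus D').ker.subtype) ∘ₗ e₁.symm.toLinearMap
  have hΛ : h.hMinusToCoker ∘ₗ Λ ∘ₗ h.kerToHPlus =
      (D.sigmaPlus D').range.mkQ ∘ₗ S ∘ₗ (D.sigmaPlus D').ker.subtype := by
    refine LinearMap.ext fun x => ?_
    change e₂ (e₂.symm (_)) = _
    rw [LinearEquiv.apply_symm_apply]
    change _ = ((D.sigmaPlus D').range.mkQ ∘ₗ S ∘ₗ (D.sigmaPlus D').ker.subtype) x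
    conv_rhs => rw [← e₁.symm_apply_apply x]
    rfl
  exact ⟨Λ, hΛ, h.stabVec_eq_detVec hD hS hΛ⟩

theorem stabVec_ne_zero (h : D.IsPseudoInv D') (hD : D.IsFredholm) {S : Vp →ₗ[𝕜] Vm}
    (hS : IsStabilization (D.sigmaPlus D') S) : h.stabVec S ≠ 0 := by
  have := hD.plus
  have := hD.minus
  obtain ⟨Λ, -, hΛ, e⟩ := h.exists_stabVec_eq_detVec hD hS
  rw [e]
  exact detVec_ne_zero hΛ

/-- The projection of `V₊` onto the kernel of `σ₊`. -/
def harm (D : TwoPeriodicComplex 𝕜 Vp Vm) (D' : TwoPeriodicComplex 𝕜 Vm Vp) : Vp →ₗ[𝕜] Vp :=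
  LinearMap.id - D.dm ∘ₗ D'.dm - D'.dp ∘ₗ D.dp

/-- The even part of the unipotent chain automorphism that transforms the pseudo-inverse `D₁` of
`D` into `D₂`. -/
def transition (D : TwoPeriodicComplex 𝕜 Vp Vm) (D₁ D₂ : TwoPeriodicComplex 𝕜 Vm Vp) :
    Vp →ₗ[𝕜] Vp :=
  D.dm ∘ₗ D₁.dm + harm D D₂ ∘ₗ harm D D₁ + D₂.dp ∘ₗ D.dp

theorem transition_apply (x : Vp) : transition D D₁ D₂ x =
    D.dm (D₁.dm x) + harm D D₂ (harm D D₁ x) + D₂.dp (D.dp x) := rfl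

theorem harm_apply (x : Vp) : harm D D' x = x - D.dm (D'.dm x) - D'.dp (D.dp x) := rfl

theorem harm_dm (h : D.IsPseudoInv D') (y : Vm) : harm D D' (D.dm y) = 0 := by
  simp [harm_apply, h.minus.left, D.dp_dm]

theorem harm_dp (h : D.IsPseudoInv D') (y : Vm) : harm D D' (D'.dp y) = 0 := by
  simp [harm_apply, h.plus.right, D'.dm_dp]

theorem dp_harm (h : D.IsPseudoInv D') (x : Vp) : D.dp (harm D D' x) = 0 := by
  simp [harm_apply, h.plus.left, D.dp_dm]

theorem dm_harm (h : D.IsPseudoInv D') (x : Vp) : D'.dm (harm D D' x) = 0 := by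
  simp [harm_apply, h.minus.right, D'.dm_dp]

theorem transition_dm (h₁ : D.IsPseudoInv D₁) (y : Vm) :
    transition D D₁ D₂ (D.dm y) = D.dm y := by
  rw [transition_apply, h₁.minus.left, h₁.harm_dm, D.dp_dm, map_zero, map_zero, add_zero, add_zero]

/-- The transition map moves cycles by boundaries only, so it acts as the identity on homology. -/
theorem transition_sub_mem_range (_h₁ : D.IsPseudoInv D₁) {x : Vp} (hx : D.dp x = 0) :
    transition D D₁ D₂ x - x ∈ D.dm.range := by
  refine ⟨-D₂.dm (x - D.dm (D₁.dm x)), ?_⟩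
  have h1 : harm D D₁ x = x - D.dm (D₁.dm x) := by
    rw [harm_apply, hx, map_zero, sub_zero]
  have h2 : D.dp (x - D.dm (D₁.dm x)) = 0 := by rw [map_sub, hx, D.dp_dm, sub_zero]
  rw [transition_apply, h1, harm_apply, h2, hx]
  simp only [map_neg, map_sub, map_zero]
  abel

theorem dp_transition (h₂ : D.IsPseudoInv D₂) (x : Vp) :
    D.dp (transition D D₁ D₂ x) = D.dp x := by
  rw [transition_apply, map_add, map_add, D.dp_dm, h₂.dp_harm, h₂.plus.left]
  simp

/-- The transition map is unipotent for the filtration Im d₋ ⊆ Ker d₊ ⊆ V₊: subtracting the identity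
sends V₊ into cycles, sends cycles into boundaries, and kills boundaries. -/
theorem isNilpotent_transition_sub (h₁ : D.IsPseudoInv D₁) (h₂ : D.IsPseudoInv D₂) :
    IsNilpotent (transition D D₁ D₂ - LinearMap.id) := by
  refine ⟨3, LinearMap.ext fun x => ?_⟩
  simp only [pow_succ', pow_zero, mul_one, Module.End.mul_apply]
  set n := transition D D₁ D₂ - LinearMap.id with hn
  have e1 : D.dp (n x) = 0 := by
    rw [hn, LinearMap.sub_apply, map_sub, h₂.dp_transition, LinearMap.id_apply, sub_self]
  obtain ⟨y, hy⟩ := h₁.transition_sub_mem_range (D₂ := D₂) e1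
  have e2 : n (n x) = D.dm y := by rw [hy]; rfl
  rw [e2, hn, LinearMap.sub_apply, h₁.transition_dm, LinearMap.id_apply, sub_self]
  rfl

theorem bijective_of_isNilpotent_sub {V : Type*} [AddCommGroup V] [Module 𝕜 V] {g : V →ₗ[𝕜] V}
    (h : IsNilpotent (g - LinearMap.id)) : Function.Bijective g := by
  have : IsUnit g := by
    have := h.isUnit_add_one
    rwa [show g - LinearMap.id + 1 = g from sub_add_cancel _ _] at this
  exact (Module.End.isUnit_iff _).1 this

/-- The transition map as a linear automorphism. -/
def transitionEquiv (h₁ : D.IsPseudoInv D₁) (h₂ : D.IsPseudoInv D₂) : Vp ≃ₗ[𝕜] Vp :=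
  LinearEquiv.ofBijective (transition D D₁ D₂)
    (bijective_of_isNilpotent_sub (h₁.isNilpotent_transition_sub h₂))

@[simp] theorem transitionEquiv_apply (h₁ : D.IsPseudoInv D₁) (h₂ : D.IsPseudoInv D₂) (x : Vp) :
    h₁.transitionEquiv h₂ x = transition D D₁ D₂ x := rfl

theorem transition_swap_dp (h₁ : D.IsPseudoInv D₁) (h₂ : D.IsPseudoInv D₂) (x : Vp) :
    transition D.swap D₁.swap D₂.swap (D.dp x) = D.dp (transition D D₁ D₂ x) := by
  rw [h₂.dp_transition]
  exact h₁.swap.transition_dm x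

theorem transition_swap_dm (h₁ : D.IsPseudoInv D₁) (h₂ : D.IsPseudoInv D₂) (x : Vp) :
    transition D.swap D₁.swap D₂.swap (D₁.dm x) = D₂.dm (transition D D₁ D₂ x) := by
  have e1 : harm D.swap D₁.swap (D₁.dm x) = 0 := h₁.swap.harm_dp x
  rw [transition_apply, transition_apply, e1, map_add, map_add, h₂.dm_harm]
  simp [D₁.dp_dm, D₂.dm_dp]

/-- The transition maps commute with d and carry the first pseudo-inverse to the second, so they
intertwine the two operators σ₊. -/
theorem transition_swap_sigmaPlus (h₁ : D.IsPseudoInv D₁) (h₂ : D.IsPseudoInv D₂) (x : Vp) :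
    transition D.swap D₁.swap D₂.swap (D.sigmaPlus D₁ x) =
      D.sigmaPlus D₂ (transition D D₁ D₂ x) := by
  simp only [sigmaPlus, LinearMap.add_apply, map_add]
  rw [transition_swap_dp h₁ h₂, transition_swap_dm h₁ h₂]

theorem finiteRank_harm (h : D.IsFiniteRankPerturbation E) (h' : D'.IsFiniteRankPerturbation E') :
    FiniteRank (harm D D' - harm E E') :=
  ((FiniteRank.refl _).sub_sub_sub (h.minus.comp_sub_comp h'.minus)).sub_sub_sub
    (h'.plus.comp_sub_comp h.plus)

theorem finiteRank_transition (h : D.IsFiniteRankPerturbation E)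
    (h₁ : D₁.IsFiniteRankPerturbation E₁) (h₂ : D₂.IsFiniteRankPerturbation E₂) :
    FiniteRank (transition D D₁ D₂ - transition E E₁ E₂) :=
  ((h.minus.comp_sub_comp h₁.minus).add_sub_add
    ((finiteRank_harm h h₂).comp_sub_comp (finiteRank_harm h h₁))).add_sub_add
    (h₂.plus.comp_sub_comp h.plus)

/-- Stabilizations are transported by the transition maps, and define the same vector of `|D|`. -/
theorem exists_transport (hD : D.IsFredholm) (h₁ : D.IsPseudoInv D₁) (h₂ : D.IsPseudoInv D₂)
    {S : Vp →ₗ[𝕜] Vm} (hS : IsStabilization (D.sigmaPlus D₁) S) :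
    ∃ S₂, IsStabilization (D.sigmaPlus D₂) S₂ ∧ h₂.stabVec S₂ = h₁.stabVec S ∧
      ∀ x, S₂ (h₁.transitionEquiv h₂ x) = h₁.swap.transitionEquiv h₂.swap (S x) := by
  set g := h₁.transitionEquiv h₂ with hg
  set g' := h₁.swap.transitionEquiv h₂.swap with hg'
  have hσ : ∀ x, g' (D.sigmaPlus D₁ x) = D.sigmaPlus D₂ (g x) := h₁.transition_swap_sigmaPlus h₂
  have hσ' : ∀ x, D.sigmaPlus D₁ (g.symm x) = g'.symm (D.sigmaPlus D₂ x) := fun x => by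
    rw [LinearEquiv.eq_symm_apply, hσ, LinearEquiv.apply_symm_apply]
  let S₂ : Vp →ₗ[𝕜] Vm := g'.toLinearMap ∘ₗ S ∘ₗ g.symm.toLinearMap
  have hS₂ : ∀ x, S₂ (g x) = g' (S x) := fun x => by simp [S₂]
  obtain ⟨P, hP, hSP⟩ := hS.proj
  have hker : ∀ x : (D.sigmaPlus D₁).ker, g x ∈ (D.sigmaPlus D₂).ker := fun x => by
    rw [LinearMap.mem_ker, ← hσ, x.2, map_zero]
  have hker' : ∀ x : (D.sigmaPlus D₂).ker, g.symm x ∈ (D.sigmaPlus D₁).ker := fun x => by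
    rw [LinearMap.mem_ker, hσ', x.2, map_zero]
  obtain ⟨Λ, hΛ, hΛb, hv⟩ := h₁.exists_stabVec_eq_detVec hD hS
  -- S₂ is S conjugated by g and g'. Both act as the identity on homology, so S₂ induces the same Λ
  -- as S.
  have hΛ₂ : h₂.hMinusToCoker ∘ₗ Λ ∘ₗ h₂.kerToHPlus =
      (D.sigmaPlus D₂).range.mkQ ∘ₗ S₂ ∘ₗ (D.sigmaPlus D₂).ker.subtype := by
    refine LinearMap.ext fun x => ?_
    set x₁ : (D.sigmaPlus D₁).ker := ⟨g.symm x, hker' x⟩ with hx₁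
    have hgx : g x₁ = x := g.apply_symm_apply _
    have e1 : h₂.kerToHPlus x = h₁.kerToHPlus x₁ := by
      simp only [kerToHPlus, LinearMap.comp_apply, Submodule.mkQ_apply]
      rw [Submodule.Quotient.eq]
      change (x : Vp) - x₁ ∈ D.dm.range
      rw [← hgx]
      exact h₁.transition_sub_mem_range (h₁.mem_ker_sigmaPlus.1 x₁.2).1
    obtain ⟨y, hy⟩ := Submodule.mkQ_surjective _ (Λ (h₁.kerToHPlus x₁))
    have e2 := LinearMap.congr_fun hΛ x₁
    simp only [LinearMap.comp_apply] at e2 ⊢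
    rw [← hy] at e2
    rw [e1, ← hy]
    change Submodule.Quotient.mk (y : Vm) = Submodule.Quotient.mk (S x₁) at e2
    change Submodule.Quotient.mk (y : Vm) = Submodule.Quotient.mk (S₂ x)
    rw [Submodule.Quotient.eq] at e2 ⊢
    obtain ⟨z, hz⟩ := e2
    have e3 : g' y - y ∈ (D.sigmaPlus D₂).range :=
      h₂.range_dp_le (h₁.swap.transition_sub_mem_range y.2)
    have e4 : g' ((y : Vm) - S x₁) ∈ (D.sigmaPlus D₂).range := ⟨g z, by rw [← hσ, hz]⟩
    have e5 := Submodule.sub_mem _ e4 e3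
    rw [map_sub, ← hS₂, hgx] at e5
    convert e5 using 1
    abel
  have hbij₂ : Function.Bijective
      ((D.sigmaPlus D₂).range.mkQ ∘ₗ S₂ ∘ₗ (D.sigmaPlus D₂).ker.subtype) := by
    rw [← hΛ₂]
    exact h₂.bijective_hMinusToCoker.comp (hΛb.comp h₂.bijective_kerToHPlus)
  have hstab : IsStabilization (D.sigmaPlus D₂) S₂ := by
    let ρ : (D.sigmaPlus D₁).ker →ₗ[𝕜] (D.sigmaPlus D₂).ker :=
      (g.toLinearMap ∘ₗ (D.sigmaPlus D₁).ker.subtype).codRestrict _ hker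
    have hρ : ∀ x, (ρ x : Vp) = g x := fun _ => rfl
    refine ⟨⟨ρ ∘ₗ P ∘ₗ g.symm.toLinearMap, fun x => ?_, fun x => ?_⟩, hbij₂⟩
    · apply Subtype.ext
      have := hP ⟨g.symm x, hker' x⟩
      rw [LinearMap.comp_apply, LinearMap.comp_apply, hρ]
      change g (P (g.symm x)) = x
      rw [this, LinearEquiv.apply_symm_apply]
    · have e1 : S₂ ((ρ ∘ₗ P ∘ₗ g.symm.toLinearMap) x) = g' (S (P (g.symm x))) := hS₂ _
      rw [e1]
      change g' (S (g.symm x)) = _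
      rw [hSP (g.symm x), map_add, hσ', LinearEquiv.apply_symm_apply]
  exact ⟨S₂, hstab, by rw [(h₂.stabVec_eq_detVec hD hstab hΛ₂).2, hv], hS₂⟩

theorem finiteRank_sigmaPlus (h : D.IsFiniteRankPerturbation E)
    (h' : D'.IsFiniteRankPerturbation E') :
    FiniteRank (D.sigmaPlus D' - E.sigmaPlus E') :=
  h.plus.add_sub_add h'.minus

/-- The transition maps of D and E are unipotent and differ by finite rank, so their quotient has
determinant one although neither of them need have a determinant of its own. -/
theorem finiteRankDet_transition (h : D.IsFiniteRankPerturbation E)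
    (h₁ : D₁.IsFiniteRankPerturbation E₁) (h₂ : D₂.IsFiniteRankPerturbation E₂)
    (hD₁ : D.IsPseudoInv D₁) (hD₂ : D.IsPseudoInv D₂) (hE₁ : E.IsPseudoInv E₁)
    (hE₂ : E.IsPseudoInv E₂) :
    FiniteRank (LinearMap.id - (hE₁.transitionEquiv hE₂).symm.toLinearMap ∘ₗ
      (hD₁.transitionEquiv hD₂).toLinearMap) ∧
    finiteRankDet ((hE₁.transitionEquiv hE₂).symm.toLinearMap ∘ₗ
      (hD₁.transitionEquiv hD₂).toLinearMap) = 1 := by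
  have hr := finiteRank_transition h h₁ h₂
  set gE := hE₁.transitionEquiv hE₂
  set gD := hD₁.transitionEquiv hD₂
  constructor
  · have : LinearMap.id - gE.symm.toLinearMap ∘ₗ gD.toLinearMap =
        gE.symm.toLinearMap ∘ₗ (transition E E₁ E₂ - transition D D₁ D₂) := by
      ext x
      change x - gE.symm (gD x) = gE.symm (gE x - gD x)
      rw [map_sub, LinearEquiv.symm_apply_apply]
    rw [this]
    exact hr.symm.comp_left _
  · refine finiteRankDet_eq_one_of_isNilpotent (hD₁.isNilpotent_transition_sub hD₂)
      (hE₁.isNilpotent_transition_sub hE₂) ?_ ?_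
    · rw [sub_sub_sub_cancel_right]
      exact hr
    · rw [add_sub_cancel, add_sub_cancel]
      ext x
      exact gE.apply_symm_apply _

end IsPseudoInv

variable {D E : TwoPeriodicComplex 𝕜 Vp Vm}

theorem IsFiniteRankPerturbation.symm (h : D.IsFiniteRankPerturbation E) :
    E.IsFiniteRankPerturbation D := ⟨h.plus.symm, h.minus.symm⟩

theorem IsFiniteRankPerturbation.swap (h : D.IsFiniteRankPerturbation E) :
    D.swap.IsFiniteRankPerturbation E.swap := ⟨h.minus, h.plus⟩

/-- The perturbation isomorphism in index zero is given by stabilizations. -/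
theorem IsPerturbationIso.exists_stabilization
    (hD0 : Module.finrank 𝕜 D.HPlus = Module.finrank 𝕜 D.HMinus)
    (hE0 : Module.finrank 𝕜 E.HPlus = Module.finrank 𝕜 E.HMinus)
    {P : D.Det →ₗ[𝕜] E.Det} (hP : D.IsPerturbationIso E P) :
    ∃ (D' E' : TwoPeriodicComplex 𝕜 Vm Vp) (hD : D.IsPseudoInv D') (hE : E.IsPseudoInv E')
      (S_D S_E : Vp →ₗ[𝕜] Vm),
      D'.IsFiniteRankPerturbation E' ∧ IsStabilization (D.sigmaPlus D') S_D ∧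
      IsStabilization (E.sigmaPlus E') S_E ∧
      ∀ T, S_E ∘ₗ T = S_D → P (hD.stabVec S_D) = (finiteRankDet T)⁻¹ • hE.stabVec S_E := by
  obtain ⟨-, -, -, D', E', hD, hE, P₀, hr, hP₀, hcomm⟩ := hP
  obtain ⟨S_D, S_E, h1, h2, h3⟩ :=
    hP₀.exists_stabilization (hD.finrank_ker_eq hD0) (hE.finrank_ker_eq hE0)
  refine ⟨D', E', hD, hE, S_D, S_E, hr, h1, h2, fun T hT => ?_⟩
  have := LinearMap.congr_fun hcomm (stabVec (D.sigmaPlus D') S_D)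
  rw [LinearMap.comp_apply, LinearMap.comp_apply, h3 T hT, map_smul] at this
  exact this

/-- The formula for the perturbation isomorphism does not depend on the choice of the
pseudo-inverses and of the stabilizations. -/
theorem stabVec_smul_independent (hDf : D.IsFredholm) (hEf : E.IsFredholm)
    (hDE : D.IsFiniteRankPerturbation E) {D₁ D₂ E₁ E₂ : TwoPeriodicComplex 𝕜 Vm Vp}
    (hD₁ : D.IsPseudoInv D₁) (hD₂ : D.IsPseudoInv D₂) (hE₁ : E.IsPseudoInv E₁)
    (hE₂ : E.IsPseudoInv E₂) (h₁ : D₁.IsFiniteRankPerturbation E₁)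
    (h₂ : D₂.IsFiniteRankPerturbation E₂) {S₁ S₂ R₁ R₂ : Vp →ₗ[𝕜] Vm}
    (hS₁ : IsStabilization (D.sigmaPlus D₁) S₁) (hS₂ : IsStabilization (D.sigmaPlus D₂) S₂)
    (hR₁ : IsStabilization (E.sigmaPlus E₁) R₁) (hR₂ : IsStabilization (E.sigmaPlus E₂) R₂)
    {T₁ T₂ : Vp →ₗ[𝕜] Vp} (hT₁ : R₁ ∘ₗ T₁ = S₁) (hT₂ : R₂ ∘ₗ T₂ = S₂) {P : D.Det →ₗ[𝕜] E.Det}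
    (hP : P (hD₁.stabVec S₁) = (finiteRankDet T₁)⁻¹ • hE₁.stabVec R₁) :
    P (hD₂.stabVec S₂) = (finiteRankDet T₂)⁻¹ • hE₂.stabVec R₂ := by
  obtain ⟨S₁', hS₁', vS, gS⟩ := hD₁.exists_transport hDf hD₂ hS₁
  obtain ⟨R₁', hR₁', vR, gR⟩ := hE₁.exists_transport hEf hE₂ hR₁
  have fD₂ := hD₂.isFredholmMap hDf
  have fE₂ := hE₂.isFredholmMap hEf
  have fσ₂ := IsPseudoInv.finiteRank_sigmaPlus hDE h₂
  obtain ⟨rp, dp⟩ := IsPseudoInv.finiteRankDet_transition hDE.symm h₁.symm ⟨h₂.plus.symm, h₂.minus.symm⟩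
    hE₁ hE₂ hD₁ hD₂
  obtain ⟨rm, dm⟩ := IsPseudoInv.finiteRankDet_transition hDE.swap h₁.swap h₂.swap
    hD₁.swap hD₂.swap hE₁.swap hE₂.swap
  set gpD := hD₁.transitionEquiv hD₂
  set gpE := hE₁.transitionEquiv hE₂
  set gmD := hD₁.swap.transitionEquiv hD₂.swap
  set gmE := hE₁.swap.transitionEquiv hE₂.swap
  let eR := hR₁.equiv
  -- The discrepancy between the odd transition maps of D and E, moved to V₊ by R₁. It has
  -- determinant one.
  let A : Vp →ₗ[𝕜] Vp := eR.symm.toLinearMap ∘ₗ (gmE.symm.toLinearMap ∘ₗ gmD.toLinearMap) ∘ₗ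
    eR.symm.symm.toLinearMap
  have hA : FiniteRank (LinearMap.id - A) := by
    have : LinearMap.id - A = eR.symm.toLinearMap ∘ₗ
        (LinearMap.id - gmE.symm.toLinearMap ∘ₗ gmD.toLinearMap) ∘ₗ eR.toLinearMap := by
      ext x; simp [A]
    rw [this]
    exact (rm.comp_right _).comp_left _
  have dA : finiteRankDet A = 1 := by rw [finiteRankDet_conj _ _ rm, dm]
  have fσ₁ := IsPseudoInv.finiteRank_sigmaPlus hDE h₁
  have rT₁ := hR₁.finiteRank_id_sub (hE₁.isFredholmMap hEf) (hD₁.isFredholmMap hDf) hS₁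
    fσ₁.symm hT₁
  let B : Vp →ₗ[𝕜] Vp := gpD.symm.toLinearMap ∘ₗ gpE.toLinearMap
  have rAT : FiniteRank (LinearMap.id - A ∘ₗ T₁) := by
    have := hA.comp_sub_comp (f := LinearMap.id) (g := LinearMap.id) rT₁
    rwa [LinearMap.id_comp] at this
  have rATB : FiniteRank (LinearMap.id - (A ∘ₗ T₁) ∘ₗ B) := by
    have := rAT.comp_sub_comp (f := LinearMap.id) (g := LinearMap.id) rp
    rwa [LinearMap.id_comp] at this
  have dATB : finiteRankDet ((A ∘ₗ T₁) ∘ₗ B) = finiteRankDet T₁ := by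
    rw [finiteRankDet_comp rAT rp, finiteRankDet_comp hA rT₁, dA, one_mul]
    rw [dp, mul_one]
  -- This is gpE A T₁ gpD⁻¹, with gpE⁻¹ gpE inserted so that it is a conjugate of a product of
  -- operators that have determinants. It is the quotient of the transported stabilizations, and det
  -- T = det T₁.
  let T : Vp →ₗ[𝕜] Vp := gpE.toLinearMap ∘ₗ ((A ∘ₗ T₁) ∘ₗ B) ∘ₗ gpE.symm.toLinearMap
  have dT : finiteRankDet T = finiteRankDet T₁ := by
    rw [finiteRankDet_conj _ _ rATB, dATB]
  have hT : R₁' ∘ₗ T = S₁' := by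
    ext x
    have e1 : ∀ y, R₁ (A y) = gmE.symm (gmD (R₁ y)) := fun y => by
      change eR (eR.symm _) = _
      rw [LinearEquiv.apply_symm_apply]
      rfl
    have e2 : ∀ y, R₁ (T₁ y) = S₁ y := LinearMap.congr_fun hT₁
    have e3 : S₁' x = gmD (S₁ (gpD.symm x)) := by
      rw [← gS, LinearEquiv.apply_symm_apply]
    change R₁' (gpE (A (T₁ (gpD.symm (gpE (gpE.symm x)))))) = S₁' x
    rw [gR, e1, LinearEquiv.apply_symm_apply, LinearEquiv.apply_symm_apply, e2, e3]
  -- The change of stabilizations for fixed pseudo-inverses.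
  have hUS : S₁' ∘ₗ (hS₁'.equiv.symm.toLinearMap ∘ₗ S₂) = S₂ := by ext x; simp
  have hUR : R₂ ∘ₗ (hR₂.equiv.symm.toLinearMap ∘ₗ R₁') = R₁' := by ext x; simp
  set US := hS₁'.equiv.symm.toLinearMap ∘ₗ S₂
  set UR := hR₂.equiv.symm.toLinearMap ∘ₗ R₁'
  have rUS := hS₁'.finiteRank_id_sub fD₂ fD₂ hS₂ (FiniteRank.refl _) hUS
  have rUR := hR₂.finiteRank_id_sub fE₂ fE₂ hR₁' (FiniteRank.refl _) hUR
  have rT := hR₁'.finiteRank_id_sub fE₂ fD₂ hS₁' fσ₂.symm hT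
  have vUS : hD₂.stabVec S₁' = finiteRankDet US • hD₂.stabVec S₂ := by
    unfold IsPseudoInv.stabVec
    rw [hS₁'.stabVec_eq_smul fD₂ hS₂ hUS, map_smul]
  have vUR : hE₂.stabVec R₂ = finiteRankDet UR • hE₂.stabVec R₁' := by
    unfold IsPseudoInv.stabVec
    rw [hR₂.stabVec_eq_smul fE₂ hR₁' hUR, map_smul]
  -- The factors det UR and det US contributed here to det T₂ are exactly those by which the vectors
  -- change, so they cancel.
  have hT₂' : T₂ = (UR ∘ₗ T) ∘ₗ US := by
    ext x
    apply hR₂.bijective_self.1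
    have e1 := LinearMap.congr_fun hT₂ x
    have e2 := LinearMap.congr_fun hUR (T (US x))
    have e3 := LinearMap.congr_fun hT (US x)
    have e4 := LinearMap.congr_fun hUS x
    simp only [LinearMap.comp_apply] at e1 e2 e3 e4 ⊢
    rw [e1, e2, e3, e4]
  have rURT : FiniteRank (LinearMap.id - UR ∘ₗ T) := by
    have := rUR.comp_sub_comp (f := LinearMap.id) (g := LinearMap.id) rT
    rwa [LinearMap.id_comp] at this
  have dT₂ : finiteRankDet T₂ = finiteRankDet UR * finiteRankDet T₁ * finiteRankDet US := by
    rw [hT₂', finiteRankDet_comp rURT rUS, finiteRankDet_comp rUR rT, dT]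
  have hnz : finiteRankDet US ≠ 0 := by
    refine finiteRankDet_ne_zero (T₂ := hS₂.equiv.symm.toLinearMap ∘ₗ S₁') rUS ?_
    ext x
    simp [US]
  have hnz' : finiteRankDet UR ≠ 0 := by
    refine finiteRankDet_ne_zero (T₂ := hR₁'.equiv.symm.toLinearMap ∘ₗ R₂) rUR ?_
    ext x
    simp [UR]
  rw [← vS, ← vR, vUS, map_smul] at hP
  have hP' := congrArg (fun v => (finiteRankDet US)⁻¹ • v) hP
  simp only [smul_smul, inv_mul_cancel₀ hnz, one_smul] at hP'
  rw [hP', vUR, smul_smul, dT₂]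
  congr 1
  field_simp

theorem IsFredholm.finrank_det (hD : D.IsFredholm) : Module.finrank 𝕜 D.Det = 1 :=
  @finrank_detLine_tensor_dual 𝕜 _ D.HPlus _ _ D.HMinus _ _ hD.plus hD.minus

/-- The perturbation isomorphism does not depend on the choices in its definition. -/
theorem IsPerturbationIso.eq (hD0 : Module.finrank 𝕜 D.HPlus = Module.finrank 𝕜 D.HMinus)
    (hE0 : Module.finrank 𝕜 E.HPlus = Module.finrank 𝕜 E.HMinus)
    {P Q : D.Det →ₗ[𝕜] E.Det} (hP : D.IsPerturbationIso E P) (hQ : D.IsPerturbationIso E Q) :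
    P = Q := by
  have hDf := hP.1
  have hEf := hP.2.1
  obtain ⟨D₁, E₁, hD₁, hE₁, S₁, R₁, h₁, hS₁, hR₁, hP₁⟩ := hP.exists_stabilization hD0 hE0
  obtain ⟨D₂, E₂, hD₂, hE₂, S₂, R₂, h₂, hS₂, hR₂, hQ₂⟩ := hQ.exists_stabilization hD0 hE0
  have hT₁ : R₁ ∘ₗ (hR₁.equiv.symm.toLinearMap ∘ₗ S₁) = S₁ := by ext x; simp
  have hT₂ : R₂ ∘ₗ (hR₂.equiv.symm.toLinearMap ∘ₗ S₂) = S₂ := by ext x; simp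
  refine LinearMap.eq_of_finrank_eq_one (V := D.Det) (W := E.Det) hDf.finrank_det
    (hD₂.stabVec_ne_zero hDf hS₂) ?_
  rw [hQ₂ _ hT₂, stabVec_smul_independent hDf hEf hP.2.2.1 hD₁ hD₂ hE₁ hE₂ h₁ h₂ hS₁ hS₂ hR₁ hR₂
    hT₁ hT₂ (hP₁ _ hT₁)]

end

end TwoPeriodicComplex

/-! ### Contractions, and existence of the perturbation isomorphism -/

namespace TwoPeriodicComplex

noncomputable section

variable {𝕜 : Type*} [Field 𝕜] {Vp Vm : Type*}
variable [AddCommGroup Vp] [Module 𝕜 Vp] [AddCommGroup Vm] [Module 𝕜 Vm]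
variable {Cp Cm Gp Gm : Type*} [AddCommGroup Cp] [Module 𝕜 Cp] [AddCommGroup Cm] [Module 𝕜 Cm]
variable [AddCommGroup Gp] [Module 𝕜 Gp] [AddCommGroup Gm] [Module 𝕜 Gm]

/-- `D` is the direct sum of an exact complex and of the trivial complex on `C`, which is embedded
by `ι` with projection `π`. -/
structure IsExactSum (D : TwoPeriodicComplex 𝕜 Vp Vm) (ιp : Cp →ₗ[𝕜] Vp) (πp : Vp →ₗ[𝕜] Cp)
    (ιm : Cm →ₗ[𝕜] Vm) (πm : Vm →ₗ[𝕜] Cm) : Prop where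
  πp_ιp : ∀ c, πp (ιp c) = c
  πm_ιm : ∀ c, πm (ιm c) = c
  dp_ιp : ∀ c, D.dp (ιp c) = 0
  dm_ιm : ∀ c, D.dm (ιm c) = 0
  πm_dp : ∀ x, πm (D.dp x) = 0
  πp_dm : ∀ y, πp (D.dm y) = 0
  exact_plus : ∀ x, D.dp x = 0 → πp x = 0 → ∃ y, D.dm y = x
  exact_minus : ∀ y, D.dm y = 0 → πm y = 0 → ∃ x, D.dp x = y

namespace IsExactSum

variable {D : TwoPeriodicComplex 𝕜 Vp Vm} {ιp : Cp →ₗ[𝕜] Vp} {πp : Vp →ₗ[𝕜] Cp}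
  {ιm : Cm →ₗ[𝕜] Vm} {πm : Vm →ₗ[𝕜] Cm}

theorem swap (h : D.IsExactSum ιp πp ιm πm) : D.swap.IsExactSum ιm πm ιp πp :=
  ⟨h.πm_ιm, h.πp_ιp, h.dm_ιm, h.dp_ιp, h.πp_dm, h.πm_dp, h.exact_minus, h.exact_plus⟩

/-- The isomorphism `C₊ → H₊(D)`. -/
def toHPlus (h : D.IsExactSum ιp πp ιm πm) : Cp →ₗ[𝕜] D.HPlus :=
  Submodule.mkQ _ ∘ₗ ιp.codRestrict D.dp.ker h.dp_ιp

/-- The isomorphism `C₋ → H₋(D)`. -/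
def toHMinus (h : D.IsExactSum ιp πp ιm πm) : Cm →ₗ[𝕜] D.HMinus :=
  Submodule.mkQ _ ∘ₗ ιm.codRestrict D.dm.ker h.dm_ιm

theorem bijective_toHPlus (h : D.IsExactSum ιp πp ιm πm) : Function.Bijective h.toHPlus := by
  constructor
  · rw [injective_iff_map_eq_zero]
    intro c hc
    have hc' : ιp c ∈ D.dm.range := by
      rwa [toHPlus, LinearMap.comp_apply, Submodule.mkQ_apply, Submodule.Quotient.mk_eq_zero] at hc
    obtain ⟨y, hy⟩ := hc'
    rw [← h.πp_ιp c, ← hy, h.πp_dm]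
  · intro q
    obtain ⟨x, rfl⟩ := Submodule.mkQ_surjective _ q
    refine ⟨πp x, ?_⟩
    rw [toHPlus, LinearMap.comp_apply, Submodule.mkQ_apply, Submodule.mkQ_apply,
      Submodule.Quotient.eq]
    refine h.exact_plus _ ?_ ?_
    · change D.dp (ιp (πp x) - x) = 0
      rw [map_sub, h.dp_ιp, x.2, sub_zero]
    · change πp (ιp (πp x) - x) = 0
      rw [map_sub, h.πp_ιp, sub_self]

theorem bijective_toHMinus (h : D.IsExactSum ιp πp ιm πm) : Function.Bijective h.toHMinus :=
  h.swap.bijective_toHPlus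

theorem isFredholm [FiniteDimensional 𝕜 Cp] [FiniteDimensional 𝕜 Cm]
    (h : D.IsExactSum ιp πp ιm πm) : D.IsFredholm :=
  ⟨Module.Finite.of_surjective _ h.bijective_toHPlus.2,
    Module.Finite.of_surjective _ h.bijective_toHMinus.2⟩

theorem finrank_hPlus_eq (h : D.IsExactSum ιp πp ιm πm)
    (hC : Module.finrank 𝕜 Cp = Module.finrank 𝕜 Cm) :
    Module.finrank 𝕜 D.HPlus = Module.finrank 𝕜 D.HMinus := by
  rw [← LinearMap.finrank_eq_of_bijective h.bijective_toHPlus, hC,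
    LinearMap.finrank_eq_of_bijective h.bijective_toHMinus]

end IsExactSum

/-- `D'` is a contraction of the complement of the trivial complex `C` in `D`, of square zero and
extended by zero to `C`. -/
structure IsContraction (D : TwoPeriodicComplex 𝕜 Vp Vm) (D' : TwoPeriodicComplex 𝕜 Vm Vp)
    (ιp : Cp →ₗ[𝕜] Vp) (πp : Vp →ₗ[𝕜] Cp) (ιm : Cm →ₗ[𝕜] Vm) (πm : Vm →ₗ[𝕜] Cm) : Prop where
  dp_ιm : ∀ c, D'.dp (ιm c) = 0
  dm_ιp : ∀ c, D'.dm (ιp c) = 0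
  πp_dp : ∀ y, πp (D'.dp y) = 0
  πm_dm : ∀ x, πm (D'.dm x) = 0
  plus : ∀ x, D.dm (D'.dm x) + D'.dp (D.dp x) = x - ιp (πp x)
  minus : ∀ y, D.dp (D'.dp y) + D'.dm (D.dm y) = y - ιm (πm y)

namespace IsContraction

variable {D E : TwoPeriodicComplex 𝕜 Vp Vm} {D' E' : TwoPeriodicComplex 𝕜 Vm Vp}
  {ιp : Cp →ₗ[𝕜] Vp} {πp : Vp →ₗ[𝕜] Cp} {ιm : Cm →ₗ[𝕜] Vm} {πm : Vm →ₗ[𝕜] Cm}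
  {jp : Gp →ₗ[𝕜] Vp} {qp : Vp →ₗ[𝕜] Gp} {jm : Gm →ₗ[𝕜] Vm} {qm : Vm →ₗ[𝕜] Gm}

theorem isExactSum (h : D.IsExactSum ιp πp ιm πm) (h' : D.IsContraction D' ιp πp ιm πm) :
    D'.IsExactSum ιm πm ιp πp := by
  refine ⟨h.πm_ιm, h.πp_ιp, h'.dp_ιm, h'.dm_ιp, h'.πp_dp, h'.πm_dm, fun y h1 h2 => ?_,
    fun x h1 h2 => ?_⟩
  · refine ⟨D.dm y, ?_⟩
    have := h'.minus y
    rw [h1, h2, map_zero, map_zero, zero_add, sub_zero] at this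
    exact this
  · refine ⟨D.dp x, ?_⟩
    have := h'.plus x
    rw [h1, h2, map_zero, map_zero, zero_add, sub_zero] at this
    exact this

theorem symm (h' : D.IsContraction D' ιp πp ιm πm) (h : D.IsExactSum ιp πp ιm πm) :
    D'.IsContraction D ιm πm ιp πp :=
  ⟨h.dp_ιp, h.dm_ιm, h.πm_dp, h.πp_dm, fun y => by rw [add_comm]; exact h'.minus y,
    fun x => by rw [add_comm]; exact h'.plus x⟩

section

variable [FiniteDimensional 𝕜 Cp] [FiniteDimensional 𝕜 Cm]

theorem isPseudoInv (h' : D.IsContraction D' ιp πp ιm πm) (h : D.IsExactSum ιp πp ιm πm) :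
    D.IsPseudoInv D' := by
  refine ⟨(isExactSum h h').isFredholm, ⟨fun x => ?_, fun y => ?_⟩, ⟨fun y => ?_, fun x => ?_⟩⟩
  · have := h'.minus (D.dp x)
    rwa [D.dm_dp, map_zero, add_zero, h.πm_dp, map_zero, sub_zero] at this
  · have := h'.plus (D'.dp y)
    rwa [D'.dm_dp, map_zero, zero_add, h'.πp_dp, map_zero, sub_zero] at this
  · have := h'.plus (D.dm y)
    rwa [D.dp_dm, map_zero, add_zero, h.πp_dm, map_zero, sub_zero] at this
  · have := h'.minus (D'.dm x)
    rwa [D'.dp_dm, map_zero, zero_add, h'.πm_dm, map_zero, sub_zero] at this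

end

/-- The cross terms are squares of the differentials of D or of D' and vanish. What remains is the
contraction identity, so the operators σ₊ of (D, D') and (D', D) are mutually pseudo-inverse. -/
theorem sigmaPlus_sigmaPlus (h' : D.IsContraction D' ιp πp ιm πm) (x : Vp) :
    D'.sigmaPlus D (D.sigmaPlus D' x) = x - ιp (πp x) := by
  simp only [sigmaPlus, LinearMap.add_apply, map_add]
  rw [D.dm_dp, D'.dp_dm, ← h'.plus x]
  abel

theorem sigmaPlus_ιp (h' : D.IsContraction D' ιp πp ιm πm) (h : D.IsExactSum ιp πp ιm πm) (c : Cp) :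
    D.sigmaPlus D' (ιp c) = 0 := by
  simp [sigmaPlus, h.dp_ιp, h'.dm_ιp]

theorem isPseudoInverse (h' : D.IsContraction D' ιp πp ιm πm) (h : D.IsExactSum ιp πp ιm πm) :
    IsPseudoInverse (D.sigmaPlus D') (D'.sigmaPlus D) := by
  refine ⟨fun x => ?_, fun y => ?_⟩
  · rw [h'.sigmaPlus_sigmaPlus, map_sub, h'.sigmaPlus_ιp h, sub_zero]
  · rw [(h'.symm h).sigmaPlus_sigmaPlus, map_sub, (h'.symm h).sigmaPlus_ιp (isExactSum h h'), sub_zero]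

/-- The kernel of `σ₊` is `C₊`. -/
def kerEquiv (h' : D.IsContraction D' ιp πp ιm πm) (h : D.IsExactSum ιp πp ιm πm) :
    Cp ≃ₗ[𝕜] (D.sigmaPlus D').ker :=
  { ιp.codRestrict _ (h'.sigmaPlus_ιp h) with
    invFun := fun x => πp x
    left_inv := fun c => h.πp_ιp c
    right_inv := fun x => by
      apply Subtype.ext
      have := h'.sigmaPlus_sigmaPlus x
      rw [x.2, map_zero] at this
      exact (sub_eq_zero.1 this.symm).symm }

theorem coe_kerEquiv (h' : D.IsContraction D' ιp πp ιm πm) (h : D.IsExactSum ιp πp ιm πm) (c : Cp) :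
    (h'.kerEquiv h c : Vp) = ιp c := rfl

/-- The stabilization of `σ₊` by an isomorphism `C₊ → C₋`. -/
def _root_.TwoPeriodicComplex.stab (D : TwoPeriodicComplex 𝕜 Vp Vm)
    (D' : TwoPeriodicComplex 𝕜 Vm Vp) (πp : Vp →ₗ[𝕜] Cp) (ιm : Cm →ₗ[𝕜] Vm) (l : Cp →ₗ[𝕜] Cm) :
    Vp →ₗ[𝕜] Vm :=
  D.sigmaPlus D' + ιm ∘ₗ l ∘ₗ πp

theorem stab_eq (h' : D.IsContraction D' ιp πp ιm πm) (h : D.IsExactSum ιp πp ιm πm)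
    (l : Cp ≃ₗ[𝕜] Cm) :
    D.stab D' πp ιm l.toLinearMap = D.sigmaPlus D' + ((D'.sigmaPlus D).ker.subtype ∘ₗ
      (((h'.symm h).kerEquiv (isExactSum h h')).symm ≪≫ₗ l.symm ≪≫ₗ
        h'.kerEquiv h).symm.toLinearMap) ∘ₗ (h'.isPseudoInverse h).kerProj := by
  refine LinearMap.ext fun x => congrArg (D.sigmaPlus D' x + ·) ?_
  have e : πp ((h'.isPseudoInverse h).kerProj x) = πp x := by
    rw [IsPseudoInverse.coe_kerProj, h'.sigmaPlus_sigmaPlus, sub_sub_cancel, h.πp_ιp]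
  change ιm (l (πp x)) = ιm (l (πp ((h'.isPseudoInverse h).kerProj x)))
  rw [e]

theorem bijective_mkQ_comp (h' : D.IsContraction D' ιp πp ιm πm) (h : D.IsExactSum ιp πp ιm πm)
    (l : Cp ≃ₗ[𝕜] Cm) :
    Function.Bijective ((D.sigmaPlus D').range.mkQ ∘ₗ (D'.sigmaPlus D).ker.subtype ∘ₗ
      (((h'.symm h).kerEquiv (isExactSum h h')).symm ≪≫ₗ l.symm ≪≫ₗ
        h'.kerEquiv h).symm.toLinearMap) :=
  (h'.isPseudoInverse h).bijective_ker_coker.comp (LinearEquiv.bijective _)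

theorem isStabilization (h' : D.IsContraction D' ιp πp ιm πm) (h : D.IsExactSum ιp πp ιm πm)
    (l : Cp ≃ₗ[𝕜] Cm) :
    IsStabilization (D.sigmaPlus D') (D.stab D' πp ιm l.toLinearMap) := by
  rw [h'.stab_eq h l]
  exact (h'.isPseudoInverse h).isStabilization (h'.bijective_mkQ_comp h l)

section

variable [FiniteDimensional 𝕜 Cp] [FiniteDimensional 𝕜 Cm]

/-- This links stabilizations to the trivialization i_C: the vector of the stabilization by l is
i_C(1) with ω₋ replaced by the image of ω₊ under l. -/
theorem stabVec_stab (h' : D.IsContraction D' ιp πp ιm πm) (h : D.IsExactSum ιp πp ιm πm)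
    (l : Cp ≃ₗ[𝕜] Cm) {ω : DetLine 𝕜 Cp} (hω : ω ≠ 0) :
    (h'.isPseudoInv h).stabVec (D.stab D' πp ιm l.toLinearMap) =
      detMap h.toHPlus ω ⊗ₜ[𝕜] dualVector (detMap h.toHMinus (detMap l.toLinearMap ω)) := by
  have hD := h.isFredholm
  have hpD := hD.plus
  have hmD := hD.minus
  let e := LinearEquiv.ofBijective _ h.bijective_toHPlus
  let Λ : D.HPlus →ₗ[𝕜] D.HMinus := h.toHMinus ∘ₗ l.toLinearMap ∘ₗ e.symm.toLinearMap
  have hΛ : (h'.isPseudoInv h).hMinusToCoker ∘ₗ Λ ∘ₗ (h'.isPseudoInv h).kerToHPlus =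
      (D.sigmaPlus D').range.mkQ ∘ₗ D.stab D' πp ιm l.toLinearMap ∘ₗ
        (D.sigmaPlus D').ker.subtype := by
    refine LinearMap.ext fun x => ?_
    obtain ⟨c, rfl⟩ := (h'.kerEquiv h).surjective x
    have e1 : (h'.isPseudoInv h).kerToHPlus (h'.kerEquiv h c) = e c := rfl
    have e2 : D.stab D' πp ιm l.toLinearMap (h'.kerEquiv h c) = ιm (l c) := by
      rw [coe_kerEquiv]
      change D.sigmaPlus D' (ιp c) + ιm (l (πp (ιp c))) = _
      rw [h'.sigmaPlus_ιp h, zero_add, h.πp_ιp]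
    change (h'.isPseudoInv h).hMinusToCoker (Λ ((h'.isPseudoInv h).kerToHPlus (h'.kerEquiv h c))) =
      (D.sigmaPlus D').range.mkQ (D.stab D' πp ιm l.toLinearMap (h'.kerEquiv h c))
    rw [e1, e2]
    change (h'.isPseudoInv h).hMinusToCoker (h.toHMinus (l (e.symm (e c)))) = _
    rw [LinearEquiv.symm_apply_apply]
    rfl
  obtain ⟨hb, hv⟩ := (h'.isPseudoInv h).stabVec_eq_detVec hD (h'.isStabilization h l) hΛ
  have hf1 := LinearMap.finrank_eq_of_bijective h.bijective_toHPlus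
  have hf2 := LinearMap.finrank_eq_of_bijective h.bijective_toHMinus
  have hΛe : Λ ∘ₗ h.toHPlus = h.toHMinus ∘ₗ l.toLinearMap := by
    refine LinearMap.ext fun c => ?_
    change h.toHMinus (l (e.symm (e c))) = _
    rw [LinearEquiv.symm_apply_apply]
    rfl
  rw [hv, detVec_eq hb (detMap_ne_zero h.bijective_toHPlus hω),
    detMap_comp_apply hf1 (LinearMap.finrank_eq_of_bijective hb), hΛe,
    detMap_comp_apply l.finrank_eq hf2]

end

variable [FiniteDimensional 𝕜 Cp] [FiniteDimensional 𝕜 Cm] [FiniteDimensional 𝕜 Gp]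
  [FiniteDimensional 𝕜 Gm]

/-- Existence of the perturbation isomorphism, for direct sums of exact complexes and trivial
complexes of index zero with contractions that differ by finite rank operators. -/
theorem exists_isPerturbationIso (hD' : D.IsContraction D' ιp πp ιm πm)
    (hD : D.IsExactSum ιp πp ιm πm) (hE' : E.IsContraction E' jp qp jm qm)
    (hE : E.IsExactSum jp qp jm qm) (hDE : D.IsFiniteRankPerturbation E)
    (hDE' : D'.IsFiniteRankPerturbation E') (l : Cp ≃ₗ[𝕜] Cm) (r : Gp ≃ₗ[𝕜] Gm) {T : Vp →ₗ[𝕜] Vp}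
    (hT : E.stab E' qp jm r.toLinearMap ∘ₗ T = D.stab D' πp ιm l.toLinearMap) :
    ∃ P : D.Det →ₗ[𝕜] E.Det, D.IsPerturbationIso E P ∧
      P ((hD'.isPseudoInv hD).stabVec (D.stab D' πp ιm l.toLinearMap)) =
        (finiteRankDet T)⁻¹ • (hE'.isPseudoInv hE).stabVec (E.stab E' qp jm r.toLinearMap) := by
  have hDf := hD.isFredholm
  have hEf := hE.isFredholm
  have hDi := hD'.isPseudoInv hD
  have hEi := hE'.isPseudoInv hE
  have fD := hDi.isFredholmMap hDf
  have fE := hEi.isFredholmMap hEf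
  have sD := hD'.isStabilization hD l
  have sE := hE'.isStabilization hE r
  -- All spaces involved are lines, so prescribing P and P₀ on one nonzero vector each determines
  -- them; compatibility is then checked on that vector.
  obtain ⟨P, hP⟩ := LinearMap.exists_apply_eq (𝕜 := 𝕜) (V := D.Det) (W := E.Det) (hDi.stabVec_ne_zero hDf sD)
    ((finiteRankDet T)⁻¹ • hEi.stabVec (E.stab E' qp jm r.toLinearMap))
  obtain ⟨P₀, hP₀⟩ := LinearMap.exists_apply_eq (𝕜 := 𝕜) (V := FredholmDet (D.sigmaPlus D'))
    (W := FredholmDet (E.sigmaPlus E')) (sD.stabVec_ne_zero fD)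
    ((finiteRankDet T)⁻¹ • _root_.stabVec (E.sigmaPlus E') (E.stab E' qp jm r.toLinearMap))
  refine ⟨P, ⟨hDf, hEf, hDE, D', E', hDi, hEi, P₀, hDE', ?_, ?_⟩, hP⟩
  · have hst : IsStabilizedIso (D.sigmaPlus D') (E.sigmaPlus E') (D.stab D' πp ιm l.toLinearMap)
        (E.stab E' qp jm r.toLinearMap) P₀ := by
      intro T' hT'
      have : T' = T := by
        ext x
        apply sE.bijective_self.1
        exact (LinearMap.congr_fun hT' x).trans (LinearMap.congr_fun hT x).symm
      rw [this]
      exact hP₀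
    rw [hD'.stab_eq hD l, hE'.stab_eq hE r] at hst
    exact isFredholmPerturbationIso_of_stabilization fD fE
      (IsPseudoInv.finiteRank_sigmaPlus hDE hDE')
      (hDi.finrank_ker_eq (hD.finrank_hPlus_eq l.finrank_eq))
      (hEi.finrank_ker_eq (hE.finrank_hPlus_eq r.finrank_eq))
      (hD'.isPseudoInverse hD) (hE'.isPseudoInverse hE) (hD'.bijective_mkQ_comp hD l) _ hst
  · have := fD.ker
    have := fD.coker
    refine LinearMap.eq_of_finrank_eq_one (V := FredholmDet (D.sigmaPlus D')) (W := E.Det)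
      finrank_detLine_tensor_dual (sD.stabVec_ne_zero fD) ?_
    rw [LinearMap.comp_apply, LinearMap.comp_apply, hP₀, map_smul]
    exact hP

end IsContraction

end

end TwoPeriodicComplex

/-! ### Bounded rank, and the trace of a finite rank operator -/

noncomputable section FiniteRankTrace

variable {𝕜 : Type*} [Field 𝕜]
variable {V : Type*} [AddCommGroup V] [Module 𝕜 V]
variable {W : Type*} [AddCommGroup W] [Module 𝕜 W]
variable {K : Type*} [AddCommGroup K] [Module 𝕜 K]

/-- The rank of `F` is at most `n`. -/
def HasRankLE (n : ℕ) (F : V →ₗ[𝕜] W) : Prop :=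
  ∃ S : Submodule 𝕜 W, FiniteDimensional 𝕜 S ∧ Module.finrank 𝕜 S ≤ n ∧ F.range ≤ S

namespace HasRankLE

theorem finiteRank {n : ℕ} {F : V →ₗ[𝕜] W} (h : HasRankLE n F) : FiniteRank F := by
  obtain ⟨S, hS, -, h⟩ := h
  exact FiniteRank.of_range_le S h

theorem of_finiteRank {F : V →ₗ[𝕜] W} (h : FiniteRank F) :
    HasRankLE (Module.finrank 𝕜 F.range) F :=
  ⟨F.range, h, le_rfl, le_rfl⟩

theorem sub {n m : ℕ} {F G : V →ₗ[𝕜] W} (hF : HasRankLE n F) (hG : HasRankLE m G) :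
    HasRankLE (n + m) (F - G) := by
  obtain ⟨S, hS, hn, hF⟩ := hF
  obtain ⟨R, hR, hm, hG⟩ := hG
  refine ⟨S ⊔ R, inferInstance,
    (Submodule.finrank_add_le_finrank_add_finrank S R).trans (add_le_add hn hm), ?_⟩
  rintro _ ⟨x, rfl⟩
  exact Submodule.sub_mem _ (Submodule.mem_sup_left (hF ⟨x, rfl⟩))
    (Submodule.mem_sup_right (hG ⟨x, rfl⟩))

theorem comp_left {n : ℕ} {F : V →ₗ[𝕜] W} (h : HasRankLE n F) (g : W →ₗ[𝕜] K) :
    HasRankLE n (g ∘ₗ F) := by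
  obtain ⟨S, hS, hn, h⟩ := h
  refine ⟨S.map g, inferInstance, (Submodule.finrank_map_le g S).trans hn, ?_⟩
  rintro _ ⟨x, rfl⟩
  exact ⟨F x, h ⟨x, rfl⟩, rfl⟩

theorem smul {n : ℕ} {F : V →ₗ[𝕜] W} (h : HasRankLE n F) (c : 𝕜) : HasRankLE n (c • F) := by
  obtain ⟨S, hS, hn, h⟩ := h
  refine ⟨S, hS, hn, ?_⟩
  rintro _ ⟨x, rfl⟩
  exact S.smul_mem c (h ⟨x, rfl⟩)

end HasRankLE

theorem range_invariant (F : V →ₗ[𝕜] V) : ∀ x ∈ F.range, F x ∈ F.range := fun x _ => ⟨x, rfl⟩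

/-- The trace of an operator of finite rank: the trace of its restriction to its image. -/
def finiteRankTrace (F : V →ₗ[𝕜] V) : 𝕜 :=
  LinearMap.trace 𝕜 F.range (F.restrict (range_invariant F))

/-- As for the determinant, both sides are moved to the image of G by cyclicity of the ordinary
trace. -/
theorem finiteRankTrace_comp [FiniteDimensional 𝕜 K] (U : K →ₗ[𝕜] V) (G : V →ₗ[𝕜] K) :
    finiteRankTrace (U ∘ₗ G) = LinearMap.trace 𝕜 K (G ∘ₗ U) := by
  set F : V →ₗ[𝕜] V := U ∘ₗ G with hF
  set R := F.range with hR
  have hfin : FiniteDimensional 𝕜 R :=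
    FiniteRank.of_range_le U.range (LinearMap.range_comp_le_range G U)
  have hUR : ∀ k : G.range, U k ∈ R := by
    rintro ⟨_, x, rfl⟩
    exact ⟨x, rfl⟩
  let U' : G.range →ₗ[𝕜] R := (U ∘ₗ G.range.subtype).codRestrict R hUR
  let G' : V →ₗ[𝕜] G.range := G.rangeRestrict
  have h1 : F.restrict (range_invariant F) = U' ∘ₗ (G' ∘ₗ R.subtype) := rfl
  have h2 : G ∘ₗ U = G.range.subtype ∘ₗ (G' ∘ₗ U) := rfl
  have h3 : (G' ∘ₗ R.subtype) ∘ₗ U' = (G' ∘ₗ U) ∘ₗ G.range.subtype := rfl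
  unfold finiteRankTrace
  rw [h1, LinearMap.trace_comp_comm', h3, h2, LinearMap.trace_comp_comm']

/-- A finite rank operator factors through any finite dimensional space that contains its image. -/
theorem finiteRankTrace_eq_trace_codRestrict (F : V →ₗ[𝕜] V) (S : Submodule 𝕜 V)
    [FiniteDimensional 𝕜 S] (hS : ∀ x, F x ∈ S) :
    finiteRankTrace F = LinearMap.trace 𝕜 S (F.codRestrict S hS ∘ₗ S.subtype) :=
  finiteRankTrace_comp S.subtype (F.codRestrict S hS)

theorem finiteRankDet_id_add_eq_det_codRestrict (F : V →ₗ[𝕜] V) (S : Submodule 𝕜 V)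
    [FiniteDimensional 𝕜 S] (hS : ∀ x, F x ∈ S) :
    finiteRankDet (LinearMap.id + F) =
      LinearMap.det (LinearMap.id + F.codRestrict S hS ∘ₗ S.subtype) :=
  finiteRankDet_id_add_comp S.subtype (F.codRestrict S hS)

theorem finiteRankTrace_sub {F G : V →ₗ[𝕜] V} (hF : FiniteRank F) (hG : FiniteRank G) :
    finiteRankTrace (F - G) = finiteRankTrace F - finiteRankTrace G := by
  have : FiniteDimensional 𝕜 F.range := hF
  have : FiniteDimensional 𝕜 G.range := hG
  have h1 : ∀ x, F x ∈ F.range ⊔ G.range := fun x => Submodule.mem_sup_left ⟨x, rfl⟩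
  have h2 : ∀ x, G x ∈ F.range ⊔ G.range := fun x => Submodule.mem_sup_right ⟨x, rfl⟩
  rw [finiteRankTrace_eq_trace_codRestrict F _ h1, finiteRankTrace_eq_trace_codRestrict G _ h2,
    finiteRankTrace_eq_trace_codRestrict (F - G) _ fun x => Submodule.sub_mem _ (h1 x) (h2 x),
    ← map_sub]
  rfl

theorem finiteRankTrace_smul {F : V →ₗ[𝕜] V} (hF : FiniteRank F) (c : 𝕜) :
    finiteRankTrace (c • F) = c * finiteRankTrace F := by
  have : FiniteDimensional 𝕜 F.range := hF
  have h1 : ∀ x, F x ∈ F.range := fun x => ⟨x, rfl⟩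
  rw [finiteRankTrace_eq_trace_codRestrict F _ h1,
    finiteRankTrace_eq_trace_codRestrict (c • F) _ fun x => Submodule.smul_mem _ c (h1 x),
    ← smul_eq_mul, ← map_smul]
  rfl

end FiniteRankTrace

/-! ### First order expansion of the determinant in bounded rank -/

noncomputable section DeterminantEstimate

variable {H : Type*} [NormedAddCommGroup H] [InnerProductSpace ℂ H]
variable {G : Type*} [NormedAddCommGroup G] [InnerProductSpace ℂ G]

/-- In an orthonormal basis of a subspace of dimension at most n containing the image, the trace is
a sum of at most n diagonal entries, each bounded by ‖F‖. -/
theorem norm_finiteRankTrace_le {n : ℕ} (F : H →L[ℂ] H) (h : HasRankLE n F.toLinearMap) :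
    ‖finiteRankTrace F.toLinearMap‖ ≤ n * ‖F‖ := by
  obtain ⟨S, hS, hn, h⟩ := h
  have hS' : ∀ x, F.toLinearMap x ∈ S := fun x => h ⟨x, rfl⟩
  let b := stdOrthonormalBasis ℂ S
  rw [finiteRankTrace_eq_trace_codRestrict _ S hS', LinearMap.trace_eq_sum_inner _ b]
  refine (norm_sum_le _ _).trans ?_
  have hi : ∀ i, ‖⟪b i, ((F.toLinearMap).codRestrict S hS' ∘ₗ S.subtype) (b i)⟫_ℂ‖ ≤ ‖F‖ := by
    intro i
    refine (norm_inner_le_norm _ _).trans ?_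
    rw [b.norm_eq_one, one_mul]
    change ‖F (b i)‖ ≤ _
    have hb : ‖(b i : H)‖ = 1 := b.norm_eq_one i
    refine (F.le_opNorm _).trans ?_
    rw [hb, mul_one]
  refine (Finset.sum_le_sum fun i _ => hi i).trans ?_
  rw [Finset.sum_const, Finset.card_univ, Fintype.card_fin, nsmul_eq_mul]
  gcongr

/-- The derivative of the determinant at the identity matrix is the trace. -/
theorem hasFDerivAt_det_one_add (m : ℕ) :
    HasFDerivAt (fun g : Fin m → Fin m → ℂ => (1 + Matrix.of g).det)
      (LinearMap.toContinuousLinearMap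
        ((Matrix.traceLinearMap (Fin m) ℂ ℂ) ∘ₗ (Matrix.ofLinearEquiv ℂ).toLinearMap))
      (0 : Fin m → Fin m → ℂ) := by
  have hd : DifferentiableAt ℂ (fun g : Fin m → Fin m → ℂ => (1 + Matrix.of g).det) 0 := by
    simp only [Matrix.det_apply, Matrix.add_apply, Matrix.of_apply]
    fun_prop
  convert hd.hasFDerivAt using 1
  ext1 g
  -- The determinant is polynomial in the entries, hence differentiable. Its derivative is read off
  -- on each line t ↦ t g from det(1 + t g) = 1 + t tr g + O(t²).
  have h1 : HasDerivAt (fun t : ℂ => t • g) g 0 := by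
    simpa using (hasDerivAt_id (0 : ℂ)).smul_const g
  have h2 : HasDerivAt (fun t : ℂ => (1 + Matrix.of (t • g)).det)
      (fderiv ℂ (fun g : Fin m → Fin m → ℂ => (1 + Matrix.of g).det) 0 g) 0 := by
    have h0 : HasFDerivAt (fun g : Fin m → Fin m → ℂ => (1 + Matrix.of g).det)
      (fderiv ℂ (fun g : Fin m → Fin m → ℂ => (1 + Matrix.of g).det) 0) ((0 : ℂ) • g) := by
      rw [zero_smul]; exact hd.hasFDerivAt
    exact h0.comp_hasDerivAt (0 : ℂ) h1
  have h3 : HasDerivAt (fun t : ℂ => (1 + Matrix.of (t • g)).det) (Matrix.trace (Matrix.of g)) 0 := by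
    have e : (fun t : ℂ => (1 + Matrix.of (t • g)).det) = fun t =>
        1 + Matrix.trace (Matrix.of g) * t + (Matrix.det (1 + (Polynomial.X : Polynomial ℂ) •
          (Matrix.of g).map Polynomial.C)).divX.divX.eval t * t ^ 2 := by
      funext t
      rw [← Matrix.det_one_add_smul]
      rfl
    rw [e]
    have h4 := (((hasDerivAt_id (0 : ℂ)).const_mul (Matrix.trace (Matrix.of g))).const_add 1).add
      ((Polynomial.hasDerivAt (Matrix.det (1 + (Polynomial.X : Polynomial ℂ) •
          (Matrix.of g).map Polynomial.C)).divX.divX 0).mul (hasDerivAt_pow 2 (0 : ℂ)))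
    exact h4.congr_deriv (by simp)
  exact h3.unique h2

/-- First order expansion of the determinant, uniformly for operators of bounded rank. -/
theorem exists_norm_finiteRankDet_sub_le (n : ℕ) {ε : ℝ} (hε : 0 < ε) :
    ∃ δ > 0, ∀ F : H →L[ℂ] H, HasRankLE n F.toLinearMap → ‖F‖ ≤ δ →
      ‖finiteRankDet (LinearMap.id + F.toLinearMap) - 1 - finiteRankTrace F.toLinearMap‖ ≤
        ε * ‖F‖ := by
  have key : ∀ m : ℕ, ∃ δ > 0, ∀ g : Fin m → Fin m → ℂ, ‖g‖ ≤ δ →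
      ‖(1 + Matrix.of g).det - 1 - Matrix.trace (Matrix.of g)‖ ≤ ε * ‖g‖ := by
    intro m
    have h := (hasFDerivAt_det_one_add m).isLittleO.def hε
    obtain ⟨δ, hδ, h⟩ := Metric.eventually_nhds_iff.1 h
    refine ⟨δ / 2, half_pos hδ, fun g hg => ?_⟩
    have := @h g (by rw [dist_zero_right]; linarith)
    simpa using this
  choose δ hδ hkey using key
  -- Only the matrix sizes m ≤ n occur, so the smallest of finitely many radii serves for all of
  -- them.
  obtain ⟨δ₀, hδ₀, hle⟩ : ∃ δ₀ > 0, ∀ m ≤ n, δ₀ ≤ δ m := by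
    have hne : (Finset.range (n + 1)).Nonempty := ⟨0, by simp⟩
    refine ⟨(Finset.range (n + 1)).inf' hne δ, ?_, fun m hm => ?_⟩
    · rw [gt_iff_lt, Finset.lt_inf'_iff]
      exact fun m _ => hδ m
    · exact Finset.inf'_le _ (by simp; omega)
  refine ⟨δ₀, hδ₀, fun F hF hFδ => ?_⟩
  obtain ⟨S, hS, hn, h⟩ := hF
  have hS' : ∀ x, F.toLinearMap x ∈ S := fun x => h ⟨x, rfl⟩
  let b := stdOrthonormalBasis ℂ S
  set A := (F.toLinearMap).codRestrict S hS' ∘ₗ S.subtype with hA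
  let g : Fin (Module.finrank ℂ S) → Fin (Module.finrank ℂ S) → ℂ :=
    LinearMap.toMatrix b.toBasis b.toBasis A
  -- In an orthonormal basis every matrix entry is at most the operator norm, hence so is the sup
  -- norm of the matrix.
  have hg : ‖g‖ ≤ ‖F‖ := by
    refine (pi_norm_le_iff_of_nonneg (norm_nonneg _)).2 fun i =>
      (pi_norm_le_iff_of_nonneg (norm_nonneg _)).2 fun j => ?_
    have e : g i j = ⟪b i, A (b j)⟫_ℂ := by
      change LinearMap.toMatrix b.toBasis b.toBasis A i j = _
      rw [LinearMap.toMatrix_apply, OrthonormalBasis.coe_toBasis,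
        OrthonormalBasis.coe_toBasis_repr_apply, OrthonormalBasis.repr_apply_apply]
    rw [e]
    refine (norm_inner_le_norm _ _).trans ?_
    rw [b.norm_eq_one, one_mul]
    change ‖F (b j)‖ ≤ _
    have hb : ‖(b j : H)‖ = 1 := b.norm_eq_one j
    refine (F.le_opNorm _).trans ?_
    rw [hb, mul_one]
  have h1 := hkey _ g (hg.trans (hFδ.trans (hle _ hn)))
  have hof : Matrix.of g = LinearMap.toMatrix b.toBasis b.toBasis A := rfl
  have h2 : (1 + Matrix.of g).det = LinearMap.det (LinearMap.id + A) := by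
    rw [hof, ← LinearMap.toMatrix_id b.toBasis, ← map_add, LinearMap.det_toMatrix]
  rw [finiteRankDet_id_add_eq_det_codRestrict _ S hS', finiteRankTrace_eq_trace_codRestrict _ S hS',
    ← hA, ← h2, LinearMap.trace_eq_matrix_trace ℂ b.toBasis, ← hof]
  exact h1.trans (by gcongr)

end DeterminantEstimate

/-! ### Holomorphic families of finite rank operators have locally bounded rank -/

noncomputable section BoundedRank

variable {H : Type*} [NormedAddCommGroup H] [InnerProductSpace ℂ H]
variable {G : Type*} [NormedAddCommGroup G] [InnerProductSpace ℂ G]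

/-- The minors of an operator between inner product spaces. -/
def minor {n : ℕ} (x : Fin n → H) (y : Fin n → G) (F : H →L[ℂ] G) : ℂ :=
  (Matrix.of fun i j => ⟪y i, F (x j)⟫_ℂ).det

theorem differentiable_minor {n : ℕ} (x : Fin n → H) (y : Fin n → G) :
    Differentiable ℂ (minor x y) := by
  unfold minor
  simp only [Matrix.det_apply, Matrix.of_apply]
  have : ∀ i j, Differentiable ℂ fun F : H →L[ℂ] G => ⟪y i, F (x j)⟫_ℂ := fun i j =>
    ((innerSL ℂ (y i)).differentiable).comp (ContinuousLinearMap.apply ℂ G (x j)).differentiable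
  fun_prop

/-- Minors turn a rank bound into equations that are holomorphic in F, in any dimension. If the rank
exceeds n, an orthonormal basis of an (n+1)-dimensional subspace of the image, together with
preimages under F, gives a minor equal to 1. -/
theorem hasRankLE_iff_minor_eq_zero {n : ℕ} (F : H →L[ℂ] G) :
    HasRankLE n F.toLinearMap ↔ ∀ (x : Fin (n + 1) → H) (y : Fin (n + 1) → G), minor x y F = 0 := by
  constructor
  · rintro ⟨S, hS, hn, h⟩ x y
    have hnl : ¬ LinearIndependent ℂ (fun j => (⟨F (x j), h ⟨x j, rfl⟩⟩ : S)) := by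
      intro hl
      have := hl.fintype_card_le_finrank
      rw [Fintype.card_fin] at this
      omega
    obtain ⟨c, hc, i, hi⟩ := Fintype.not_linearIndependent_iff.1 hnl
    refine Matrix.exists_mulVec_eq_zero_iff.1 ⟨c, fun h0 => hi (congrFun h0 i), ?_⟩
    funext k
    have hc' := congrArg Subtype.val hc
    simp only [AddSubmonoidClass.coe_finsetSum, Submodule.coe_smul, ZeroMemClass.coe_zero] at hc'
    have := congrArg (fun w => ⟪y k, w⟫_ℂ) hc'
    simp only [inner_sum, inner_smul_right, inner_zero_right] at this
    rw [Pi.zero_apply, ← this]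
    simp [Matrix.mulVec, dotProduct, mul_comm]
  · intro h
    by_contra hF
    have hr : ((n + 1 : ℕ) : Cardinal) ≤ F.toLinearMap.rank := by
      by_contra hlt
      rw [not_le] at hlt
      have hfin : FiniteDimensional ℂ F.toLinearMap.range :=
        Module.rank_lt_aleph0_iff.1 (hlt.trans (Cardinal.natCast_lt_aleph0))
      refine hF ⟨_, hfin, ?_, le_rfl⟩
      have : (Module.finrank ℂ F.toLinearMap.range : Cardinal) < ((n + 1 : ℕ) : Cardinal) := by
        rw [Module.finrank_eq_rank]; exact hlt
      exact Nat.lt_succ_iff.1 (by exact_mod_cast this)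
    obtain ⟨s, hs, hl⟩ := LinearMap.le_rank_iff_exists_linearIndependent_finset.1 hr
    let S := Submodule.span ℂ (Set.range fun x : (s : Set H) => F.toLinearMap x)
    have hSfin : FiniteDimensional ℂ S := FiniteDimensional.span_of_finite ℂ (Set.finite_range _)
    have hSr : Module.finrank ℂ S = n + 1 := by
      have := finrank_span_eq_card hl
      rw [this]
      simpa using hs
    have hSle : S ≤ F.toLinearMap.range := by
      rw [Submodule.span_le]
      rintro _ ⟨x, rfl⟩
      exact ⟨x, rfl⟩
    let b := (stdOrthonormalBasis ℂ S).reindex (finCongr hSr)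
    have hb : ∀ j, ∃ x, F x = b j := fun j => hSle (b j).2
    choose x hx using hb
    have := h x (fun i => b i)
    have e : (Matrix.of fun i j => ⟪(b i : G), F (x j)⟫_ℂ) = 1 := by
      ext i j
      rw [Matrix.of_apply, hx, ← Submodule.coe_inner, orthonormal_iff_ite.1 b.orthonormal,
        Matrix.one_apply]
    rw [minor, e, Matrix.det_one] at this
    exact one_ne_zero this

theorem isClosed_hasRankLE (n : ℕ) : IsClosed {F : H →L[ℂ] G | HasRankLE n F.toLinearMap} := by
  have : {F : H →L[ℂ] G | HasRankLE n F.toLinearMap} =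
      ⋂ (x : Fin (n + 1) → H) (y : Fin (n + 1) → G), {F | minor x y F = 0} := by
    ext F
    simp [hasRankLE_iff_minor_eq_zero]
  rw [this]
  exact isClosed_iInter fun x => isClosed_iInter fun y =>
    isClosed_eq (differentiable_minor x y).continuous continuous_const

variable {E : Type*} [NormedAddCommGroup E] [NormedSpace ℂ E]

/-- The identity theorem on a convex open subset of a complex normed space. -/
theorem DifferentiableOn.eq_zero_of_eventuallyEq_zero_of_convex {U : Set E} (hU : IsOpen U)
    (hc : Convex ℝ U) {f : E → ℂ} (hf : DifferentiableOn ℂ f U) {w : E} (hw : w ∈ U)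
    (h0 : f =ᶠ[𝓝 w] 0) : ∀ z ∈ U, f z = 0 := by
  intro z hz
  -- The complex line from w to z meets U in a set with convex, hence connected, parameter domain.
  -- The identity theorem in one variable applies there.
  let γ : ℂ → E := fun t => w + t • (z - w)
  have hγ : Differentiable ℂ γ := by fun_prop
  let O := γ ⁻¹' U
  have hO : IsOpen O := hU.preimage hγ.continuous
  have hOc : Convex ℝ O := by
    intro s hs t ht a b ha hb hab
    have : γ (a • s + b • t) = a • γ s + b • γ t := by
      simp only [γ, smul_add, add_smul, smul_assoc]
      rw [show a • w + a • s • (z - w) + (b • w + b • t • (z - w)) =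
        (a + b) • w + (a • s • (z - w) + b • t • (z - w)) by rw [add_smul]; abel, hab, one_smul]
    change γ _ ∈ U
    rw [this]
    exact hc hs ht ha hb hab
  have h0O : (0 : ℂ) ∈ O := by simpa [O, γ] using hw
  have h1O : (1 : ℂ) ∈ O := by simpa [O, γ] using hz
  have hd : DifferentiableOn ℂ (f ∘ γ) O := hf.comp hγ.differentiableOn (fun t ht => ht)
  have han : AnalyticOnNhd ℂ (f ∘ γ) O := hd.analyticOnNhd hO
  have hev : f ∘ γ =ᶠ[𝓝 0] 0 := by
    have ht : Filter.Tendsto γ (𝓝 0) (𝓝 w) := by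
      have := hγ.continuous.tendsto 0
      simpa [γ] using this
    exact ht.eventually h0
  have := han.eqOn_zero_of_preconnected_of_eventuallyEq_zero hOc.isPreconnected h0O hev h1O
  simpa [γ] using this

/-- A holomorphic family of finite rank operators on a convex open set has bounded rank. -/
theorem exists_hasRankLE_of_finiteRank [CompleteSpace E] {U : Set E} (hU : IsOpen U)
    (hc : Convex ℝ U) {F : E → H →L[ℂ] G} (hF : DifferentiableOn ℂ F U)
    (hfin : ∀ z ∈ U, FiniteRank (F z).toLinearMap) :
    ∃ n, ∀ z ∈ U, HasRankLE n (F z).toLinearMap := by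
  rcases U.eq_empty_or_nonempty with rfl | hne
  · exact ⟨0, fun z hz => hz.elim⟩
  have : BaireSpace U := hU.baireSpace
  have : Nonempty U := hne.to_subtype
  have hcont : Continuous fun z : U => F z := hF.continuousOn.domRestrict
  -- By Baire one of the closed sets of points with rank at most n has an interior point. The minors
  -- of size n + 1 vanish near it, hence on all of U.
  obtain ⟨n, ⟨w, hw⟩, hwi⟩ := nonempty_interior_of_iUnion_of_closed
    (f := fun n : ℕ => {z : U | HasRankLE n (F z).toLinearMap})
    (fun n => (isClosed_hasRankLE n).preimage hcont) (by
      rw [Set.eq_univ_iff_forall]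
      intro z
      exact Set.mem_iUnion.2 ⟨_, HasRankLE.of_finiteRank (hfin z z.2)⟩)
  refine ⟨n, fun z hz => (hasRankLE_iff_minor_eq_zero _).2 fun x y => ?_⟩
  refine DifferentiableOn.eq_zero_of_eventuallyEq_zero_of_convex (f := fun z => minor x y (F z))
    hU hc ((differentiable_minor x y).comp_differentiableOn hF) hw ?_ z hz
  have h1 : ∀ᶠ z : U in 𝓝 (⟨w, hw⟩ : U), HasRankLE n (F z).toLinearMap :=
    mem_interior_iff_mem_nhds.1 hwi
  have h2 : ∀ᶠ z in 𝓝 w, z ∈ U ∧ HasRankLE n (F z).toLinearMap := by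
    rw [nhds_subtype_eq_comap] at h1
    obtain ⟨t, ht, hts⟩ := h1
    filter_upwards [ht, hU.mem_nhds hw] with z hz hzU
    exact ⟨hzU, hts (show (⟨z, hzU⟩ : U) ∈ _ from hz)⟩
  filter_upwards [h2] with z hz
  exact (hasRankLE_iff_minor_eq_zero _).1 hz.2 x y

end BoundedRank

/-! ### Holomorphy of the determinant -/

noncomputable section DeterminantDerivative

variable {H : Type*} [NormedAddCommGroup H] [InnerProductSpace ℂ H]
variable {E : Type*} [NormedAddCommGroup E] [NormedSpace ℂ E]

theorem finiteRankTrace_add {𝕜 V : Type*} [Field 𝕜] [AddCommGroup V] [Module 𝕜 V]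
    {F G : V →ₗ[𝕜] V} (hF : FiniteRank F) (hG : FiniteRank G) :
    finiteRankTrace (F + G) = finiteRankTrace F + finiteRankTrace G := by
  have h := finiteRankTrace_sub (hF.add hG) hG
  rw [add_sub_cancel_right] at h
  rw [h, sub_add_cancel]

/-- F'(v) is a norm limit of multiples of increments of F, and the operators of rank at most n form
a closed set. -/
theorem HasFDerivAt.hasRankLE {G : Type*} [NormedAddCommGroup G] [InnerProductSpace ℂ G]
    {F : E → H →L[ℂ] G} {F' : E →L[ℂ] H →L[ℂ] G} {z₀ : E} (hF : HasFDerivAt F F' z₀) {n : ℕ}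
    (hn : ∀ᶠ z in 𝓝 z₀, HasRankLE n (F z - F z₀).toLinearMap) (v : E) :
    HasRankLE n (F' v).toLinearMap := by
  have h1 : HasDerivAt (fun t : ℂ => F (z₀ + t • v)) (F' v) 0 := hF.hasLineDerivAt v
  rw [hasDerivAt_iff_tendsto_slope] at h1
  refine (isClosed_hasRankLE n).mem_of_tendsto h1 ?_
  have h2 : Filter.Tendsto (fun t : ℂ => z₀ + t • v) (𝓝 0) (𝓝 z₀) := by
    have : Continuous fun t : ℂ => z₀ + t • v := by fun_prop
    simpa using this.tendsto 0
  filter_upwards [(h2.mono_left nhdsWithin_le_nhds).eventually hn] with t ht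
  have e : slope (fun t : ℂ => F (z₀ + t • v)) 0 t = t⁻¹ • (F (z₀ + t • v) - F z₀) := by
    simp [slope_def_module]
  change HasRankLE n (slope (fun t : ℂ => F (z₀ + t • v)) 0 t).toLinearMap
  rw [e]
  exact ht.smul _

/-- Holomorphy of the determinant of a holomorphic family of invertible operators that are
perturbations of the identity of bounded rank. -/
theorem differentiableAt_finiteRankDet [FiniteDimensional ℂ E] {T : E → H →L[ℂ] H} {z₀ : E}
    (hT : DifferentiableAt ℂ T z₀) {R : H →L[ℂ] H} (hR : (T z₀).comp R = ContinuousLinearMap.id ℂ H)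
    {n : ℕ}
    (hn : ∀ᶠ z in 𝓝 z₀, HasRankLE n (LinearMap.id - (T z).toLinearMap)) :
    DifferentiableAt ℂ (fun z => finiteRankDet (T z).toLinearMap) z₀ := by
  have hn₀ := hn.self_of_nhds
  -- T z = T z₀ (1 + G z) with G z₀ = 0, so differentiability is needed only at the identity. G z
  -- has rank at most n + n.
  let G : E → H →L[ℂ] H := fun z => R.comp (T z - T z₀)
  let G' : E →L[ℂ] H →L[ℂ] H := (ContinuousLinearMap.compL ℂ H H H R).comp (fderiv ℂ T z₀)
  have hG : HasFDerivAt G G' z₀ :=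
    (ContinuousLinearMap.compL ℂ H H H R).hasFDerivAt.comp z₀ (hT.hasFDerivAt.sub_const (T z₀))
  have hG0 : G z₀ = 0 := by simp [G]
  have hGn : ∀ᶠ z in 𝓝 z₀, HasRankLE (n + n) (G z).toLinearMap := by
    filter_upwards [hn] with z hz
    have := (hn₀.sub hz).comp_left R.toLinearMap
    rw [sub_sub_sub_cancel_left] at this
    exact this
  have hG'n : ∀ v, HasRankLE (n + n) (G' v).toLinearMap := hG.hasRankLE (by
    simpa only [hG0, sub_zero] using hGn)
  -- The candidate derivative is v ↦ tr G'(v). Additivity uses that all values of G' have finite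
  -- rank; continuity comes from the finite dimension of the parameter space.
  let L : E →L[ℂ] ℂ := LinearMap.toContinuousLinearMap
    { toFun := fun v => finiteRankTrace (G' v).toLinearMap
      map_add' := fun v w => by
        rw [map_add]
        exact finiteRankTrace_add (hG'n v).finiteRank (hG'n w).finiteRank
      map_smul' := fun c v => by
        rw [map_smul]
        exact finiteRankTrace_smul (hG'n v).finiteRank c }
  have hL : ∀ v, L v = finiteRankTrace (G' v).toLinearMap := fun _ => rfl
  have hdet : HasFDerivAt (fun z => finiteRankDet (LinearMap.id + (G z).toLinearMap)) L z₀ := by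
    refine HasFDerivAt.of_isLittleO (Asymptotics.isLittleO_iff.2 fun c hc => ?_)
    let K := ‖G'‖ + 1
    have hK : 0 < K := by positivity
    have hlo := hG.isLittleO
    simp only [hG0, sub_zero] at hlo
    have e1 : ∀ᶠ z in 𝓝 z₀, ‖G z‖ ≤ K * ‖z - z₀‖ := by
      filter_upwards [hlo.def one_pos] with z hz
      calc ‖G z‖ = ‖(G z - G' (z - z₀)) + G' (z - z₀)‖ := by rw [sub_add_cancel]
        _ ≤ 1 * ‖z - z₀‖ + ‖G'‖ * ‖z - z₀‖ :=
          (norm_add_le _ _).trans (add_le_add hz (G'.le_opNorm _))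
        _ = K * ‖z - z₀‖ := by simp only [K]; ring
    obtain ⟨δ, hδ, hdetδ⟩ := exists_norm_finiteRankDet_sub_le (H := H) (n + n)
      (ε := c / (2 * K)) (by positivity)
    have e2 : ∀ᶠ z in 𝓝 z₀, ‖G z‖ ≤ δ := by
      have : Filter.Tendsto G (𝓝 z₀) (𝓝 0) := by
        have := hG.continuousAt.tendsto
        rwa [hG0] at this
      filter_upwards [this.eventually (Metric.closedBall_mem_nhds 0 hδ)] with z hz
      simpa using hz
    -- The rank bound for G z - G'(z - z₀). The remainder is the determinant expansion at G z plus
    -- the trace of this difference; each is given half of c, and m + 1 below avoids division by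
    -- zero.
    let m : ℕ := n + n + (n + n)
    filter_upwards [e1, e2, hGn, hlo.def (show 0 < c / (2 * (m + 1)) by positivity)]
      with z h1 h2 h3 h4
    have h5 := hdetδ _ h3 h2
    have h6 : ‖finiteRankTrace (G z - G' (z - z₀)).toLinearMap‖ ≤ m * ‖G z - G' (z - z₀)‖ :=
      norm_finiteRankTrace_le _ (h3.sub (hG'n _))
    have h7 : finiteRankTrace (G z - G' (z - z₀)).toLinearMap =
        finiteRankTrace (G z).toLinearMap - finiteRankTrace (G' (z - z₀)).toLinearMap :=
      finiteRankTrace_sub h3.finiteRank (hG'n _).finiteRank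
    have h8 : finiteRankDet (LinearMap.id + (G z₀).toLinearMap) = 1 := by
      rw [hG0]
      change finiteRankDet (LinearMap.id + (0 : H →ₗ[ℂ] H)) = 1
      rw [add_zero, finiteRankDet_id]
    rw [h8, hL]
    have h9 : finiteRankDet (LinearMap.id + (G z).toLinearMap) - 1 -
        finiteRankTrace (G' (z - z₀)).toLinearMap =
        (finiteRankDet (LinearMap.id + (G z).toLinearMap) - 1 -
          finiteRankTrace (G z).toLinearMap) +
        finiteRankTrace (G z - G' (z - z₀)).toLinearMap := by
      rw [h7]; ring
    rw [h9]
    calc _ ≤ c / (2 * K) * ‖G z‖ + m * ‖G z - G' (z - z₀)‖ := (norm_add_le _ _).trans (add_le_add h5 h6)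
      _ ≤ c / (2 * K) * (K * ‖z - z₀‖) + (m + 1) * (c / (2 * (m + 1)) * ‖z - z₀‖) := by
        refine add_le_add (by gcongr) ?_
        refine mul_le_mul (by linarith) h4 (norm_nonneg _) (by positivity)
      _ = c * ‖z - z₀‖ := by field_simp; ring
  have hev : (fun z => finiteRankDet (T z₀).toLinearMap *
      finiteRankDet (LinearMap.id + (G z).toLinearMap)) =ᶠ[𝓝 z₀]
      fun z => finiteRankDet (T z).toLinearMap := by
    filter_upwards [hGn] with z hz
    have h1 : FiniteRank (LinearMap.id - (LinearMap.id + (G z).toLinearMap)) := by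
      rw [sub_add_cancel_left]
      exact hz.finiteRank.neg
    rw [← finiteRankDet_comp hn₀.finiteRank h1]
    congr 1
    ext x
    have e1 : ∀ y, T z₀ (R y) = y := fun y => DFunLike.congr_fun hR y
    simp [G, e1]
  exact (hdet.differentiableAt.const_mul _).congr_of_eventuallyEq hev.symm

end DeterminantDerivative

/-! ### Operator norm holomorphic families of linear maps -/

noncomputable section HolomorphicFamilies

variable {E : Type*} [NormedAddCommGroup E] [NormedSpace ℂ E]
variable {V : Type*} [NormedAddCommGroup V] [NormedSpace ℂ V]
variable {W : Type*} [NormedAddCommGroup W] [NormedSpace ℂ W]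
variable {K : Type*} [NormedAddCommGroup K] [NormedSpace ℂ K]

/-- A family of linear maps consists on `U` of bounded operators, and is holomorphic in the operator
norm. -/
def HolOn (F : E → V →ₗ[ℂ] W) (U : Set E) : Prop :=
  ∃ F' : E → V →L[ℂ] W, DifferentiableOn ℂ F' U ∧ ∀ z ∈ U, F z = (F' z).toLinearMap

namespace HolOn

variable {U : Set E}

theorem mono {F : E → V →ₗ[ℂ] W} {U' : Set E} (h : HolOn F U) (hU : U' ⊆ U) : HolOn F U' := by
  obtain ⟨F', hd, hF⟩ := h
  exact ⟨F', hd.mono hU, fun z hz => hF z (hU hz)⟩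

theorem const {F : V →ₗ[ℂ] W} (h : Continuous F) : HolOn (fun _ : E => F) U :=
  ⟨fun _ => ⟨F, h⟩, differentiableOn_const _, fun _ _ => rfl⟩

theorem continuous {F : E → V →ₗ[ℂ] W} (h : HolOn F U) {z : E} (hz : z ∈ U) :
    Continuous (F z) := by
  obtain ⟨F', -, hF⟩ := h
  rw [hF z hz]
  exact (F' z).continuous

theorem add {F G : E → V →ₗ[ℂ] W} (hF : HolOn F U) (hG : HolOn G U) :
    HolOn (fun z => F z + G z) U := by
  obtain ⟨F', hd, hF⟩ := hF
  obtain ⟨G', hd', hG⟩ := hG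
  exact ⟨fun z => F' z + G' z, hd.add hd', fun z hz => by change F z + G z = _; rw [hF z hz, hG z hz]; rfl⟩

theorem sub {F G : E → V →ₗ[ℂ] W} (hF : HolOn F U) (hG : HolOn G U) :
    HolOn (fun z => F z - G z) U := by
  obtain ⟨F', hd, hF⟩ := hF
  obtain ⟨G', hd', hG⟩ := hG
  exact ⟨fun z => F' z - G' z, hd.sub hd', fun z hz => by change F z - G z = _; rw [hF z hz, hG z hz]; rfl⟩

theorem comp {F : E → W →ₗ[ℂ] K} {G : E → V →ₗ[ℂ] W} (hF : HolOn F U) (hG : HolOn G U) :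
    HolOn (fun z => F z ∘ₗ G z) U := by
  obtain ⟨F', hd, hF⟩ := hF
  obtain ⟨G', hd', hG⟩ := hG
  refine ⟨fun z => (F' z).comp (G' z), hd.clm_comp hd', fun z hz => ?_⟩
  change F z ∘ₗ G z = _
  rw [hF z hz, hG z hz]
  rfl

theorem sum {ι : Type*} (s : Finset ι) {F : ι → E → V →ₗ[ℂ] W} (hF : ∀ i ∈ s, HolOn (F i) U) :
    HolOn (fun z => ∑ i ∈ s, F i z) U := by
  classical
  induction s using Finset.induction_on with
  | empty => simpa using const (U := U) (F := (0 : V →ₗ[ℂ] W)) continuous_const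
  | insert a s ha ih =>
    simp only [Finset.sum_insert ha]
    exact (hF a (by simp)).add (ih fun i hi => hF i (by simp [hi]))

theorem congr {F G : E → V →ₗ[ℂ] W} (hF : HolOn F U) (h : ∀ z ∈ U, G z = F z) : HolOn G U := by
  obtain ⟨F', hd, hF⟩ := hF
  exact ⟨F', hd, fun z hz => (h z hz).trans (hF z hz)⟩

/-- If a holomorphic family is the identity at one point, then the inverses form a holomorphic family
near this point. -/
theorem exists_inverse [CompleteSpace V] (hU : IsOpen U) {F : E → V →ₗ[ℂ] V} (hF : HolOn F U)
    {z₀ : E} (hz₀ : z₀ ∈ U) (h1 : F z₀ = LinearMap.id) :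
    ∃ B, IsOpen B ∧ z₀ ∈ B ∧ B ⊆ U ∧ ∃ G : E → V →ₗ[ℂ] V, HolOn G B ∧
      ∀ z ∈ B, (∀ x, F z (G z x) = x) ∧ ∀ x, G z (F z x) = x := by
  obtain ⟨F', hd, hF⟩ := hF
  have hF1 : F' z₀ = 1 := by
    ext x
    have := LinearMap.congr_fun ((hF z₀ hz₀).symm.trans h1) x
    exact this
  have hB : IsOpen (U ∩ F' ⁻¹' {T | IsUnit T}) :=
    hd.continuousOn.isOpen_inter_preimage hU Units.isOpen
  refine ⟨_, hB, ⟨hz₀, by simp [hF1]⟩, Set.inter_subset_left,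
    fun z => (Ring.inverse (F' z)).toLinearMap, ⟨fun z => Ring.inverse (F' z), ?_, fun _ _ => rfl⟩,
    ?_⟩
  · rintro z ⟨hz, hu⟩
    have h2 : DifferentiableAt ℂ (Ring.inverse : (V →L[ℂ] V) → V →L[ℂ] V) (F' z) :=
      differentiableAt_inverse hu
    exact h2.comp_differentiableWithinAt z ((hd z hz).mono Set.inter_subset_left)
  · rintro z ⟨hz, hu⟩
    rw [hF z hz]
    exact ⟨fun x => DFunLike.congr_fun (Ring.mul_inverse_cancel _ hu) x,
      fun x => DFunLike.congr_fun (Ring.inverse_mul_cancel _ hu) x⟩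

end HolOn

end HolomorphicFamilies

/-! ### Homotopies: squaring, correction and transfer -/

namespace TwoPeriodicComplex

noncomputable section Homotopies

variable {𝕜 : Type*} [Field 𝕜] {Vp Vm : Type*}
variable [AddCommGroup Vp] [Module 𝕜 Vp] [AddCommGroup Vm] [Module 𝕜 Vm]
variable {Cp Cm Gp Gm : Type*} [AddCommGroup Cp] [Module 𝕜 Cp] [AddCommGroup Cm] [Module 𝕜 Cm]
variable [AddCommGroup Gp] [Module 𝕜 Gp] [AddCommGroup Gm] [Module 𝕜 Gm]

/-- The conditions of `IsContraction` without the requirement that the contraction has square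
zero. -/
structure IsHomotopy (D : TwoPeriodicComplex 𝕜 Vp Vm) (ιp : Cp →ₗ[𝕜] Vp) (πp : Vp →ₗ[𝕜] Cp)
    (ιm : Cm →ₗ[𝕜] Vm) (πm : Vm →ₗ[𝕜] Cm) (hp : Vm →ₗ[𝕜] Vp) (hm : Vp →ₗ[𝕜] Vm) : Prop where
  hp_ιm : ∀ c, hp (ιm c) = 0
  hm_ιp : ∀ c, hm (ιp c) = 0
  πp_hp : ∀ y, πp (hp y) = 0
  πm_hm : ∀ x, πm (hm x) = 0
  plus : ∀ x, D.dm (hm x) + hp (D.dp x) = x - ιp (πp x)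
  minus : ∀ y, D.dp (hp y) + hm (D.dm y) = y - ιm (πm y)

namespace IsHomotopy

variable {D E : TwoPeriodicComplex 𝕜 Vp Vm} {D' : TwoPeriodicComplex 𝕜 Vm Vp}
  {ιp : Cp →ₗ[𝕜] Vp} {πp : Vp →ₗ[𝕜] Cp} {ιm : Cm →ₗ[𝕜] Vm} {πm : Vm →ₗ[𝕜] Cm}
  {jp : Gp →ₗ[𝕜] Vp} {qp : Vp →ₗ[𝕜] Gp} {jm : Gm →ₗ[𝕜] Vm} {qm : Vm →ₗ[𝕜] Gm}
  {hp : Vm →ₗ[𝕜] Vp} {hm : Vp →ₗ[𝕜] Vm}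

theorem swap (h : D.IsHomotopy ιp πp ιm πm hp hm) : D.swap.IsHomotopy ιm πm ιp πp hm hp :=
  ⟨h.hm_ιp, h.hp_ιm, h.πm_hm, h.πp_hp, h.minus, h.plus⟩

theorem dp_hp_dp (hD : D.IsExactSum ιp πp ιm πm) (h : D.IsHomotopy ιp πp ιm πm hp hm) (x : Vp) :
    D.dp (hp (D.dp x)) = D.dp x := by
  have := h.minus (D.dp x)
  rwa [D.dm_dp, map_zero, add_zero, hD.πm_dp, map_zero, sub_zero] at this

/-- The reason why h d h has square zero: by the homotopy identity at h d x, d h fixes d x and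
leaves no room for d h h d x. -/
theorem dm_hm_hp_dp (hD : D.IsExactSum ιp πp ιm πm) (h : D.IsHomotopy ιp πp ιm πm hp hm) (x : Vp) :
    D.dm (hm (hp (D.dp x))) = 0 := by
  have := h.plus (hp (D.dp x))
  rw [h.dp_hp_dp hD, h.πp_hp, map_zero, sub_zero] at this
  exact add_eq_right.1 this

/-- A homotopy `h` gives the contraction `h d h` of square zero. -/
def square (hD : D.IsExactSum ιp πp ιm πm) (h : D.IsHomotopy ιp πp ιm πm hp hm) :
    TwoPeriodicComplex 𝕜 Vm Vp where
  dp := hp ∘ₗ D.dp ∘ₗ hp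
  dm := hm ∘ₗ D.dm ∘ₗ hm
  dm_dp y := by
    change hm (D.dm (hm (hp (D.dp (hp y))))) = 0
    rw [h.dm_hm_hp_dp hD, map_zero]
  dp_dm x := by
    change hp (D.dp (hp (hm (D.dm (hm x))))) = 0
    have := h.swap.dm_hm_hp_dp hD.swap (hm x)
    change D.dp (hp (hm (D.dm (hm x)))) = 0 at this
    rw [this, map_zero]

theorem isContraction (hD : D.IsExactSum ιp πp ιm πm) (h : D.IsHomotopy ιp πp ιm πm hp hm) :
    D.IsContraction (h.square hD) ιp πp ιm πm := by
  have e : ∀ y, D.dm (hm (D.dm y)) = D.dm y := h.swap.dp_hp_dp hD.swap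
  refine ⟨fun c => ?_, fun c => ?_, fun y => h.πp_hp _, fun x => h.πm_hm _, fun x => ?_,
    fun y => ?_⟩
  · change hp (D.dp (hp (ιm c))) = 0
    rw [h.hp_ιm, map_zero, map_zero]
  · change hm (D.dm (hm (ιp c))) = 0
    rw [h.hm_ιp, map_zero, map_zero]
  · change D.dm (hm (D.dm (hm x))) + hp (D.dp (hp (D.dp x))) = _
    rw [e, h.dp_hp_dp hD, h.plus]
  · change D.dp (hp (D.dp (hp y))) + hm (D.dm (hm (D.dm y))) = _
    rw [e, h.dp_hp_dp hD, h.minus]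

/-- Correction of an approximate homotopy `(hp, hm)` by the inverse of `d h + h d`. -/
theorem of_inverse (hD : D.IsExactSum ιp πp ιm πm) (hp_ιm : ∀ c, hp (ιm c) = 0)
    (hm_ιp : ∀ c, hm (ιp c) = 0) (πp_hp : ∀ y, πp (hp y) = 0) (πm_hm : ∀ x, πm (hm x) = 0)
    {vp : Vp →ₗ[𝕜] Vp} {vm : Vm →ₗ[𝕜] Vm}
    (hp₁ : ∀ x, (D.dm ∘ₗ hm + hp ∘ₗ D.dp + ιp ∘ₗ πp) (vp x) = x)
    (hp₂ : ∀ x, vp ((D.dm ∘ₗ hm + hp ∘ₗ D.dp + ιp ∘ₗ πp) x) = x)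
    (hm₁ : ∀ y, (D.dp ∘ₗ hp + hm ∘ₗ D.dm + ιm ∘ₗ πm) (vm y) = y)
    (hm₂ : ∀ y, vm ((D.dp ∘ₗ hp + hm ∘ₗ D.dm + ιm ∘ₗ πm) y) = y) :
    D.IsHomotopy ιp πp ιm πm (vp ∘ₗ hp) (vm ∘ₗ hm) := by
  have up : ∀ x, (D.dm ∘ₗ hm + hp ∘ₗ D.dp + ιp ∘ₗ πp) x =
    D.dm (hm x) + hp (D.dp x) + ιp (πp x) := fun x => rfl
  have um : ∀ y, (D.dp ∘ₗ hp + hm ∘ₗ D.dm + ιm ∘ₗ πm) y =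
    D.dp (hp y) + hm (D.dm y) + ιm (πm y) := fun y => rfl
  simp only [up, um] at hp₁ hp₂ hm₁ hm₂
  -- The operator d h + h d + ι π commutes with d, ι and π, hence so does its inverse v. Therefore d
  -- v h + v h d = v (d h + h d) = 1 - ι π.
  have vdm : ∀ y, vp (D.dm y) = D.dm (vm y) := fun y => by
    have h1 : D.dm y = D.dm (hm (D.dm (vm y))) + hp (D.dp (D.dm (vm y))) +
        ιp (πp (D.dm (vm y))) := by
      conv_lhs => rw [← hm₁ y]
      simp [D.dm_dp, D.dp_dm, hD.dm_ιm, hD.πp_dm]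
    rw [h1, hp₂]
  have vdp : ∀ x, vm (D.dp x) = D.dp (vp x) := fun x => by
    have h1 : D.dp x = D.dp (hp (D.dp (vp x))) + hm (D.dm (D.dp (vp x))) +
        ιm (πm (D.dp (vp x))) := by
      conv_lhs => rw [← hp₁ x]
      simp [D.dm_dp, D.dp_dm, hD.dp_ιp, hD.πm_dp]
    rw [h1, hm₂]
  have vιp : ∀ c, vp (ιp c) = ιp c := fun c => by
    have := hp₂ (ιp c)
    simpa [hm_ιp, hD.dp_ιp, hD.πp_ιp] using this
  have vιm : ∀ c, vm (ιm c) = ιm c := fun c => by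
    have := hm₂ (ιm c)
    simpa [hp_ιm, hD.dm_ιm, hD.πm_ιm] using this
  have πvp : ∀ x, πp (vp x) = πp x := fun x => by
    have := congrArg πp (hp₁ x)
    simpa [hD.πp_dm, πp_hp, hD.πp_ιp] using this
  have πvm : ∀ y, πm (vm y) = πm y := fun y => by
    have := congrArg πm (hm₁ y)
    simpa [hD.πm_dp, πm_hm, hD.πm_ιm] using this
  refine ⟨fun c => ?_, fun c => ?_, fun y => ?_, fun x => ?_, fun x => ?_, fun y => ?_⟩
  · rw [LinearMap.comp_apply, hp_ιm, map_zero]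
  · rw [LinearMap.comp_apply, hm_ιp, map_zero]
  · rw [LinearMap.comp_apply, πvp, πp_hp]
  · rw [LinearMap.comp_apply, πvm, πm_hm]
  · rw [LinearMap.comp_apply, LinearMap.comp_apply, ← vdm, ← map_add, eq_sub_iff_add_eq,
      ← vιp, ← map_add, hp₂]
  · rw [LinearMap.comp_apply, LinearMap.comp_apply, ← vdp, ← map_add, eq_sub_iff_add_eq,
      ← vιm, ← map_add, hm₂]

/-- Homotopies from maps that are right inverses of the differentials on their images. -/
theorem of_rightInverse (hD : D.IsExactSum ιp πp ιm πm) {sp : Vm →ₗ[𝕜] Vp} {sm : Vp →ₗ[𝕜] Vm}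
    (hsp : ∀ x, D.dp (sp (D.dp x)) = D.dp x) (hsm : ∀ y, D.dm (sm (D.dm y)) = D.dm y) :
    D.IsHomotopy ιp πp ιm πm
      ((LinearMap.id - ιp ∘ₗ πp) ∘ₗ sp ∘ₗ
        (LinearMap.id - ιm ∘ₗ πm - (LinearMap.id - ιm ∘ₗ πm) ∘ₗ sm ∘ₗ D.dm))
      ((LinearMap.id - ιm ∘ₗ πm) ∘ₗ sm ∘ₗ
        (LinearMap.id - ιp ∘ₗ πp - (LinearMap.id - ιp ∘ₗ πp) ∘ₗ sp ∘ₗ D.dp)) := by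
  -- Subtracting from y its component in C₋ and the lift of d₋ y gives a cycle without component in
  -- C₋. By exactness it is a boundary, and d₊ sp is the identity on boundaries.
  have key1 : ∀ y, D.dp (sp (y - ιm (πm y) - (sm (D.dm y) - ιm (πm (sm (D.dm y)))))) =
      y - ιm (πm y) - (sm (D.dm y) - ιm (πm (sm (D.dm y)))) := fun y => by
    obtain ⟨x, hx⟩ := hD.exact_minus (y - ιm (πm y) - (sm (D.dm y) - ιm (πm (sm (D.dm y)))))
      (by simp [hD.dm_ιm, hsm]) (by simp [hD.πm_ιm])
    rw [← hx, hsp]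
  have key2 : ∀ x, D.dm (sm (x - ιp (πp x) - (sp (D.dp x) - ιp (πp (sp (D.dp x)))))) =
      x - ιp (πp x) - (sp (D.dp x) - ιp (πp (sp (D.dp x)))) := fun x => by
    obtain ⟨y, hy⟩ := hD.exact_plus (x - ιp (πp x) - (sp (D.dp x) - ιp (πp (sp (D.dp x)))))
      (by simp [hD.dp_ιp, hsp]) (by simp [hD.πp_ιp])
    rw [← hy, hsm]
  refine ⟨fun c => ?_, fun c => ?_, fun y => ?_, fun x => ?_, fun x => ?_, fun y => ?_⟩
  · simp [hD.dm_ιm, hD.πm_ιm]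
  · simp [hD.dp_ιp, hD.πp_ιp]
  · simp [hD.πp_ιp]
  · simp [hD.πm_ιm]
  · have := key2 x
    simp only [LinearMap.comp_apply, LinearMap.sub_apply, LinearMap.id_apply, D.dm_dp,
      hD.dm_ιm, hD.πm_dp, map_sub, map_zero, sub_zero] at this ⊢
    rw [this]
    abel
  · have := key1 y
    simp only [LinearMap.comp_apply, LinearMap.sub_apply, LinearMap.id_apply, D.dp_dm,
      hD.dp_ιp, hD.πp_dm, map_sub, map_zero, sub_zero] at this ⊢
    rw [this]
    abel

section Transfer

variable (D' jp qp jm qm)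

/-- The compression of `D'₊` to the complement of the trivial complex. -/
def compressPlus : Vm →ₗ[𝕜] Vp :=
  (LinearMap.id - jp ∘ₗ qp) ∘ₗ D'.dp ∘ₗ (LinearMap.id - jm ∘ₗ qm)

/-- The compression of `D'₋` to the complement of the trivial complex. -/
def compressMinus : Vp →ₗ[𝕜] Vm :=
  (LinearMap.id - jm ∘ₗ qm) ∘ₗ D'.dm ∘ₗ (LinearMap.id - jp ∘ₗ qp)

variable (E hp hm)

/-- The homotopy of `E` close to `D'` that is obtained from the homotopy `(hp, hm)`. -/
def transferPlus : Vm →ₗ[𝕜] Vp :=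
  compressPlus D' jp qp jm qm + hp ∘ₗ (LinearMap.id - jm ∘ₗ qm -
    (E.dp ∘ₗ compressPlus D' jp qp jm qm + compressMinus D' jp qp jm qm ∘ₗ E.dm))

/-- The homotopy of `E` close to `D'` that is obtained from the homotopy `(hp, hm)`. -/
def transferMinus : Vp →ₗ[𝕜] Vm :=
  compressMinus D' jp qp jm qm + hm ∘ₗ (LinearMap.id - jp ∘ₗ qp -
    (E.dm ∘ₗ compressMinus D' jp qp jm qm + compressPlus D' jp qp jm qm ∘ₗ E.dp))

end Transfer

/-- Let k be the compression of D' and e = 1 - j q - (d k + k d) its error. As e commutes with d and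
q e = 0, replacing k by k + h e adds (d h + h d) e = e and repairs the homotopy identity. -/
theorem transfer (hE : E.IsExactSum jp qp jm qm) (h : E.IsHomotopy jp qp jm qm hp hm) :
    E.IsHomotopy jp qp jm qm (transferPlus E D' jp qp jm qm hp)
      (transferMinus E D' jp qp jm qm hm) := by
  set kp := compressPlus D' jp qp jm qm with hkp
  set km := compressMinus D' jp qp jm qm with hkm
  have kp_jm : ∀ c, kp (jm c) = 0 := fun c => by simp [hkp, compressPlus, hE.πm_ιm]
  have km_jp : ∀ c, km (jp c) = 0 := fun c => by simp [hkm, compressMinus, hE.πp_ιp]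
  have qp_kp : ∀ y, qp (kp y) = 0 := fun y => by simp [hkp, compressPlus, hE.πp_ιp]
  have qm_km : ∀ x, qm (km x) = 0 := fun x => by simp [hkm, compressMinus, hE.πm_ιm]
  have ap : ∀ y, transferPlus E D' jp qp jm qm hp y =
    kp y + hp (y - jm (qm y) - (E.dp (kp y) + km (E.dm y))) := fun y => rfl
  have am : ∀ x, transferMinus E D' jp qp jm qm hm x =
    km x + hm (x - jp (qp x) - (E.dm (km x) + kp (E.dp x))) := fun x => rfl
  refine ⟨fun c => ?_, fun c => ?_, fun y => ?_, fun x => ?_, fun x => ?_, fun y => ?_⟩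
  · rw [ap, kp_jm, hE.πm_ιm, hE.dm_ιm]; simp
  · rw [am, km_jp, hE.πp_ιp, hE.dp_ιp]; simp
  · rw [ap, map_add, qp_kp, h.πp_hp, add_zero]
  · rw [am, map_add, qm_km, h.πm_hm, add_zero]
  · have := h.plus (x - jp (qp x) - (E.dm (km x) + kp (E.dp x)))
    rw [ap, am]
    simp only [map_add, map_sub, E.dm_dp, E.dp_dm, hE.dp_ιp, hE.πm_dp, hE.πp_dm, hE.πp_ιp, qp_kp,
      map_zero, sub_zero, add_zero, zero_add, sub_self] at this ⊢
    rw [eq_sub_iff_add_eq, eq_sub_iff_add_eq] at this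
    rw [← sub_eq_zero] at this ⊢
    rw [← this]
    abel
  · have := h.minus (y - jm (qm y) - (E.dp (kp y) + km (E.dm y)))
    rw [ap, am]
    simp only [map_add, map_sub, E.dm_dp, E.dp_dm, hE.dm_ιm, hE.πm_dp, hE.πp_dm, hE.πm_ιm, qm_km,
      map_zero, sub_zero, add_zero, zero_add, sub_self] at this ⊢
    rw [eq_sub_iff_add_eq, eq_sub_iff_add_eq] at this
    rw [← sub_eq_zero] at this ⊢
    rw [← this]
    abel

end IsHomotopy

theorem _root_.FiniteRank.id_sub_comp_sub {V G : Type*} [AddCommGroup V] [Module 𝕜 V]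
    [AddCommGroup G] [Module 𝕜 G] [FiniteDimensional 𝕜 G] (j : G →ₗ[𝕜] V) (q : V →ₗ[𝕜] G) :
    FiniteRank (LinearMap.id - j ∘ₗ q - LinearMap.id) := by
  rw [sub_sub_cancel_left]
  exact ((FiniteRank.of_finiteDimensional_left j).comp_right q).neg

namespace IsHomotopy

variable {D E : TwoPeriodicComplex 𝕜 Vp Vm} {D' : TwoPeriodicComplex 𝕜 Vm Vp}
  {ιp : Cp →ₗ[𝕜] Vp} {πp : Vp →ₗ[𝕜] Cp} {ιm : Cm →ₗ[𝕜] Vm} {πm : Vm →ₗ[𝕜] Cm}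
  {jp : Gp →ₗ[𝕜] Vp} {qp : Vp →ₗ[𝕜] Gp} {jm : Gm →ₗ[𝕜] Vm} {qm : Vm →ₗ[𝕜] Gm}
  {hp : Vm →ₗ[𝕜] Vp} {hm : Vp →ₗ[𝕜] Vm}

variable [FiniteDimensional 𝕜 Gp] [FiniteDimensional 𝕜 Gm]

theorem finiteRank_compressPlus_sub :
    FiniteRank (compressPlus D' jp qp jm qm - D'.dp) := by
  have h := (FiniteRank.id_sub_comp_sub jp qp).comp_sub_comp
    ((FiniteRank.refl D'.dp).comp_sub_comp (FiniteRank.id_sub_comp_sub jm qm))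
  rwa [LinearMap.comp_id, LinearMap.id_comp] at h

theorem finiteRank_compressMinus_sub :
    FiniteRank (compressMinus D' jp qp jm qm - D'.dm) := by
  have h := (FiniteRank.id_sub_comp_sub jm qm).comp_sub_comp
    ((FiniteRank.refl D'.dm).comp_sub_comp (FiniteRank.id_sub_comp_sub jp qp))
  rwa [LinearMap.comp_id, LinearMap.id_comp] at h

/-- D' satisfies the contraction identity for D, and replacing D by E or D' by its compression
changes everything by finite rank. So the error corrected in the transfer has finite rank, whatever
hp is. -/
theorem finiteRank_transferPlus_sub [FiniteDimensional 𝕜 Cm] (hD' : D.IsContraction D' ιp πp ιm πm)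
    (hDE : D.IsFiniteRankPerturbation E) :
    FiniteRank (transferPlus E D' jp qp jm qm hp - D'.dp) := by
  have h1 : FiniteRank (E.dp ∘ₗ compressPlus D' jp qp jm qm +
      compressMinus D' jp qp jm qm ∘ₗ E.dm - (D.dp ∘ₗ D'.dp + D'.dm ∘ₗ D.dm)) :=
    (hDE.plus.symm.comp_sub_comp finiteRank_compressPlus_sub).add_sub_add
      (finiteRank_compressMinus_sub.comp_sub_comp hDE.minus.symm)
  have h2 : D.dp ∘ₗ D'.dp + D'.dm ∘ₗ D.dm = LinearMap.id - ιm ∘ₗ πm :=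
    LinearMap.ext fun y => hD'.minus y
  rw [h2] at h1
  have h3 := h1.trans (FiniteRank.id_sub_comp_sub ιm πm)
  have h4 := ((FiniteRank.id_sub_comp_sub jm qm).trans h3.symm).comp_left hp
  rw [transferPlus, add_sub_right_comm]
  exact finiteRank_compressPlus_sub.add h4

theorem finiteRank_transferMinus_sub [FiniteDimensional 𝕜 Cp] (hD' : D.IsContraction D' ιp πp ιm πm)
    (hDE : D.IsFiniteRankPerturbation E) :
    FiniteRank (transferMinus E D' jp qp jm qm hm - D'.dm) := by
  have h1 : FiniteRank (E.dm ∘ₗ compressMinus D' jp qp jm qm +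
      compressPlus D' jp qp jm qm ∘ₗ E.dp - (D.dm ∘ₗ D'.dm + D'.dp ∘ₗ D.dp)) :=
    (hDE.minus.symm.comp_sub_comp finiteRank_compressMinus_sub).add_sub_add
      (finiteRank_compressPlus_sub.comp_sub_comp hDE.plus.symm)
  have h2 : D.dm ∘ₗ D'.dm + D'.dp ∘ₗ D.dp = LinearMap.id - ιp ∘ₗ πp :=
    LinearMap.ext fun y => hD'.plus y
  rw [h2] at h1
  have h3 := h1.trans (FiniteRank.id_sub_comp_sub ιp πp)
  have h4 := ((FiniteRank.id_sub_comp_sub jp qp).trans h3.symm).comp_left hm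
  rw [transferMinus, add_sub_right_comm]
  exact finiteRank_compressMinus_sub.add h4

/-- Passing from h to h d h costs only finite rank, since D' already satisfies D' d D' = D'. -/
theorem isFiniteRankPerturbation_square_transfer [FiniteDimensional 𝕜 Cp]
    [FiniteDimensional 𝕜 Cm] (hD : D.IsExactSum ιp πp ιm πm)
    (hD' : D.IsContraction D' ιp πp ιm πm) (hDE : D.IsFiniteRankPerturbation E)
    (hE : E.IsExactSum jp qp jm qm) (h : E.IsHomotopy jp qp jm qm hp hm) :
    D'.IsFiniteRankPerturbation ((h.transfer (D' := D') hE).square hE) := by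
  have hi := hD'.isPseudoInv hD
  have hp := finiteRank_transferPlus_sub (jp := jp) (qp := qp) (jm := jm) (qm := qm) (hp := hp)
    hD' hDE
  have hm := finiteRank_transferMinus_sub (jp := jp) (qp := qp) (jm := jm) (qm := qm) (hm := hm)
    hD' hDE
  have e1 : D'.dp ∘ₗ D.dp ∘ₗ D'.dp = D'.dp := LinearMap.ext fun y => hi.plus.right y
  have e2 : D'.dm ∘ₗ D.dm ∘ₗ D'.dm = D'.dm := LinearMap.ext fun y => hi.minus.right y
  constructor
  · have := hp.comp_sub_comp (hDE.plus.symm.comp_sub_comp hp)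
    rw [e1] at this
    exact this.symm
  · have := hm.comp_sub_comp (hDE.minus.symm.comp_sub_comp hm)
    rw [e2] at this
    exact this.symm

end IsHomotopy

/-- The inverse of a stabilization of `σ₊`. -/
theorem IsContraction.stab_stab {D : TwoPeriodicComplex 𝕜 Vp Vm} {D' : TwoPeriodicComplex 𝕜 Vm Vp}
    {ιp : Cp →ₗ[𝕜] Vp} {πp : Vp →ₗ[𝕜] Cp} {ιm : Cm →ₗ[𝕜] Vm} {πm : Vm →ₗ[𝕜] Cm}
    (h' : D.IsContraction D' ιp πp ιm πm) (h : D.IsExactSum ιp πp ιm πm) (l : Cp ≃ₗ[𝕜] Cm)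
    (y : Vm) :
    D.stab D' πp ιm l.toLinearMap (D'.stab D πm ιp l.symm.toLinearMap y) = y := by
  have e1 : D'.stab D πm ιp l.symm.toLinearMap y = D'.sigmaPlus D y + ιp (l.symm (πm y)) := rfl
  have e2 : ∀ x, D.stab D' πp ιm l.toLinearMap x = D.sigmaPlus D' x + ιm (l (πp x)) := fun _ => rfl
  have e3 : πp (D'.sigmaPlus D y) = 0 := by
    change πp (D'.dp y + D.dm y) = 0
    rw [map_add, h'.πp_dp, h.πp_dm, add_zero]
  rw [e1, e2, map_add, map_add, (h'.symm h).sigmaPlus_sigmaPlus, h'.sigmaPlus_ιp h, e3, zero_add,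
    h.πp_ιp, LinearEquiv.apply_symm_apply, add_zero, sub_add_cancel]

end Homotopies

end TwoPeriodicComplex

/-! ### Holomorphic contractions and local holomorphy -/

/-- A bounded operator with closed range between Hilbert spaces has a bounded generalized inverse. -/
theorem ContinuousLinearMap.exists_generalizedInverse {H G : Type*} [NormedAddCommGroup H]
    [InnerProductSpace ℂ H] [CompleteSpace H] [NormedAddCommGroup G] [InnerProductSpace ℂ G]
    [CompleteSpace G] (T : H →L[ℂ] G) (hT : IsClosed (T.toLinearMap.range : Set G)) :
    ∃ S : G →L[ℂ] H, ∀ x, T (S (T x)) = T x := by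
  let R : Submodule ℂ G := T.toLinearMap.range
  let K : Submodule ℂ H := T.toLinearMap.kerᗮ
  have : CompleteSpace R := hT.completeSpace_coe
  have hk : IsClosed (T.toLinearMap.ker : Set H) := T.isClosed_ker
  have : CompleteSpace T.toLinearMap.ker := hk.completeSpace_coe
  -- T is a bijection from the orthogonal complement of its kernel onto its closed range.
  -- Completeness of both makes the inverse bounded; composing it with the orthogonal projection
  -- onto the range gives S.
  let T' : K →L[ℂ] R := (T.comp K.subtypeL).codRestrict R fun x => ⟨x, rfl⟩
  have hT' : ∀ x, (T' x : G) = T x := fun _ => rfl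
  have h1 : T'.toLinearMap.ker = ⊥ := by
    refine LinearMap.ker_eq_bot'.2 fun x hx => ?_
    have h2 : (x : H) ∈ T.toLinearMap.ker := congrArg Subtype.val hx
    have h3 := Submodule.inner_right_of_mem_orthogonal h2 x.2
    exact Subtype.ext (inner_self_eq_zero.1 h3)
  have h2 : T'.toLinearMap.range = ⊤ := by
    rw [LinearMap.range_eq_top]
    rintro ⟨_, x, rfl⟩
    refine ⟨⟨x - T.toLinearMap.ker.starProjection x,
      Submodule.sub_starProjection_mem_orthogonal x⟩, Subtype.ext ?_⟩
    have h3 : T (T.toLinearMap.ker.starProjection x) = 0 :=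
      T.toLinearMap.ker.starProjection_apply_mem x
    change T (x - T.toLinearMap.ker.starProjection x) = T x
    rw [map_sub, h3, sub_zero]
  let e := ContinuousLinearEquiv.ofBijective T' h1 h2
  refine ⟨K.subtypeL.comp ((e.symm : R →L[ℂ] K).comp R.orthogonalProjectionOnto), fun x => ?_⟩
  have h3 : R.orthogonalProjectionOnto (T x) = ⟨T x, x, rfl⟩ :=
    R.orthogonalProjectionOnto_mem_subspace_eq_self ⟨T x, x, rfl⟩
  change T (e.symm (R.orthogonalProjectionOnto (T x)) : H) = T x
  rw [h3, ← hT']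
  change ((e (e.symm ⟨T x, x, rfl⟩) : R) : G) = T x
  rw [ContinuousLinearEquiv.apply_symm_apply]

namespace TwoPeriodicComplex

noncomputable section

/-- By exactness the image of d₊ is the common kernel of the continuous maps d₋ and π₋. -/
theorem IsExactSum.isClosed_range_dp {𝕜 Vp Vm Cp Cm : Type*} [NontriviallyNormedField 𝕜]
    [NormedAddCommGroup Vp] [NormedSpace 𝕜 Vp] [NormedAddCommGroup Vm] [NormedSpace 𝕜 Vm]
    [NormedAddCommGroup Cp] [NormedSpace 𝕜 Cp] [NormedAddCommGroup Cm] [NormedSpace 𝕜 Cm]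
    {ιp : Cp →ₗ[𝕜] Vp} {πp : Vp →ₗ[𝕜] Cp} {ιm : Cm →ₗ[𝕜] Vm} {πm : Vm →ₗ[𝕜] Cm}
    {D : TwoPeriodicComplex 𝕜 Vp Vm}
    (hD : D.IsExactSum ιp πp ιm πm) (hdm : Continuous D.dm) (hπm : Continuous πm) :
    IsClosed (D.dp.range : Set Vm) := by
  have h : (D.dp.range : Set Vm) = {y | D.dm y = 0} ∩ {y | πm y = 0} := by
    ext y
    constructor
    · rintro ⟨x, rfl⟩
      exact ⟨D.dm_dp x, hD.πm_dp x⟩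
    · rintro ⟨h1, h2⟩
      exact hD.exact_minus y h1 h2
  rw [h]
  exact (isClosed_eq hdm continuous_const).inter (isClosed_eq hπm continuous_const)

theorem exists_holOn_square {E Vp Vm Cp Cm : Type*} [NormedAddCommGroup E] [NormedSpace ℂ E]
    [NormedAddCommGroup Vp] [NormedSpace ℂ Vp] [NormedAddCommGroup Vm] [NormedSpace ℂ Vm]
    [AddCommGroup Cp] [Module ℂ Cp] [AddCommGroup Cm] [Module ℂ Cm]
    {ιp : Cp →ₗ[ℂ] Vp} {πp : Vp →ₗ[ℂ] Cp} {ιm : Cm →ₗ[ℂ] Vm} {πm : Vm →ₗ[ℂ] Cm}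
    {B : Set E} {D : E → TwoPeriodicComplex ℂ Vp Vm}
    (hdp : HolOn (fun z => (D z).dp) B) (hdm : HolOn (fun z => (D z).dm) B)
    (hD : ∀ z ∈ B, (D z).IsExactSum ιp πp ιm πm) {hp : E → Vm →ₗ[ℂ] Vp} {hm : E → Vp →ₗ[ℂ] Vm}
    (hhp : HolOn hp B) (hhm : HolOn hm B)
    (h : ∀ z ∈ B, (D z).IsHomotopy ιp πp ιm πm (hp z) (hm z)) :
    ∃ D' : E → TwoPeriodicComplex ℂ Vm Vp, HolOn (fun z => (D' z).dp) B ∧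
      HolOn (fun z => (D' z).dm) B ∧ ∀ z (hz : z ∈ B), D' z = (h z hz).square (hD z hz) := by
  classical
  let D' : E → TwoPeriodicComplex ℂ Vm Vp := fun z =>
    if hz : z ∈ B then (h z hz).square (hD z hz) else ⟨0, 0, fun _ => rfl, fun _ => rfl⟩
  have e : ∀ z (hz : z ∈ B), D' z = (h z hz).square (hD z hz) := fun z hz => dif_pos hz
  refine ⟨D', (hhp.comp (hdp.comp hhp)).congr fun z hz => ?_,
    (hhm.comp (hdm.comp hhm)).congr fun z hz => ?_, e⟩
  · rw [e z hz]; rfl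
  · rw [e z hz]; rfl

/-- Passes from the vectors normalized by l and r to the fixed vectors ω₋ and η₋. The extra factor a
b⁻¹ depends only on l, r and these vectors, so it is constant in a family. -/
theorem IsContraction.exists_isPerturbationIso_smul {𝕜 Vp Vm Cp Cm Gp Gm : Type*} [Field 𝕜]
    [AddCommGroup Vp] [Module 𝕜 Vp] [AddCommGroup Vm] [Module 𝕜 Vm]
    [AddCommGroup Cp] [Module 𝕜 Cp] [AddCommGroup Cm] [Module 𝕜 Cm]
    [AddCommGroup Gp] [Module 𝕜 Gp] [AddCommGroup Gm] [Module 𝕜 Gm]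
    [FiniteDimensional 𝕜 Cp] [FiniteDimensional 𝕜 Cm] [FiniteDimensional 𝕜 Gp]
    [FiniteDimensional 𝕜 Gm] {D E : TwoPeriodicComplex 𝕜 Vp Vm}
    {D' E' : TwoPeriodicComplex 𝕜 Vm Vp}
    {ιp : Cp →ₗ[𝕜] Vp} {πp : Vp →ₗ[𝕜] Cp} {ιm : Cm →ₗ[𝕜] Vm} {πm : Vm →ₗ[𝕜] Cm}
    {jp : Gp →ₗ[𝕜] Vp} {qp : Vp →ₗ[𝕜] Gp} {jm : Gm →ₗ[𝕜] Vm} {qm : Vm →ₗ[𝕜] Gm}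
    (hD' : D.IsContraction D' ιp πp ιm πm)
    (hD : D.IsExactSum ιp πp ιm πm) (hE' : E.IsContraction E' jp qp jm qm)
    (hE : E.IsExactSum jp qp jm qm) (hDE : D.IsFiniteRankPerturbation E)
    (hDE' : D'.IsFiniteRankPerturbation E') (l : Cp ≃ₗ[𝕜] Cm) (r : Gp ≃ₗ[𝕜] Gm) {T : Vp →ₗ[𝕜] Vp}
    (hT : E.stab E' qp jm r.toLinearMap ∘ₗ T = D.stab D' πp ιm l.toLinearMap)
    {ωp : DetLine 𝕜 Cp} {ωm : DetLine 𝕜 Cm} {ηp : DetLine 𝕜 Gp} {ηm : DetLine 𝕜 Gm}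
    (hωp : ωp ≠ 0) (hωm : ωm ≠ 0) (hηp : ηp ≠ 0) (hηm : ηm ≠ 0) {a b : 𝕜} (ha0 : a ≠ 0)
    (hb0 : b ≠ 0) (ha : a • ωm = detMap l.toLinearMap ωp)
    (hb : b • ηm = detMap r.toLinearMap ηp) :
    ∃ P : D.Det →ₗ[𝕜] E.Det, D.IsPerturbationIso E P ∧
      P (detMap hD.toHPlus ωp ⊗ₜ[𝕜] dualVector (detMap hD.toHMinus ωm)) =
        (a * b⁻¹ * (finiteRankDet T)⁻¹) •
          (detMap hE.toHPlus ηp ⊗ₜ[𝕜] dualVector (detMap hE.toHMinus ηm)) := by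
  have := hD.isFredholm.minus
  have := hE.isFredholm.minus
  obtain ⟨P, hP, hPv⟩ := hD'.exists_isPerturbationIso hD hE' hE hDE hDE' l r hT
  refine ⟨P, hP, ?_⟩
  rw [hD'.stabVec_stab hD l hωp, hE'.stabVec_stab hE r hηp, ← ha, ← hb,
    map_smul, map_smul, dualVector_smul (detMap_ne_zero hD.bijective_toHMinus hωm) ha0,
    dualVector_smul (detMap_ne_zero hE.bijective_toHMinus hηm) hb0, TensorProduct.tmul_smul,
    TensorProduct.tmul_smul, map_smul, inv_smul_eq_iff₀ ha0, smul_smul, smul_smul] at hPv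
  rw [hPv]
  congr 1
  ring

variable {E : Type*} [NormedAddCommGroup E] [NormedSpace ℂ E]
variable {Vp Vm : Type*} [NormedAddCommGroup Vp] [InnerProductSpace ℂ Vp] [CompleteSpace Vp]
  [NormedAddCommGroup Vm] [InnerProductSpace ℂ Vm] [CompleteSpace Vm]
variable {Cp Cm Gp Gm : Type*} [NormedAddCommGroup Cp] [NormedSpace ℂ Cp] [FiniteDimensional ℂ Cp]
  [NormedAddCommGroup Cm] [NormedSpace ℂ Cm] [FiniteDimensional ℂ Cm]
  [NormedAddCommGroup Gp] [NormedSpace ℂ Gp] [FiniteDimensional ℂ Gp]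
  [NormedAddCommGroup Gm] [NormedSpace ℂ Gm] [FiniteDimensional ℂ Gm]
variable {ιp : Cp →ₗ[ℂ] Vp} {πp : Vp →ₗ[ℂ] Cp} {ιm : Cm →ₗ[ℂ] Vm} {πm : Vm →ₗ[ℂ] Cm}
  {jp : Gp →ₗ[ℂ] Vp} {qp : Vp →ₗ[ℂ] Gp} {jm : Gm →ₗ[ℂ] Vm} {qm : Vm →ₗ[ℂ] Gm}

/-- Existence of bounded homotopies. -/
theorem IsExactSum.exists_continuous_isHomotopy {D : TwoPeriodicComplex ℂ Vp Vm}
    (hD : D.IsExactSum ιp πp ιm πm) (hdp : Continuous D.dp) (hdm : Continuous D.dm)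
    (hπp : Continuous πp) (hπm : Continuous πm) :
    ∃ (hp : Vm →ₗ[ℂ] Vp) (hm : Vp →ₗ[ℂ] Vm), Continuous hp ∧ Continuous hm ∧
      D.IsHomotopy ιp πp ιm πm hp hm := by
  obtain ⟨sp, hsp⟩ := ContinuousLinearMap.exists_generalizedInverse ⟨D.dp, hdp⟩
    (hD.isClosed_range_dp hdm hπm)
  obtain ⟨sm, hsm⟩ := ContinuousLinearMap.exists_generalizedInverse ⟨D.dm, hdm⟩
    (hD.swap.isClosed_range_dp hdp hπp)
  have hιp : Continuous ιp := ιp.continuous_of_finiteDimensional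
  have hιm : Continuous ιm := ιm.continuous_of_finiteDimensional
  refine ⟨_, _, ?_, ?_, IsHomotopy.of_rightInverse (sp := sp.toLinearMap) (sm := sm.toLinearMap)
    hD hsp hsm⟩
  · let f : Vm →L[ℂ] Vp := (ContinuousLinearMap.id ℂ Vp - .comp ⟨ιp, hιp⟩ ⟨πp, hπp⟩).comp (sp.comp
      (ContinuousLinearMap.id ℂ Vm - .comp ⟨ιm, hιm⟩ ⟨πm, hπm⟩ -
        (ContinuousLinearMap.id ℂ Vm - .comp ⟨ιm, hιm⟩ ⟨πm, hπm⟩).comp (sm.comp ⟨D.dm, hdm⟩)))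
    exact f.continuous
  · let f : Vp →L[ℂ] Vm := (ContinuousLinearMap.id ℂ Vm - .comp ⟨ιm, hιm⟩ ⟨πm, hπm⟩).comp (sm.comp
      (ContinuousLinearMap.id ℂ Vp - .comp ⟨ιp, hιp⟩ ⟨πp, hπp⟩ -
        (ContinuousLinearMap.id ℂ Vp - .comp ⟨ιp, hιp⟩ ⟨πp, hπp⟩).comp (sp.comp ⟨D.dp, hdp⟩)))
    exact f.continuous

/-- Existence of holomorphic homotopies near a point. -/
theorem exists_holOn_isHomotopy {U : Set E} (hU : IsOpen U) {D : E → TwoPeriodicComplex ℂ Vp Vm}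
    (hdp : HolOn (fun z => (D z).dp) U) (hdm : HolOn (fun z => (D z).dm) U)
    (hD : ∀ z ∈ U, (D z).IsExactSum ιp πp ιm πm) (hπp : Continuous πp) (hπm : Continuous πm)
    {z₀ : E} (hz₀ : z₀ ∈ U) :
    ∃ B, IsOpen B ∧ z₀ ∈ B ∧ B ⊆ U ∧ ∃ (hp : E → Vm →ₗ[ℂ] Vp) (hm : E → Vp →ₗ[ℂ] Vm),
      HolOn hp B ∧ HolOn hm B ∧ ∀ z ∈ B, (D z).IsHomotopy ιp πp ιm πm (hp z) (hm z) := by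
  have hιp : Continuous ιp := ιp.continuous_of_finiteDimensional
  have hιm : Continuous ιm := ιm.continuous_of_finiteDimensional
  obtain ⟨hp, hm, cp, cm, h⟩ := (hD z₀ hz₀).exists_continuous_isHomotopy
    (hdp.continuous hz₀) (hdm.continuous hz₀) hπp hπm
  -- The homotopy at z₀ is used for all nearby z. This operator is the identity at z₀, hence
  -- invertible nearby, and its inverse corrects the homotopy holomorphically.
  have up : HolOn (fun z => (D z).dm ∘ₗ hm + hp ∘ₗ (D z).dp + ιp ∘ₗ πp) U :=
    ((hdm.comp (.const cm)).add (.comp (.const cp) hdp)).add (.const (hιp.comp hπp))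
  have um : HolOn (fun z => (D z).dp ∘ₗ hp + hm ∘ₗ (D z).dm + ιm ∘ₗ πm) U :=
    ((hdp.comp (.const cp)).add (.comp (.const cm) hdm)).add (.const (hιm.comp hπm))
  obtain ⟨Bp, oBp, zBp, sBp, vp, hvp, invp⟩ := up.exists_inverse hU hz₀ (LinearMap.ext fun x => by
    change (D z₀).dm (hm x) + hp ((D z₀).dp x) + ιp (πp x) = x
    rw [h.plus, sub_add_cancel])
  obtain ⟨Bm, oBm, zBm, sBm, vm, hvm, invm⟩ := um.exists_inverse hU hz₀ (LinearMap.ext fun x => by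
    change (D z₀).dp (hp x) + hm ((D z₀).dm x) + ιm (πm x) = x
    rw [h.minus, sub_add_cancel])
  refine ⟨Bp ∩ Bm, oBp.inter oBm, ⟨zBp, zBm⟩, Set.inter_subset_left.trans sBp,
    fun z => vp z ∘ₗ hp, fun z => vm z ∘ₗ hm,
    (hvp.mono Set.inter_subset_left).comp (.const cp),
    (hvm.mono Set.inter_subset_right).comp (.const cm), ?_⟩
  rintro z ⟨hz1, hz2⟩
  exact IsHomotopy.of_inverse (hD z (sBp hz1)) h.hp_ιm h.hm_ιp h.πp_hp h.πm_hm (invp z hz1).1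
    (invp z hz1).2 (invm z hz2).1 (invm z hz2).2

/-- Existence, near a point, of holomorphic families of contractions that differ by operators of
finite rank. -/
theorem exists_holOn_isContraction {U : Set E}
    (hU : IsOpen U) {D Δ : E → TwoPeriodicComplex ℂ Vp Vm}
    (hdp : HolOn (fun z => (D z).dp) U) (hdm : HolOn (fun z => (D z).dm) U)
    (hδp : HolOn (fun z => (Δ z).dp) U) (hδm : HolOn (fun z => (Δ z).dm) U)
    (hD : ∀ z ∈ U, (D z).IsExactSum ιp πp ιm πm) (hΔ : ∀ z ∈ U, (Δ z).IsExactSum jp qp jm qm)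
    (hDΔ : ∀ z ∈ U, (D z).IsFiniteRankPerturbation (Δ z))
    (hπp : Continuous πp) (hπm : Continuous πm) (hqp : Continuous qp) (hqm : Continuous qm)
    {z₀ : E} (hz₀ : z₀ ∈ U) :
    ∃ ρ > 0, Metric.ball z₀ ρ ⊆ U ∧ ∃ D' Δ' : E → TwoPeriodicComplex ℂ Vm Vp,
      HolOn (fun z => (D' z).dp) (Metric.ball z₀ ρ) ∧
      HolOn (fun z => (D' z).dm) (Metric.ball z₀ ρ) ∧
      HolOn (fun z => (Δ' z).dp) (Metric.ball z₀ ρ) ∧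
      HolOn (fun z => (Δ' z).dm) (Metric.ball z₀ ρ) ∧
      ∀ z ∈ Metric.ball z₀ ρ, (D z).IsContraction (D' z) ιp πp ιm πm ∧
        (Δ z).IsContraction (Δ' z) jp qp jm qm ∧ (D' z).IsFiniteRankPerturbation (Δ' z) := by
  have hjp : Continuous jp := jp.continuous_of_finiteDimensional
  have hjm : Continuous jm := jm.continuous_of_finiteDimensional
  obtain ⟨B₁, oB₁, zB₁, sB₁, hp, hm, hhp, hhm, hh⟩ :=
    exists_holOn_isHomotopy hU hdp hdm hD hπp hπm hz₀
  obtain ⟨B₂, oB₂, zB₂, sB₂, κp, κm, hκp, hκm, hκ⟩ :=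
    exists_holOn_isHomotopy hU hδp hδm hΔ hqp hqm hz₀
  -- A ball is taken because the bounded rank argument requires a convex domain.
  obtain ⟨ρ, hρ, hball⟩ := Metric.isOpen_iff.1 (oB₁.inter oB₂) z₀ ⟨zB₁, zB₂⟩
  set B := Metric.ball z₀ ρ with hB
  have s1 : B ⊆ B₁ := fun z hz => (hball hz).1
  have s2 : B ⊆ B₂ := fun z hz => (hball hz).2
  have sU : B ⊆ U := s1.trans sB₁
  obtain ⟨D', hD'p, hD'm, eD'⟩ := exists_holOn_square (hdp.mono sU) (hdm.mono sU)
    (fun z hz => hD z (sU hz)) (hhp.mono s1) (hhm.mono s1) (fun z hz => hh z (s1 hz))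
  have hD' : ∀ z ∈ B, (D z).IsContraction (D' z) ιp πp ιm πm := fun z hz => by
    rw [eD' z hz]; exact (hh z (s1 hz)).isContraction (hD z (sU hz))
  have hQp : HolOn (fun _ : E => LinearMap.id - jp ∘ₗ qp) B :=
    (HolOn.const (F := LinearMap.id) continuous_id).sub (.const (hjp.comp hqp))
  have hQm : HolOn (fun _ : E => LinearMap.id - jm ∘ₗ qm) B :=
    (HolOn.const (F := LinearMap.id) continuous_id).sub (.const (hjm.comp hqm))
  have hkp : HolOn (fun z => IsHomotopy.compressPlus (D' z) jp qp jm qm) B :=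
    hQp.comp (hD'p.comp hQm)
  have hkm : HolOn (fun z => IsHomotopy.compressMinus (D' z) jp qp jm qm) B :=
    hQm.comp (hD'm.comp hQp)
  -- Two independently chosen contractions need not differ by finite rank. The one for Δ is
  -- therefore built from D', with the homotopy κ used only for the correction.
  have htp : HolOn (fun z => IsHomotopy.transferPlus (Δ z) (D' z) jp qp jm qm (κp z)) B :=
    hkp.add ((hκp.mono s2).comp (hQm.sub (((hδp.mono sU).comp hkp).add (hkm.comp (hδm.mono sU)))))
  have htm : HolOn (fun z => IsHomotopy.transferMinus (Δ z) (D' z) jp qp jm qm (κm z)) B :=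
    hkm.add ((hκm.mono s2).comp (hQp.sub (((hδm.mono sU).comp hkm).add (hkp.comp (hδp.mono sU)))))
  have ht : ∀ z ∈ B, (Δ z).IsHomotopy jp qp jm qm
      (IsHomotopy.transferPlus (Δ z) (D' z) jp qp jm qm (κp z))
      (IsHomotopy.transferMinus (Δ z) (D' z) jp qp jm qm (κm z)) := fun z hz =>
    (hκ z (s2 hz)).transfer (hΔ z (sU hz))
  obtain ⟨Δ', hΔ'p, hΔ'm, eΔ'⟩ := exists_holOn_square (hδp.mono sU) (hδm.mono sU)
    (fun z hz => hΔ z (sU hz)) htp htm ht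
  have hΔ' : ∀ z ∈ B, (Δ z).IsContraction (Δ' z) jp qp jm qm := fun z hz => by
    rw [eΔ' z hz]; exact (ht z hz).isContraction (hΔ z (sU hz))
  have hDΔ' : ∀ z ∈ B, (D' z).IsFiniteRankPerturbation (Δ' z) := fun z hz => by
    rw [eΔ' z hz]
    exact IsHomotopy.isFiniteRankPerturbation_square_transfer (hD z (sU hz)) (hD' z hz)
      (hDΔ z (sU hz)) (hΔ z (sU hz)) (hκ z (s2 hz))
  exact ⟨ρ, hρ, sU, D', Δ', hD'p, hD'm, hΔ'p, hΔ'm, fun z hz => ⟨hD' z hz, hΔ' z hz, hDΔ' z hz⟩⟩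

set_option maxHeartbeats 1000000 in
/-- The perturbation isomorphisms of a holomorphic family exist, and are holomorphic near a point
with respect to the trivializations by fixed elements of the determinant lines of the trivial
complexes. -/
theorem exists_differentiableAt_isPerturbationIso [FiniteDimensional ℂ E] {U : Set E}
    (hU : IsOpen U) {D Δ : E → TwoPeriodicComplex ℂ Vp Vm}
    (hdp : HolOn (fun z => (D z).dp) U) (hdm : HolOn (fun z => (D z).dm) U)
    (hδp : HolOn (fun z => (Δ z).dp) U) (hδm : HolOn (fun z => (Δ z).dm) U)
    (hD : ∀ z ∈ U, (D z).IsExactSum ιp πp ιm πm) (hΔ : ∀ z ∈ U, (Δ z).IsExactSum jp qp jm qm)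
    (hDΔ : ∀ z ∈ U, (D z).IsFiniteRankPerturbation (Δ z))
    (hπp : Continuous πp) (hπm : Continuous πm) (hqp : Continuous qp) (hqm : Continuous qm)
    (hC : Module.finrank ℂ Cp = Module.finrank ℂ Cm)
    (hG : Module.finrank ℂ Gp = Module.finrank ℂ Gm)
    {ωp : DetLine ℂ Cp} {ωm : DetLine ℂ Cm} {ηp : DetLine ℂ Gp} {ηm : DetLine ℂ Gm}
    (hωp : ωp ≠ 0) (hωm : ωm ≠ 0) (hηp : ηp ≠ 0) (hηm : ηm ≠ 0) {z₀ : E} (hz₀ : z₀ ∈ U) :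
    ∃ f : E → ℂ, DifferentiableAt ℂ f z₀ ∧ ∀ᶠ z in 𝓝 z₀, f z ≠ 0 ∧
      ∀ (h : (D z).IsExactSum ιp πp ιm πm) (k : (Δ z).IsExactSum jp qp jm qm),
        ∃ P, (D z).IsPerturbationIso (Δ z) P ∧
          P (detMap h.toHPlus ωp ⊗ₜ[ℂ] dualVector (detMap h.toHMinus ωm)) =
            f z • (detMap k.toHPlus ηp ⊗ₜ[ℂ] dualVector (detMap k.toHMinus ηm)) := by
  have hιp : Continuous ιp := ιp.continuous_of_finiteDimensional
  have hιm : Continuous ιm := ιm.continuous_of_finiteDimensional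
  have hjp : Continuous jp := jp.continuous_of_finiteDimensional
  have hjm : Continuous jm := jm.continuous_of_finiteDimensional
  obtain ⟨ρ, hρ, sU, D', Δ', hD'p, hD'm, hΔ'p, hΔ'm, hc⟩ :=
    exists_holOn_isContraction hU hdp hdm hδp hδm hD hΔ hDΔ hπp hπm hqp hqm hz₀
  set B := Metric.ball z₀ ρ with hB
  have hD' := fun z hz => (hc z hz).1
  have hΔ' := fun z hz => (hc z hz).2.1
  have hDΔ' := fun z hz => (hc z hz).2.2
  -- Index zero provides isomorphisms independent of z; the stabilizations built from them and their
  -- inverses are holomorphic.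
  let l : Cp ≃ₗ[ℂ] Cm := LinearEquiv.ofFinrankEq Cp Cm hC
  let r : Gp ≃ₗ[ℂ] Gm := LinearEquiv.ofFinrankEq Gp Gm hG
  have hl : Continuous (ιm ∘ₗ l.toLinearMap ∘ₗ πp) :=
    hιm.comp ((l.toLinearMap.continuous_of_finiteDimensional).comp hπp)
  have hls : Continuous (ιp ∘ₗ l.symm.toLinearMap ∘ₗ πm) :=
    hιp.comp ((l.symm.toLinearMap.continuous_of_finiteDimensional).comp hπm)
  have hr : Continuous (jm ∘ₗ r.toLinearMap ∘ₗ qp) :=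
    hjm.comp ((r.toLinearMap.continuous_of_finiteDimensional).comp hqp)
  have hrs : Continuous (jp ∘ₗ r.symm.toLinearMap ∘ₗ qm) :=
    hjp.comp ((r.symm.toLinearMap.continuous_of_finiteDimensional).comp hqm)
  let SD : E → Vp →ₗ[ℂ] Vm := fun z => (D z).stab (D' z) πp ιm l.toLinearMap
  let SDi : E → Vm →ₗ[ℂ] Vp := fun z => (D' z).stab (D z) πm ιp l.symm.toLinearMap
  let SE : E → Vp →ₗ[ℂ] Vm := fun z => (Δ z).stab (Δ' z) qp jm r.toLinearMap
  let SEi : E → Vm →ₗ[ℂ] Vp := fun z => (Δ' z).stab (Δ z) qm jp r.symm.toLinearMap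
  have hSD : HolOn SD B := ((hdp.mono sU).add hD'm).add (.const hl)
  have hSDi : HolOn SDi B := (hD'p.add (hdm.mono sU)).add (.const hls)
  have hSE : HolOn SE B := ((hδp.mono sU).add hΔ'm).add (.const hr)
  have hSEi : HolOn SEi B := (hΔ'p.add (hδm.mono sU)).add (.const hrs)
  have iD : ∀ z ∈ B, ∀ y, SD z (SDi z y) = y := fun z hz y =>
    (hD' z hz).stab_stab (hD z (sU hz)) l y
  have iE : ∀ z ∈ B, ∀ y, SE z (SEi z y) = y := fun z hz y =>
    (hΔ' z hz).stab_stab (hΔ z (sU hz)) r y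
  have iE' : ∀ z ∈ B, ∀ x, SEi z (SE z x) = x := fun z hz x =>
    ((hΔ' z hz).symm (hΔ z (sU hz))).stab_stab
      (IsContraction.isExactSum (hΔ z (sU hz)) (hΔ' z hz)) r.symm x
  -- T = S_Δ⁻¹ S_D is the operator whose inverse determinant is the local formula for f; R is its
  -- inverse.
  obtain ⟨T, hT, eT⟩ := hSEi.comp hSD
  obtain ⟨R, -, eR⟩ := hSDi.comp hSE
  have eT' : ∀ z ∈ B, ∀ x, T z x = SEi z (SD z x) := fun z hz x =>
    (LinearMap.congr_fun (eT z hz) x).symm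
  have eR' : ∀ z ∈ B, ∀ x, R z x = SDi z (SE z x) := fun z hz x =>
    (LinearMap.congr_fun (eR z hz) x).symm
  have TR : ∀ z ∈ B, ∀ x, T z (R z x) = x := fun z hz x => by
    rw [eT' z hz, eR' z hz, iD z hz, iE' z hz]
  have ST : ∀ z ∈ B, SE z ∘ₗ (T z).toLinearMap = SD z := fun z hz => LinearMap.ext fun x => by
    change SE z (T z x) = SD z x
    rw [eT' z hz, iE z hz]
  have fT : ∀ z ∈ B, FiniteRank (LinearMap.id - (T z).toLinearMap) := fun z hz => by
    have hDz := hD z (sU hz)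
    have hΔz := hΔ z (sU hz)
    have fD := ((hD' z hz).isPseudoInv hDz).isFredholmMap hDz.isFredholm
    have fE := ((hΔ' z hz).isPseudoInv hΔz).isFredholmMap hΔz.isFredholm
    exact IsStabilization.finiteRank_id_sub fE fD ((hΔ' z hz).isStabilization hΔz r)
      ((hD' z hz).isStabilization hDz l)
      (IsPseudoInv.finiteRank_sigmaPlus (hDΔ z (sU hz)) (hDΔ' z hz)).symm (ST z hz)
  have : CompleteSpace E := FiniteDimensional.complete ℂ E
  obtain ⟨n, hn⟩ := exists_hasRankLE_of_finiteRank (U := B) Metric.isOpen_ball (convex_ball z₀ ρ)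
    (F := fun z => ContinuousLinearMap.id ℂ Vp - T z) ((differentiableOn_const _).sub hT) fT
  have nB : B ∈ 𝓝 z₀ := Metric.ball_mem_nhds z₀ hρ
  have dT := differentiableAt_finiteRankDet (hT.differentiableAt nB) (R := R z₀)
    (ContinuousLinearMap.ext fun x => TR z₀ (mem_of_mem_nhds nB) x)
    (n := n) (Filter.mem_of_superset nB hn)
  have nT : ∀ z ∈ B, finiteRankDet (T z).toLinearMap ≠ 0 := fun z hz =>
    finiteRankDet_ne_zero (fT z hz) (T₂ := (R z).toLinearMap) (LinearMap.ext fun x => TR z hz x)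
  obtain ⟨a, ha⟩ := DetLine.exists_smul_eq hωm (detMap l.toLinearMap ωp)
  obtain ⟨b, hb⟩ := DetLine.exists_smul_eq hηm (detMap r.toLinearMap ηp)
  have ha0 : a ≠ 0 := by
    rintro rfl
    rw [zero_smul] at ha
    exact detMap_ne_zero l.bijective hωp ha.symm
  have hb0 : b ≠ 0 := by
    rintro rfl
    rw [zero_smul] at hb
    exact detMap_ne_zero r.bijective hηp hb.symm
  refine ⟨fun z => a * b⁻¹ * (finiteRankDet (T z).toLinearMap)⁻¹,
    (dT.inv (nT z₀ (mem_of_mem_nhds nB))).const_mul _, Filter.mem_of_superset nB fun z hz =>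
      ⟨mul_ne_zero (mul_ne_zero ha0 (inv_ne_zero hb0)) (inv_ne_zero (nT z hz)), fun h k => ?_⟩⟩
  exact (hD' z hz).exists_isPerturbationIso_smul h (hΔ' z hz) k (hDΔ z (sU hz)) (hDΔ' z hz) l r
    (ST z hz) hωp hωm hηp hηm ha0 hb0 ha hb

end

end TwoPeriodicComplex

/-! ### Gluing the local functions -/

namespace TwoPeriodicComplex

noncomputable section

variable {E : Type*} [NormedAddCommGroup E] [NormedSpace ℂ E]
variable {Vp Vm : Type*} [NormedAddCommGroup Vp] [InnerProductSpace ℂ Vp] [CompleteSpace Vp]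
  [NormedAddCommGroup Vm] [InnerProductSpace ℂ Vm] [CompleteSpace Vm]
variable {Cp Cm Gp Gm : Type*} [NormedAddCommGroup Cp] [NormedSpace ℂ Cp] [FiniteDimensional ℂ Cp]
  [NormedAddCommGroup Cm] [NormedSpace ℂ Cm] [FiniteDimensional ℂ Cm]
  [NormedAddCommGroup Gp] [NormedSpace ℂ Gp] [FiniteDimensional ℂ Gp]
  [NormedAddCommGroup Gm] [NormedSpace ℂ Gm] [FiniteDimensional ℂ Gm]
variable {ιp : Cp →ₗ[ℂ] Vp} {πp : Vp →ₗ[ℂ] Cp} {ιm : Cm →ₗ[ℂ] Vm} {πm : Vm →ₗ[ℂ] Cm}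
  {jp : Gp →ₗ[ℂ] Vp} {qp : Vp →ₗ[ℂ] Gp} {jm : Gm →ₗ[ℂ] Vm} {qm : Vm →ₗ[ℂ] Gm}

theorem _root_.eq_of_smul_eq_smul_of_ne_zero {𝕜 V : Type*} [Field 𝕜] [AddCommGroup V] [Module 𝕜 V]
    {c d : 𝕜} {v : V} (hv : v ≠ 0) (h : c • v = d • v) : c = d :=
  smul_left_injective 𝕜 hv h

theorem IsExactSum.trivialization_ne_zero {𝕜 Vp Vm Cp Cm : Type*} [Field 𝕜]
    [AddCommGroup Vp] [Module 𝕜 Vp] [AddCommGroup Vm] [Module 𝕜 Vm]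
    [AddCommGroup Cp] [Module 𝕜 Cp] [AddCommGroup Cm] [Module 𝕜 Cm]
    [FiniteDimensional 𝕜 Cp] [FiniteDimensional 𝕜 Cm] {D : TwoPeriodicComplex 𝕜 Vp Vm}
    {ιp : Cp →ₗ[𝕜] Vp} {πp : Vp →ₗ[𝕜] Cp} {ιm : Cm →ₗ[𝕜] Vm} {πm : Vm →ₗ[𝕜] Cm}
    (hD : D.IsExactSum ιp πp ιm πm) {ωp : DetLine 𝕜 Cp} {ωm : DetLine 𝕜 Cm}
    (hωp : ωp ≠ 0) (hωm : ωm ≠ 0) :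
    detMap hD.toHPlus ωp ⊗ₜ[𝕜] dualVector (detMap hD.toHMinus ωm) ≠ 0 := by
  have := hD.isFredholm.plus
  have := hD.isFredholm.minus
  exact tmul_dualVector_ne_zero (detMap_ne_zero hD.bijective_toHPlus hωp)
    (detMap_ne_zero hD.bijective_toHMinus hωm)

/-- The perturbation isomorphisms of a holomorphic family are holomorphic with respect to the
trivializations by fixed elements of the determinant lines of the trivial complexes. -/
theorem exists_differentiableOn_isPerturbationIso [FiniteDimensional ℂ E] {U : Set E}
    (hU : IsOpen U) {D Δ : E → TwoPeriodicComplex ℂ Vp Vm}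
    (hdp : HolOn (fun z => (D z).dp) U) (hdm : HolOn (fun z => (D z).dm) U)
    (hδp : HolOn (fun z => (Δ z).dp) U) (hδm : HolOn (fun z => (Δ z).dm) U)
    (hD : ∀ z ∈ U, (D z).IsExactSum ιp πp ιm πm) (hΔ : ∀ z ∈ U, (Δ z).IsExactSum jp qp jm qm)
    (hDΔ : ∀ z ∈ U, (D z).IsFiniteRankPerturbation (Δ z))
    (hπp : Continuous πp) (hπm : Continuous πm) (hqp : Continuous qp) (hqm : Continuous qm)
    (hC : Module.finrank ℂ Cp = Module.finrank ℂ Cm)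
    (hG : Module.finrank ℂ Gp = Module.finrank ℂ Gm)
    {ωp : DetLine ℂ Cp} {ωm : DetLine ℂ Cm} {ηp : DetLine ℂ Gp} {ηm : DetLine ℂ Gm}
    (hωp : ωp ≠ 0) (hωm : ωm ≠ 0) (hηp : ηp ≠ 0) (hηm : ηm ≠ 0) :
    ∃ f : E → ℂ, DifferentiableOn ℂ f U ∧ (∀ z ∈ U, f z ≠ 0) ∧
      ∀ z ∈ U, (∃ P, (D z).IsPerturbationIso (Δ z) P) ∧
        ∀ (h : (D z).IsExactSum ιp πp ιm πm) (k : (Δ z).IsExactSum jp qp jm qm) (P),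
          (D z).IsPerturbationIso (Δ z) P →
          P (detMap h.toHPlus ωp ⊗ₜ[ℂ] dualVector (detMap h.toHMinus ωm)) =
            f z • (detMap k.toHPlus ηp ⊗ₜ[ℂ] dualVector (detMap k.toHMinus ηm)) := by
  have local_exists := fun z₀ (hz₀ : z₀ ∈ U) => exists_differentiableAt_isPerturbationIso hU hdp hdm
    hδp hδm hD hΔ hDΔ hπp hπm hqp hqm hC hG hωp hωm hηp hηm hz₀
  choose g hg hg' using local_exists
  classical
  -- The diagonal of the local functions. Near each z₀ it agrees with the local function at z₀,
  -- because both express the unique perturbation isomorphism in terms of a nonzero vector.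
  let f : E → ℂ := fun z => if hz : z ∈ U then g z hz z else 0
  have ef : ∀ z (hz : z ∈ U), f z = g z hz z := fun z hz => dif_pos hz
  have hf : ∀ z ∈ U, f z ≠ 0 ∧ ∀ (h : (D z).IsExactSum ιp πp ιm πm)
      (k : (Δ z).IsExactSum jp qp jm qm), ∃ P, (D z).IsPerturbationIso (Δ z) P ∧
          P (detMap h.toHPlus ωp ⊗ₜ[ℂ] dualVector (detMap h.toHMinus ωm)) =
            f z • (detMap k.toHPlus ηp ⊗ₜ[ℂ] dualVector (detMap k.toHMinus ηm)) := fun z hz => by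
    rw [ef z hz]
    exact (hg' z hz).self_of_nhds
  have huniq : ∀ z ∈ U, ∀ P Q, (D z).IsPerturbationIso (Δ z) P → (D z).IsPerturbationIso (Δ z) Q →
      P = Q := fun z hz P Q hP hQ =>
    hP.eq ((hD z hz).finrank_hPlus_eq hC) ((hΔ z hz).finrank_hPlus_eq hG) hQ
  refine ⟨f, fun z₀ hz₀ => ?_, fun z hz => (hf z hz).1, fun z hz => ⟨?_, fun h k P hP => ?_⟩⟩
  · refine ((hg z₀ hz₀).congr_of_eventuallyEq ?_).differentiableWithinAt
    filter_upwards [hg' z₀ hz₀, hU.mem_nhds hz₀] with z h1 hz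
    obtain ⟨P, hP, hP'⟩ := (hf z hz).2 (hD z hz) (hΔ z hz)
    obtain ⟨Q, hQ, hQ'⟩ := h1.2 (hD z hz) (hΔ z hz)
    rw [huniq z hz P Q hP hQ, hQ'] at hP'
    have hne := (hΔ z hz).trivialization_ne_zero hηp hηm
    exact (eq_of_smul_eq_smul_of_ne_zero (𝕜 := ℂ) (V := (Δ z).Det) hne hP').symm
  · obtain ⟨P, hP, -⟩ := (hf z hz).2 (hD z hz) (hΔ z hz)
    exact ⟨P, hP⟩
  · obtain ⟨Q, hQ, hQ'⟩ := (hf z hz).2 h k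
    rw [huniq z hz P Q hP hQ, hQ']

end

end TwoPeriodicComplex

/-! ### Finitely supported direct sums as Hilbert spaces -/

noncomputable section FinitelySupportedSums

/-- All but finitely many members of the family vanish. -/
class IsFinitelySupported {ι : Type*} (A : ι → Type*) : Prop where
  exists_finset : ∃ s : Finset ι, ∀ i ∉ s, Subsingleton (A i)

/-- A finite set of indices that contains all nonzero members of the family. -/
def supportIndices {ι : Type*} (A : ι → Type*) [h : IsFinitelySupported A] : Finset ι :=
  h.exists_finset.choose

theorem subsingleton_of_notMem_supportIndices {ι : Type*} {A : ι → Type*}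
    [h : IsFinitelySupported A] {i : ι} (hi : i ∉ supportIndices A) : Subsingleton (A i) :=
  h.exists_finset.choose_spec i hi

section Algebra

variable {𝕜 : Type*} [Field 𝕜] {ι κ : Type*}
variable {A : ι → Type*} [∀ i, AddCommGroup (A i)] [∀ i, Module 𝕜 (A i)]
variable {B : κ → Type*} [∀ i, AddCommGroup (B i)] [∀ i, Module 𝕜 (B i)]
variable {W : Type*} [AddCommGroup W] [Module 𝕜 W]

theorem FiniteRank.sum {V : Type*} [AddCommGroup V] [Module 𝕜 V] (s : Finset ι)
    {f : ι → V →ₗ[𝕜] W} (hf : ∀ i ∈ s, FiniteRank (f i)) : FiniteRank (∑ i ∈ s, f i) := by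
  classical
  induction s using Finset.induction_on with
  | empty => simpa using FiniteRank.zero
  | insert a s ha ih =>
    rw [Finset.sum_insert ha]
    exact (hf a (by simp)).add (ih fun i hi => hf i (by simp [hi]))

instance DirectSum.finiteDimensional [IsFinitelySupported A] [∀ i, FiniteDimensional 𝕜 (A i)] :
    FiniteDimensional 𝕜 (⨁ i, A i) := by
  let f : (⨁ i, A i) →ₗ[𝕜] ∀ i : supportIndices A, A i :=
    LinearMap.pi fun i => DirectSum.component 𝕜 ι A i
  refine Module.Finite.of_injective f fun x y h => DFinsupp.ext fun i => ?_
  by_cases hi : i ∈ supportIndices A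
  · exact congrFun h ⟨i, hi⟩
  · have := subsingleton_of_notMem_supportIndices hi
    exact Subsingleton.elim _ _

variable [DecidableEq ι] [DecidableEq κ]

theorem DirectSum.toModule_eq_sum [IsFinitelySupported A] (T : ∀ i, A i →ₗ[𝕜] W) :
    DirectSum.toModule 𝕜 ι W T =
      ∑ i ∈ supportIndices A, T i ∘ₗ DirectSum.component 𝕜 ι A i := by
  refine DirectSum.linearMap_ext _ fun i => LinearMap.ext fun x => ?_
  rw [LinearMap.comp_apply, DirectSum.toModule_lof, LinearMap.comp_apply, LinearMap.sum_apply]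
  by_cases hi : i ∈ supportIndices A
  · rw [Finset.sum_eq_single i]
    · rw [LinearMap.comp_apply, DirectSum.component.lof_self]
    · intro j _ hj
      rw [LinearMap.comp_apply, DirectSum.component.of, dif_neg (Ne.symm hj), map_zero]
    · exact fun h => (h hi).elim
  · have := subsingleton_of_notMem_supportIndices hi
    rw [Subsingleton.elim x 0]
    simp

/-- The map of direct sums given by maps of their members that shift the indices. -/
def shiftMap (σ : ι → κ) (T : ∀ i, A i →ₗ[𝕜] B (σ i)) : (⨁ i, A i) →ₗ[𝕜] ⨁ k, B k :=
  DirectSum.toModule 𝕜 ι _ fun i => DirectSum.lof 𝕜 κ B (σ i) ∘ₗ T i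

theorem shiftMap_lof (σ : ι → κ) (T : ∀ i, A i →ₗ[𝕜] B (σ i)) (i : ι) (x : A i) :
    shiftMap σ T (DirectSum.lof 𝕜 ι A i x) = DirectSum.lof 𝕜 κ B (σ i) (T i x) := by
  rw [shiftMap, DirectSum.toModule_lof, LinearMap.comp_apply]

theorem shiftMap_apply {σ : ι → κ} (hσ : Function.Injective σ) (T : ∀ i, A i →ₗ[𝕜] B (σ i))
    (x : ⨁ i, A i) (i : ι) : shiftMap σ T x (σ i) = T i (x i) := by
  induction x using DirectSum.induction_on with
  | zero => simp
  | of j x =>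
    rw [← DirectSum.lof_eq_of 𝕜, shiftMap_lof]
    by_cases h : j = i
    · subst h
      rw [DirectSum.lof_apply, DirectSum.lof_apply]
    · have h1 := DirectSum.component.of 𝕜 (M := A) i j x
      have h2 := DirectSum.component.of 𝕜 (M := B) (σ i) (σ j) (T j x)
      rw [dif_neg h] at h1
      rw [dif_neg (hσ.ne h)] at h2
      rw [DirectSum.apply_eq_component 𝕜, DirectSum.apply_eq_component 𝕜, h1, h2, map_zero]
  | add x y hx hy => rw [map_add, DirectSum.add_apply, DirectSum.add_apply, hx, hy, map_add]

theorem finiteRank_shiftMap_sub [IsFinitelySupported A] {σ : ι → κ}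
    {S T : ∀ i, A i →ₗ[𝕜] B (σ i)} (h : ∀ i, FiniteRank (S i - T i)) :
    FiniteRank (shiftMap σ S - shiftMap σ T) := by
  rw [shiftMap, shiftMap, DirectSum.toModule_eq_sum, DirectSum.toModule_eq_sum,
    ← Finset.sum_sub_distrib]
  exact FiniteRank.sum _ fun i _ => ((FiniteRank.refl _).comp_sub_comp (h i)).comp_sub_comp
    (FiniteRank.refl _)

/-- Degreewise exactness passes to the folded complex: injectivity of the shift isolates the
components of a cycle, each is a boundary, and the element is the finite sum of its components. -/
theorem exists_shiftMap_eq {C : ι → Type*} [∀ i, AddCommGroup (C i)] [∀ i, Module 𝕜 (C i)]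
    {σ : ι → κ} {τ : κ → ι} (hσ : Function.Injective σ) (hτ : Function.Surjective τ)
    {T : ∀ i, A i →ₗ[𝕜] B (σ i)} {S : ∀ k, B k →ₗ[𝕜] A (τ k)} {π : ∀ i, A i →ₗ[𝕜] C i}
    (h : ∀ k (x : A (τ k)), T (τ k) x = 0 → π (τ k) x = 0 → ∃ y, S k y = x)
    (x : ⨁ i, A i) (hT : shiftMap σ T x = 0) (hπ : DirectSum.lmap π x = 0) :
    ∃ y, shiftMap τ S y = x := by
  classical
  have h1 : ∀ i, DirectSum.of A i (x i) ∈ (shiftMap τ S).range := fun i => by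
    obtain ⟨k, rfl⟩ := hτ i
    have hT' := shiftMap_apply hσ T x (τ k)
    rw [hT, DirectSum.zero_apply] at hT'
    have hπ' : π (τ k) (x (τ k)) = 0 := by
      rw [← DirectSum.lmap_apply, hπ, DirectSum.zero_apply]
    obtain ⟨y, hy⟩ := h k (x (τ k)) hT'.symm hπ'
    exact ⟨DirectSum.lof 𝕜 κ B k y, by rw [shiftMap_lof, hy, DirectSum.lof_eq_of]⟩
  have h2 : x ∈ (shiftMap τ S).range := by
    rw [← DirectSum.sum_support_of x]
    exact Submodule.sum_mem _ fun i _ => h1 i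
  exact h2

end Algebra

section Topology

variable {ι κ : Type*}
variable (A : ι → Type*) [∀ i, NormedAddCommGroup (A i)] [∀ i, InnerProductSpace ℂ (A i)]
variable [IsFinitelySupported A]

/-- The bijection between a finitely supported direct sum and a finite `ℓ²` sum. -/
def DirectSum.toPiLp : (⨁ i, A i) →ₗ[ℂ] PiLp 2 fun i : supportIndices A => A i :=
  (WithLp.linearEquiv 2 ℂ (∀ i : supportIndices A, A i)).symm.toLinearMap ∘ₗ
    LinearMap.pi fun i => DirectSum.component ℂ ι A i

theorem DirectSum.toPiLp_apply (x : ⨁ i, A i) (i : supportIndices A) :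
    DirectSum.toPiLp A x i = x i := rfl

theorem DirectSum.toPiLp_injective : Function.Injective (DirectSum.toPiLp A) := by
  refine fun x y h => DFinsupp.ext fun i => ?_
  by_cases hi : i ∈ supportIndices A
  · exact congrArg (fun f : PiLp 2 fun i : supportIndices A => A i => f ⟨i, hi⟩) h
  · have := subsingleton_of_notMem_supportIndices hi
    exact Subsingleton.elim _ _

theorem DirectSum.toPiLp_surjective : Function.Surjective (DirectSum.toPiLp A) := by
  classical
  intro y
  refine ⟨∑ i : supportIndices A, DirectSum.lof ℂ ι A i (y i), ?_⟩
  ext j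
  rw [DirectSum.toPiLp_apply]
  change DirectSum.component ℂ ι A j _ = _
  rw [map_sum, Finset.sum_eq_single j]
  · rw [DirectSum.component.lof_self]
  · intro i _ hij
    rw [DirectSum.component.of, dif_neg fun h => hij (Subtype.ext h)]
  · simp

/-- Only finitely many summands are nonzero, so the direct sum acquires the Hilbert space structure
of a finite ℓ² sum. The analytic arguments for the folded complexes take place in it. -/
instance DirectSum.normedAddCommGroup : NormedAddCommGroup (⨁ i, A i) :=
  NormedAddCommGroup.induced _ _ (DirectSum.toPiLp A) (DirectSum.toPiLp_injective A)

instance DirectSum.innerProductSpace : InnerProductSpace ℂ (⨁ i, A i) :=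
  InnerProductSpace.induced (DirectSum.toPiLp A)

theorem DirectSum.isometry_toPiLp : Isometry (DirectSum.toPiLp A) :=
  fun _ _ => rfl

instance DirectSum.completeSpace [∀ i, CompleteSpace (A i)] : CompleteSpace (⨁ i, A i) :=
  ((DirectSum.isometry_toPiLp A).isUniformInducing.completeSpace_congr
    (DirectSum.toPiLp_surjective A)).2 inferInstance

variable {A}

theorem DirectSum.continuous_of_apply {S : Type*} [TopologicalSpace S] {f : S → ⨁ i, A i}
    (hf : ∀ i, Continuous fun s => f s i) : Continuous f := by
  rw [(DirectSum.isometry_toPiLp A).isUniformInducing.isInducing.continuous_iff]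
  exact (PiLp.continuous_toLp 2 _).comp (continuous_pi fun i => hf i)

theorem DirectSum.continuous_apply (i : ι) : Continuous fun x : ⨁ i, A i => x i := by
  by_cases hi : i ∈ supportIndices A
  · have h := (PiLp.continuous_ofLp 2 fun i : supportIndices A => A i).comp
      (DirectSum.isometry_toPiLp A).continuous
    exact (_root_.continuous_apply (⟨i, hi⟩ : supportIndices A)).comp h
  · have := subsingleton_of_notMem_supportIndices hi
    exact continuous_of_const fun _ _ => Subsingleton.elim _ _

theorem DirectSum.continuous_lmap {B : ι → Type*} [∀ i, NormedAddCommGroup (B i)]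
    [∀ i, InnerProductSpace ℂ (B i)] [IsFinitelySupported B] {f : ∀ i, A i →ₗ[ℂ] B i}
    (hf : ∀ i, Continuous (f i)) : Continuous (DirectSum.lmap f) :=
  DirectSum.continuous_of_apply fun i => (hf i).comp (DirectSum.continuous_apply i)

variable [DecidableEq ι] [DecidableEq κ]

theorem DirectSum.continuous_lof (i : ι) : Continuous (DirectSum.lof ℂ ι A i) := by
  refine DirectSum.continuous_of_apply fun j => ?_
  change Continuous fun x => DirectSum.component ℂ ι A j (DirectSum.lof ℂ ι A i x)
  by_cases h : i = j
  · subst h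
    simpa only [DirectSum.component.lof_self] using continuous_id'
  · simpa only [DirectSum.component.of, dif_neg h] using continuous_const

theorem HolOn.shiftMap {E : Type*} [NormedAddCommGroup E] [NormedSpace ℂ E] {U : Set E}
    {B : κ → Type*} [∀ i, NormedAddCommGroup (B i)] [∀ i, InnerProductSpace ℂ (B i)]
    [IsFinitelySupported B] {σ : ι → κ} {T : E → ∀ i, A i →ₗ[ℂ] B (σ i)}
    (hT : ∀ i, HolOn (fun z => T z i) U) : HolOn (fun z => shiftMap σ (T z)) U := by
  refine HolOn.congr (F := fun z => ∑ i ∈ supportIndices A,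
    (DirectSum.lof ℂ κ B (σ i) ∘ₗ T z i) ∘ₗ DirectSum.component ℂ ι A i)
    (HolOn.sum _ fun i _ => ?_) fun z _ => DirectSum.toModule_eq_sum _
  exact ((HolOn.const (DirectSum.continuous_lof _)).comp (hT i)).comp
    (HolOn.const (DirectSum.continuous_apply i))

end Topology

end FinitelySupportedSums

/-! ### Even and odd parts of bounded graded spaces -/

noncomputable section GradedParts

theorem IsBoundedGrading.isFinitelySupported {X : ℤ → Type*} (hX : IsBoundedGrading X)
    (p : ℤ → Prop) : IsFinitelySupported fun j : {j : ℤ // p j} => X j := by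
  classical
  obtain ⟨J, hJ⟩ := hX
  refine ⟨(Finset.Ioo (-(J : ℤ)) J).subtype p, fun j hj => hJ j ?_⟩
  rw [Finset.mem_subtype, Finset.mem_Ioo, ← abs_lt, not_lt] at hj
  exact hj

/-- The shift of degrees from even to odd indices. -/
abbrev evenPred (j : {j : ℤ // Even j}) : {j : ℤ // Odd j} := ⟨j.1 - 1, j.2.sub_odd odd_one⟩

/-- The shift of degrees from odd to even indices. -/
abbrev oddPred (j : {j : ℤ // Odd j}) : {j : ℤ // Even j} := ⟨j.1 - 1, j.2.sub_odd odd_one⟩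

theorem evenPred_injective : Function.Injective evenPred := fun _ _ h =>
  Subtype.ext (sub_left_injective (congrArg Subtype.val h))

theorem oddPred_injective : Function.Injective oddPred := fun _ _ h =>
  Subtype.ext (sub_left_injective (congrArg Subtype.val h))

theorem evenPred_surjective : Function.Surjective evenPred := fun j =>
  ⟨⟨j.1 + 1, j.2.add_odd odd_one⟩, Subtype.ext (add_sub_cancel_right _ _)⟩

theorem oddPred_surjective : Function.Surjective oddPred := fun j =>
  ⟨⟨j.1 + 1, j.2.add_odd odd_one⟩, Subtype.ext (add_sub_cancel_right _ _)⟩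

end GradedParts

/-! ### Folding the sum of an exact complex and a trivial one -/

namespace HilbertComplex

noncomputable section

variable {X : ℤ → Type*} [∀ j, NormedAddCommGroup (X j)] [∀ j, InnerProductSpace ℂ (X j)]
variable {C : ℤ → Type*} [∀ j, NormedAddCommGroup (C j)] [∀ j, InnerProductSpace ℂ (C j)]
variable {Z : ℤ → Type*} [∀ j, NormedAddCommGroup (Z j)] [∀ j, InnerProductSpace ℂ (Z j)]

/-- The projection of `Z_j = X_j ⊕ C_j` onto `C_j`. -/
def trivialProj (e : ∀ j, WithLp 2 (X j × C j) ≃L[ℂ] Z j) (j : ℤ) : Z j →ₗ[ℂ] C j :=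
  LinearMap.snd ℂ (X j) (C j) ∘ₗ
    (WithLp.prodContinuousLinearEquiv 2 ℂ (X j) (C j)).toLinearMap ∘ₗ (e j).symm.toLinearMap

theorem continuous_trivialProj (e : ∀ j, WithLp 2 (X j × C j) ≃L[ℂ] Z j) (j : ℤ) :
    Continuous (trivialProj e j) :=
  continuous_snd.comp ((WithLp.prodContinuousLinearEquiv 2 ℂ (X j) (C j)).continuous.comp
    (e j).symm.continuous)

theorem trivialProj_trivialIncl (e : ∀ j, WithLp 2 (X j × C j) ≃L[ℂ] Z j) (j : ℤ) (c : C j) :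
    trivialProj e j (trivialIncl e j c) = c := by
  simp [trivialProj, trivialIncl]

variable [∀ j, CompleteSpace (X j)] [∀ j, CompleteSpace (Z j)]

theorem fold_dp (D : HilbertComplex X) :
    D.fold.dp = shiftMap evenPred fun j => (D.d j).toLinearMap := rfl

theorem fold_dm (D : HilbertComplex X) :
    D.fold.dm = shiftMap oddPred fun j => (D.d j).toLinearMap := rfl

theorem isFiniteRankPerturbation_fold {D E : HilbertComplex X}
    (h : ∀ j, FiniteRank (D.d j - E.d j).toLinearMap) :
    D.fold.IsFiniteRankPerturbation E.fold := by
  have := D.bounded.isFinitelySupported Even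
  have := D.bounded.isFinitelySupported Odd
  constructor
  · rw [fold_dp, fold_dp]
    exact finiteRank_shiftMap_sub fun j => h j
  · rw [fold_dm, fold_dm]
    exact finiteRank_shiftMap_sub fun j => h j

theorem trivialProj_addTrivial_d (D : HilbertComplex X) (hC : IsBoundedGrading C)
    (e : ∀ j, WithLp 2 (X j × C j) ≃L[ℂ] Z j) (j : ℤ) (x : Z j) :
    trivialProj e (j - 1) ((D.addTrivial hC e).d j x) = 0 := by
  simp [trivialProj, addTrivial]

theorem exists_addTrivial_d_eq {D : HilbertComplex X} (hD : D.IsExact) (hC : IsBoundedGrading C)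
    (e : ∀ j, WithLp 2 (X j × C j) ≃L[ℂ] Z j) (j : ℤ) (x : Z (j - 1))
    (hx : (D.addTrivial hC e).d (j - 1) x = 0) (hx' : trivialProj e (j - 1) x = 0) :
    ∃ y, (D.addTrivial hC e).d j y = x := by
  obtain ⟨w, rfl⟩ := (e (j - 1)).surjective x
  obtain ⟨⟨x, c⟩, rfl⟩ := (WithLp.prodContinuousLinearEquiv 2 ℂ (X (j - 1)) (C (j - 1))).symm.surjective w
  have hc : c = 0 := by simpa [trivialProj] using hx'
  have hdx : D.d (j - 1) x = 0 := by simpa [addTrivial] using hx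
  obtain ⟨y, rfl⟩ := (hD j x).1 hdx
  refine ⟨e j ((WithLp.prodContinuousLinearEquiv 2 ℂ (X j) (C j)).symm (y, 0)), ?_⟩
  simp [addTrivial, hc]

theorem isExactSum_addTrivial {D : HilbertComplex X} (hD : D.IsExact) (hC : IsBoundedGrading C)
    (e : ∀ j, WithLp 2 (X j × C j) ≃L[ℂ] Z j) :
    (D.addTrivial hC e).fold.IsExactSum
      (DirectSum.lmap fun j : {j : ℤ // Even j} => trivialIncl e j.1)
      (DirectSum.lmap fun j : {j : ℤ // Even j} => trivialProj e j.1)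
      (DirectSum.lmap fun j : {j : ℤ // Odd j} => trivialIncl e j.1)
      (DirectSum.lmap fun j : {j : ℤ // Odd j} => trivialProj e j.1) where
  πp_ιp c := DFinsupp.ext fun i => trivialProj_trivialIncl e i.1 (c i)
  πm_ιm c := DFinsupp.ext fun i => trivialProj_trivialIncl e i.1 (c i)
  dp_ιp c := by
    have h : (D.addTrivial hC e).fold.dp ∘ₗ
        (DirectSum.lmap fun j : {j : ℤ // Even j} => trivialIncl e j.1) = 0 :=
      DirectSum.linearMap_ext _ fun i => LinearMap.ext fun x => by
        simp [fold_dp, shiftMap_lof, addTrivial_d_trivialIncl]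
    exact LinearMap.congr_fun h c
  dm_ιm c := by
    have h : (D.addTrivial hC e).fold.dm ∘ₗ
        (DirectSum.lmap fun j : {j : ℤ // Odd j} => trivialIncl e j.1) = 0 :=
      DirectSum.linearMap_ext _ fun i => LinearMap.ext fun x => by
        simp [fold_dm, shiftMap_lof, addTrivial_d_trivialIncl]
    exact LinearMap.congr_fun h c
  πm_dp x := by
    have h : (DirectSum.lmap fun j : {j : ℤ // Odd j} => trivialProj e j.1) ∘ₗ
        (D.addTrivial hC e).fold.dp = 0 :=
      DirectSum.linearMap_ext _ fun i => LinearMap.ext fun x => by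
        simp [fold_dp, shiftMap_lof, trivialProj_addTrivial_d]
    exact LinearMap.congr_fun h x
  πp_dm y := by
    have h : (DirectSum.lmap fun j : {j : ℤ // Even j} => trivialProj e j.1) ∘ₗ
        (D.addTrivial hC e).fold.dm = 0 :=
      DirectSum.linearMap_ext _ fun i => LinearMap.ext fun x => by
        simp [fold_dm, shiftMap_lof, trivialProj_addTrivial_d]
    exact LinearMap.congr_fun h y
  exact_plus x h1 h2 := by
    rw [fold_dp] at h1
    rw [fold_dm]
    exact exists_shiftMap_eq evenPred_injective oddPred_surjective
      (fun k x hx hx' => exists_addTrivial_d_eq hD hC e k.1 x hx hx') x h1 h2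
  exact_minus x h1 h2 := by
    rw [fold_dm] at h1
    rw [fold_dp]
    exact exists_shiftMap_eq oddPred_injective evenPred_surjective
      (fun k x hx hx' => exists_addTrivial_d_eq hD hC e k.1 x hx hx') x h1 h2

theorem holOn_addTrivial_d {E : Type*} [NormedAddCommGroup E] [NormedSpace ℂ E] {U : Set E}
    {D : E → HilbertComplex X} {j : ℤ} (hD : DifferentiableOn ℂ (fun z => (D z).d j) U)
    (hC : IsBoundedGrading C) (e : ∀ j, WithLp 2 (X j × C j) ≃L[ℂ] Z j) :
    HolOn (fun z => (((D z).addTrivial hC e).d j).toLinearMap) U := by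
  let ι : X (j - 1) →L[ℂ] Z (j - 1) :=
    ((e (j - 1) : WithLp 2 (X (j - 1) × C (j - 1)) →L[ℂ] Z (j - 1)).comp
      ((WithLp.prodContinuousLinearEquiv 2 ℂ (X (j - 1)) (C (j - 1))).symm :
        X (j - 1) × C (j - 1) →L[ℂ] WithLp 2 (X (j - 1) × C (j - 1)))).comp
      (ContinuousLinearMap.inl ℂ (X (j - 1)) (C (j - 1)))
  let π : Z j →L[ℂ] X j := (ContinuousLinearMap.fst ℂ (X j) (C j)).comp
    ((WithLp.prodContinuousLinearEquiv 2 ℂ (X j) (C j) :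
      WithLp 2 (X j × C j) →L[ℂ] X j × C j).comp ((e j).symm : Z j →L[ℂ] WithLp 2 (X j × C j)))
  refine ⟨fun z => ι.comp (((D z).d j).comp π), ?_, fun z _ => rfl⟩
  exact (differentiableOn_const _).clm_comp (hD.clm_comp (differentiableOn_const _))

/-- The maps from C to homology used in i_C are definitionally those of the exact sum structure, so
only the scalar 1 has to be removed. -/
theorem trivialization_one {D : HilbertComplex X} (hD : D.IsExact) (hC : IsBoundedGrading C)
    (e : ∀ j, WithLp 2 (X j × C j) ≃L[ℂ] Z j)
    (ωp : DetLine ℂ (EvenPart C)) (ωm : DetLine ℂ (OddPart C)) :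
    D.trivialization hC e ωp ωm 1 = detMap (isExactSum_addTrivial hD hC e).toHPlus ωp ⊗ₜ[ℂ]
      dualVector (detMap (isExactSum_addTrivial hD hC e).toHMinus ωm) :=
  one_smul ℂ _

theorem bijective_trivialization [∀ j, FiniteDimensional ℂ (C j)] {D : HilbertComplex X}
    (hD : D.IsExact) (hC : IsBoundedGrading C) (e : ∀ j, WithLp 2 (X j × C j) ≃L[ℂ] Z j)
    {ωp : DetLine ℂ (EvenPart C)} {ωm : DetLine ℂ (OddPart C)} (hωp : ωp ≠ 0) (hωm : ωm ≠ 0) :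
    Function.Bijective (D.trivialization hC e ωp ωm) := by
  have := hC.isFinitelySupported Even
  have := hC.isFinitelySupported Odd
  have h := isExactSum_addTrivial hD hC e
  have hne := h.trivialization_ne_zero hωp hωm
  have h1 : Module.finrank ℂ (D.addTrivial hC e).fold.Det = 1 := h.isFredholm.finrank_det
  refine ⟨fun a b hab => eq_of_smul_eq_smul_of_ne_zero (𝕜 := ℂ)
    (V := (D.addTrivial hC e).fold.Det) hne hab, fun x => ?_⟩
  exact exists_smul_eq_of_finrank_eq_one (K := ℂ) (V := (D.addTrivial hC e).fold.Det) h1 hne x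

end

end HilbertComplex

/-! ### The proposition -/

set_option maxHeartbeats 1000000 in
theorem proposition5p2 {k : ℕ} (U : Set (EuclideanSpace ℂ (Fin k))) (hU : IsOpen U)
    (hUc : IsConnected U)
    {X Y C Γ Z : ℤ → Type*}
    [∀ j, NormedAddCommGroup (X j)] [∀ j, InnerProductSpace ℂ (X j)] [∀ j, CompleteSpace (X j)]
    [∀ j, NormedAddCommGroup (Y j)] [∀ j, InnerProductSpace ℂ (Y j)] [∀ j, CompleteSpace (Y j)]
    [∀ j, NormedAddCommGroup (C j)] [∀ j, InnerProductSpace ℂ (C j)]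
    [∀ j, FiniteDimensional ℂ (C j)]
    [∀ j, NormedAddCommGroup (Γ j)] [∀ j, InnerProductSpace ℂ (Γ j)]
    [∀ j, FiniteDimensional ℂ (Γ j)]
    [∀ j, NormedAddCommGroup (Z j)] [∀ j, InnerProductSpace ℂ (Z j)] [∀ j, CompleteSpace (Z j)]
    -- the two holomorphic families of exact complexes
    (D : EuclideanSpace ℂ (Fin k) → HilbertComplex X)
    (Δ : EuclideanSpace ℂ (Fin k) → HilbertComplex Y)
    (hD : IsHolomorphicFamily D U) (hΔ : IsHolomorphicFamily Δ U)
    (hDex : ∀ z ∈ U, (D z).IsExact) (hΔex : ∀ z ∈ U, (Δ z).IsExact)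
    -- the trivial complexes of index zero
    (hC : IsBoundedGrading C) (hΓ : IsBoundedGrading Γ)
    (hCind : Module.finrank ℂ (EvenPart C) = Module.finrank ℂ (OddPart C))
    (hΓind : Module.finrank ℂ (EvenPart Γ) = Module.finrank ℂ (OddPart Γ))
    -- the common chains `X_j ⊕ C_j = Z_j = Y_j ⊕ Γ_j`
    (e : ∀ j, WithLp 2 (X j × C j) ≃L[ℂ] Z j) (e' : ∀ j, WithLp 2 (Y j × Γ j) ≃L[ℂ] Z j)
    -- the nonzero vectors that define `i_C` and `i_Γ`
    (ωp : DetLine ℂ (EvenPart C)) (ωm : DetLine ℂ (OddPart C)) (hωp : ωp ≠ 0) (hωm : ωm ≠ 0)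
    (ηp : DetLine ℂ (EvenPart Γ)) (ηm : DetLine ℂ (OddPart Γ)) (hηp : ηp ≠ 0) (hηm : ηm ≠ 0)
    (hfin : ∀ z ∈ U, ∀ j, FiniteRank
      (((D z).addTrivial hC e).d j - ((Δ z).addTrivial hΓ e').d j : Z j →L[ℂ] Z (j - 1)).toLinearMap)
    (htr : ∀ j, TraceNormHolomorphicOn
      (fun z => ((D z).addTrivial hC e).d j - ((Δ z).addTrivial hΓ e').d j) U) :
    -- the perturbation isomorphism, `i_C` and `i_Γ` are well defined
    (∀ z ∈ U,
      (∃! P, ((D z).addTrivial hC e).fold.IsPerturbationIso ((Δ z).addTrivial hΓ e').fold P) ∧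
      Function.Bijective ((D z).trivialization hC e ωp ωm) ∧
      Function.Bijective ((Δ z).trivialization hΓ e' ηp ηm)) ∧
    -- `f z = i_Γ⁻¹ P(Δ^z ⊕ Γ, D^z ⊕ C) i_C` is holomorphic with values in `ℂ \ {0}`
    ∃ f : EuclideanSpace ℂ (Fin k) → ℂ, DifferentiableOn ℂ f U ∧ (∀ z ∈ U, f z ≠ 0) ∧
      ∀ z ∈ U, ∀ P,
        ((D z).addTrivial hC e).fold.IsPerturbationIso ((Δ z).addTrivial hΓ e').fold P →
        P ((D z).trivialization hC e ωp ωm 1) = (Δ z).trivialization hΓ e' ηp ηm (f z) := by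

  have hne : U.Nonempty := hUc.nonempty
  -- A point of U supplies a complex with chains Z, and with it the boundedness of the grading that
  -- gives the even and odd parts of Z their Hilbert structures.
  obtain ⟨z₁, hz₁⟩ := hne
  have hZ := ((D z₁).addTrivial hC e).bounded
  have := hZ.isFinitelySupported Even
  have := hZ.isFinitelySupported Odd
  have := hC.isFinitelySupported Even
  have := hC.isFinitelySupported Odd
  have := hΓ.isFinitelySupported Even
  have := hΓ.isFinitelySupported Odd
  have hDs := fun z hz => HilbertComplex.isExactSum_addTrivial (hDex z hz) hC e
  have hΔs := fun z hz => HilbertComplex.isExactSum_addTrivial (hΔex z hz) hΓ e'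
  obtain ⟨f, hf, hf0, hfP⟩ := TwoPeriodicComplex.exists_differentiableOn_isPerturbationIso hU
    (D := fun z => ((D z).addTrivial hC e).fold) (Δ := fun z => ((Δ z).addTrivial hΓ e').fold)
    (HolOn.shiftMap fun j => HilbertComplex.holOn_addTrivial_d (hD j) hC e)
    (HolOn.shiftMap fun j => HilbertComplex.holOn_addTrivial_d (hD j) hC e)
    (HolOn.shiftMap fun j => HilbertComplex.holOn_addTrivial_d (hΔ j) hΓ e')
    (HolOn.shiftMap fun j => HilbertComplex.holOn_addTrivial_d (hΔ j) hΓ e')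
    hDs hΔs (fun z hz => HilbertComplex.isFiniteRankPerturbation_fold (hfin z hz))
    (DirectSum.continuous_lmap fun j => HilbertComplex.continuous_trivialProj e j)
    (DirectSum.continuous_lmap fun j => HilbertComplex.continuous_trivialProj e j)
    (DirectSum.continuous_lmap fun j => HilbertComplex.continuous_trivialProj e' j)
    (DirectSum.continuous_lmap fun j => HilbertComplex.continuous_trivialProj e' j)
    hCind hΓind hωp hωm hηp hηm
  refine ⟨fun z hz => ⟨?_, HilbertComplex.bijective_trivialization (hDex z hz) hC e hωp hωm,
    HilbertComplex.bijective_trivialization (hΔex z hz) hΓ e' hηp hηm⟩, f, hf, hf0,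
    fun z hz P hP => ?_⟩
  · obtain ⟨P, hP⟩ := (hfP z hz).1
    exact ⟨P, hP, fun Q hQ => hQ.eq ((hDs z hz).finrank_hPlus_eq hCind)
      ((hΔs z hz).finrank_hPlus_eq hΓind) hP⟩
  · exact (congrArg P (HilbertComplex.trivialization_one (hDex z hz) hC e ωp ωm)).trans
      ((hfP z hz).2 (hDs z hz) (hΔs z hz) P hP)
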